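/- For $n,k\in\mathbb{Z}_+$, a $k$-SIIRV of order $n$ is the distribution of a sum of $n$ independent random variables, each with values in $\{0,1,\dots,k-1\}$. Let $d_{\mathrm{TV}}(\mathbf P,\mathbf Q)=\tfrac12\|\mathbf P-\mathbf Q\|_1$. A learning algorithm with $N$ samples is a (possibly randomized) map, with no restriction on running time, that takes $N$ independent samples from an unknown distribution $\mathbf P$ and outputs a hypothesis distribution $\mathbf H$ on $\{0,1,2,\dots\}$; it learns $\mathbf P$ to within $\epsilon$ if $d_{\mathrm{TV}}(\mathbf H,\mathbf P)\le\epsilon$ with probability at least $2/3$. Theorem. There are universal constants $A\ge 1$, $c,C>0$ and $d\in\mathbb{N}$ such that the following holds for every integer $k\ge 1$ and every $0<\epsilon\le 1/(A k^{d})$. (Upper bound.) There are an integer $N\le C\,\frac{k}{\epsilon^{2}}\sqrt{\log(1/\epsilon)}$ and a learning algorithm with $N$ samples that, for every $n\ge 1$, learns every $k$-SIIRV of order $n$ to within $\epsilon$. (Lower bound.) If $k\ge 2$, there is an order $n\ge 1$ such that every learning algorithm (which may depend on $n$, $k$ and $\epsilon$) that learns every $k$-SIIRV of order $n$ to within $\epsilon$,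 or that outputs a hypothesis $\mathbf H$ with $\mathbb{E}[d_{\mathrm{TV}}(\mathbf H,\mathbf P)]\le\epsilon$ for every $k$-SIIRV $\mathbf P$ of order $n$, uses at least $c\,\frac{k}{\epsilon^{2}}\sqrt{\log(1/\epsilon)}$ samples. -/

import Mathlib

open MeasureTheory ProbabilityTheory

open scoped ENNReal

/-- `P` is a `k`-SIIRV of order `n`: the law of the sum of `n` independent random variables, each of
them with values in `{0, 1, …, k - 1}` (the `i`-th one with law `Q i`). -/
def IsSIIRV (n k : ℕ) (P : ProbabilityMeasure ℕ) : Prop :=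
  ∃ Q : Fin n → ProbabilityMeasure ℕ,
    (∀ i, ∀ᵐ x ∂(Q i : Measure ℕ), x < k) ∧
      (P : Measure ℕ) =
        (Measure.pi fun i => (Q i : Measure ℕ)).map (fun x : Fin n → ℕ => ∑ i, x i)

/-- Total variation distance of two distributions on `ℕ`, as one half of the `ℓ¹` distance of the
probability mass functions. -/
noncomputable def tvDist (P Q : ProbabilityMeasure ℕ) : ℝ :=
  1 / 2 * ∑' j : ℕ, |(P : Measure ℕ).real {j} - (Q : Measure ℕ).real {j}|

/-- A (possibly randomized) learning algorithm that uses `N` samples, in the information-theoretic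
sense, is a Markov kernel `𝒜` from `N`-tuples of samples to hypothesis distributions. This is the
law of the hypothesis that it outputs when the samples are i.i.d. with law `P`. -/
noncomputable def hypothesisLaw {N : ℕ} (𝒜 : Kernel (Fin N → ℕ) (ProbabilityMeasure ℕ))
    (P : ProbabilityMeasure ℕ) : Measure (ProbabilityMeasure ℕ) :=
  𝒜 ∘ₘ (Measure.pi fun _ : Fin N => (P : Measure ℕ))

/-- On i.i.d. samples from `P`, the algorithm `𝒜` outputs with probability at least `2 / 3` a
hypothesis that is within total variation distance `ε` of `P`. -/
def Learns {N : ℕ} (𝒜 : Kernel (Fin N → ℕ) (ProbabilityMeasure ℕ)) (ε : ℝ)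
    (P : ProbabilityMeasure ℕ) : Prop :=
  2 / 3 ≤ hypothesisLaw 𝒜 P {H | tvDist H P ≤ ε}

/-- On i.i.d. samples from `P`, the expected total variation distance between the output of `𝒜` and
`P` is at most `ε`. -/
def LearnsInExpectation {N : ℕ} (𝒜 : Kernel (Fin N → ℕ) (ProbabilityMeasure ℕ)) (ε : ℝ)
    (P : ProbabilityMeasure ℕ) : Prop :=
  ∫⁻ H, ENNReal.ofReal (tvDist H P) ∂(hypothesisLaw 𝒜 P) ≤ ENNReal.ofReal ε

/-! Upper bound. Let `E(ξ)` be the sum over the summands of half of `1 - |χᵢ(ξ)|²`. The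
characteristic function of the sum is at most `exp (-E)`, and both `2 E` and twice the variance `σ²`
are sums over the differences `j` of two independent copies of a summand, with the same weights and
with `1 - cos (2 π j ξ)` or `j²` as the function that is averaged. If `σ` is at least of order `k`,
the weights can be rounded down to a multiset of only `k` differences with common weight `s² / k³`,
where `s` is a rough value of `σ`. The resulting trigonometric polynomial `f` lies below `E`, and by
convexity of `exp` the set where `f ≲ Λ` has measure `O(k √Λ / σ)`. A kernel estimator whose Fourier
multiplier is a smooth cutoff to this set has a bias controlled by `exp (-Λ / 2)`, and its variance
is the measure of the set divided by the sample size. Passing from weighted `ℓ²` to `ℓ¹` by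
Cauchy–Schwarz costs a factor `σ`, which cancels: the squared `ℓ¹` error is of order `k √Λ / N`.
With `Λ = 8 log (1 / ε)` this is the claimed rate (`exists_measure_smoothKernelEstimator_le`). The
multiset is unknown, but there are at most `4 ^ k` of them, so minimum distance selection on
Yatracos sets finds a good one with `O(k / ε²)` further samples (`ellOne_yatracosSelect_le`). Nine
samples determine the scale up to a constant (`measure_spread_bad_le`), and for `σ ≤ k` the
empirical distribution suffices.

Lower bound. Take about `log (1 / ε) / 100` Bernoulli variables with distinct success probabilities,
stretched by the factor `κ = k - 1`, and add one lazy uniform variable on `{0, …, κ}`. The products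
of all but one Bernoulli polynomial span all polynomials of lower degree, so suitable small
perturbations of the factors change the product, to first order, by any chosen `X ^ (κ q + r) - X ^
(κ (q + 1))`. This yields a cube with about `κ √n` independent directions, all located where the
base distribution has mass of order `1 / (κ √n)` (`exists_hard_family`). The interpolation
coefficients are exponential in `n`, hence only a small power of `1 / ε`, and the second order terms
are negligible. Assouad's method (`assouad_false`), with chi-square divergence to compare
neighbours, gives the bound. -/

/-! ### Generating polynomials and SIIRVs. -/

/-- `q` is the generating polynomial of a probability distribution on `{0, …, k - 1}`. -/
structure IsProbPoly (k : ℕ) (q : Polynomial ℝ) : Prop where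
  coeff_nonneg : ∀ x, 0 ≤ q.coeff x
  coeff_eq_zero : ∀ x, k ≤ x → q.coeff x = 0
  eval_one : q.eval 1 = 1

theorem IsProbPoly.mono {k l : ℕ} (hkl : k ≤ l) {q : Polynomial ℝ} (hq : IsProbPoly k q) :
    IsProbPoly l q :=
  ⟨hq.coeff_nonneg, fun x hx => hq.coeff_eq_zero x (hkl.trans hx), hq.eval_one⟩

theorem IsProbPoly.eq_sum {k : ℕ} {q : Polynomial ℝ} (hq : IsProbPoly k q) :
    q = ∑ x ∈ Finset.range k, Polynomial.monomial x (q.coeff x) := by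
  ext y
  simp only [Polynomial.finsetSum_coeff, Polynomial.coeff_monomial]
  rw [Finset.sum_ite_eq' (Finset.range k) y]
  split_ifs with h
  · rfl
  · exact hq.coeff_eq_zero y (by simpa using h)

theorem IsProbPoly.eval_eq {k : ℕ} {q : Polynomial ℝ} (hq : IsProbPoly k q) (t : ℝ) :
    q.eval t = ∑ x ∈ Finset.range k, q.coeff x * t ^ x := by
  conv_lhs => rw [hq.eq_sum]
  simp [Polynomial.eval_finsetSum]

theorem IsProbPoly.sum_coeff {k : ℕ} {q : Polynomial ℝ} (hq : IsProbPoly k q) :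
    ∑ x ∈ Finset.range k, q.coeff x = 1 := by
  have := hq.eval_eq 1
  rw [hq.eval_one] at this
  simpa using this.symm

theorem IsProbPoly.one : IsProbPoly 1 1 :=
  ⟨fun x => by rw [Polynomial.coeff_one]; split_ifs <;> norm_num,
    fun x hx => by rw [Polynomial.coeff_one, if_neg (by omega)], by simp⟩

theorem IsProbPoly.natDegree_lt {k : ℕ} {q : Polynomial ℝ} (hq : IsProbPoly k q) :
    q.natDegree < k := by
  by_contra! h
  have h0 : q ≠ 0 := by
    rintro rfl
    simpa using hq.eval_one
  exact h0 (Polynomial.leadingCoeff_eq_zero.mp (hq.coeff_eq_zero _ h))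

theorem IsProbPoly.mul {k l : ℕ} {p q : Polynomial ℝ} (hp : IsProbPoly (k + 1) p)
    (hq : IsProbPoly (l + 1) q) : IsProbPoly (k + l + 1) (p * q) := by
  refine ⟨fun x => ?_, fun x hx => ?_, by simp [hp.eval_one, hq.eval_one]⟩
  · rw [Polynomial.coeff_mul]
    exact Finset.sum_nonneg fun i _ => mul_nonneg (hp.coeff_nonneg _) (hq.coeff_nonneg _)
  · apply Polynomial.coeff_eq_zero_of_natDegree_lt
    have h1 := hp.natDegree_lt
    have h2 := hq.natDegree_lt
    have h3 := Polynomial.natDegree_mul_le (p := p) (q := q)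
    omega

theorem IsProbPoly.prod {ι : Type*} (s : Finset ι) {k : ℕ} {q : ι → Polynomial ℝ}
    (hq : ∀ i ∈ s, IsProbPoly (k + 1) (q i)) :
    IsProbPoly (s.card * k + 1) (∏ i ∈ s, q i) := by
  classical
  induction s using Finset.induction_on with
  | empty => simpa using IsProbPoly.one
  | insert a s ha ih =>
    rw [Finset.prod_insert ha, Finset.card_insert_of_notMem ha]
    have h := (hq a (by simp)).mul (ih fun i hi => hq i (by simp [hi]))
    convert h using 1
    ring

theorem integral_eq_sum_range {E : Type*} [NormedAddCommGroup E] [NormedSpace ℝ E]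
    [CompleteSpace E] {Q : Measure ℕ} [IsFiniteMeasure Q] {k : ℕ}
    (hQ : ∀ᵐ x ∂Q, x < k) (f : ℕ → E) :
    ∫ x, f x ∂Q = ∑ x ∈ Finset.range k, Q.real {x} • f x := by
  have h1 : Q.restrict (Finset.range k : Set ℕ) = Q := by
    apply Measure.restrict_eq_self_of_ae_mem
    filter_upwards [hQ] with x hx
    simpa using hx
  conv_lhs => rw [← h1]
  rw [setIntegral_finset]
  exact IntegrableOn.finset

/-- The generating polynomial of (the part on `{0, …, k - 1}` of) a measure on `ℕ`. -/
noncomputable def genPoly (k : ℕ) (Q : Measure ℕ) : Polynomial ℝ :=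
  ∑ x ∈ Finset.range k, Polynomial.monomial x (Q.real {x})

theorem coeff_genPoly {Q : Measure ℕ} [IsFiniteMeasure Q] {k : ℕ}
    (hQ : ∀ᵐ x ∂Q, x < k) (x : ℕ) : (genPoly k Q).coeff x = Q.real {x} := by
  simp only [genPoly, Polynomial.finsetSum_coeff, Polynomial.coeff_monomial]
  rw [Finset.sum_ite_eq' (Finset.range k) x]
  split_ifs with h
  · rfl
  · symm
    rw [measureReal_eq_zero_iff]
    refine measure_mono_null ?_ hQ
    intro y hy
    simp only [Set.mem_singleton_iff] at hy
    simpa [hy] using h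

theorem eval_genPoly {Q : Measure ℕ} [IsFiniteMeasure Q] {k : ℕ}
    (hQ : ∀ᵐ x ∂Q, x < k) (t : ℝ) : (genPoly k Q).eval t = ∫ x, t ^ x ∂Q := by
  rw [integral_eq_sum_range hQ]
  simp [genPoly, Polynomial.eval_finsetSum]

theorem isProbPoly_genPoly {Q : Measure ℕ} [IsProbabilityMeasure Q] {k : ℕ}
    (hQ : ∀ᵐ x ∂Q, x < k) : IsProbPoly k (genPoly k Q) := by
  refine ⟨fun x => ?_, fun x hx => ?_, ?_⟩
  · rw [coeff_genPoly hQ]; exact measureReal_nonneg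
  · simp only [genPoly, Polynomial.finsetSum_coeff, Polynomial.coeff_monomial]
    rw [Finset.sum_ite_eq' (Finset.range k) x, if_neg (by simpa using hx)]
  · rw [eval_genPoly hQ]; simp

/-- Independence turns the law of the sum into the product of generating polynomials. Two
polynomials are compared through their values at every real `t`, where `t ^ ∑ xᵢ` factorises and so
does its integral over the product measure. -/
theorem map_sum_pi_real_singleton {n k : ℕ} (Q : Fin n → ProbabilityMeasure ℕ)
    (hQ : ∀ i, ∀ᵐ x ∂(Q i : Measure ℕ), x < k) (x : ℕ) :
    ((Measure.pi fun i => (Q i : Measure ℕ)).map (fun x : Fin n → ℕ => ∑ i, x i)).real {x} =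
      (∏ i, genPoly k (Q i : Measure ℕ)).coeff x := by
  set μ := (Measure.pi fun i => (Q i : Measure ℕ)).map (fun x : Fin n → ℕ => ∑ i, x i) with hμ
  have hm : Measurable (fun x : Fin n → ℕ => ∑ i, x i) := by fun_prop
  have : IsProbabilityMeasure μ := Measure.isProbabilityMeasure_map hm.aemeasurable
  have hall : ∀ᵐ y ∂(Measure.pi fun i => (Q i : Measure ℕ)), ∀ i, y i < k := by
    rw [ae_all_iff]
    intro i
    exact (Measure.tendsto_eval_ae_ae (μ := fun i => (Q i : Measure ℕ)) (i := i)).eventually (hQ i)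
  have hsupp : ∀ᵐ x ∂μ, x < n * k + 1 := by
    rw [hμ, ae_map_iff hm.aemeasurable (Set.to_countable _).measurableSet]
    filter_upwards [hall] with y hy
    have : ∑ i, y i ≤ ∑ _i : Fin n, k := Finset.sum_le_sum fun i _ => (hy i).le
    simp at this
    omega
  rw [← coeff_genPoly hsupp]
  congr 1
  apply Polynomial.funext
  intro t
  rw [eval_genPoly hsupp, Polynomial.eval_prod, hμ, integral_map hm.aemeasurable
    (Measurable.aestronglyMeasurable (measurable_of_countable _))]
  simp_rw [eval_genPoly (hQ _)]
  rw [← integral_fintype_prod_eq_prod]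
  simp [Finset.prod_pow_eq_pow_sum]

theorem IsSIIRV.exists_polynomial {n k : ℕ} {P : ProbabilityMeasure ℕ} (h : IsSIIRV n k P) :
    ∃ q : Fin n → Polynomial ℝ, (∀ i, IsProbPoly k (q i)) ∧
      ∀ x, (P : Measure ℕ).real {x} = (∏ i, q i).coeff x := by
  obtain ⟨Q, hQ, hP⟩ := h
  exact ⟨fun i => genPoly k (Q i : Measure ℕ), fun i => isProbPoly_genPoly (hQ i),
    fun x => by rw [hP, map_sum_pi_real_singleton Q hQ]⟩

theorem IsProbPoly.exists_probabilityMeasure {k : ℕ} {q : Polynomial ℝ} (hq : IsProbPoly k q) :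
    ∃ Q : ProbabilityMeasure ℕ, (∀ᵐ x ∂(Q : Measure ℕ), x < k) ∧
      ∀ x, (Q : Measure ℕ).real {x} = q.coeff x := by
  let p : PMF ℕ := PMF.ofFinset (fun x => ENNReal.ofReal (q.coeff x)) (Finset.range k)
    (by rw [← ENNReal.ofReal_sum_of_nonneg fun x _ => hq.coeff_nonneg x, hq.sum_coeff]; simp)
    (fun x hx => by rw [hq.coeff_eq_zero x (by simpa using hx)]; simp)
  have hp : ∀ x, p.toMeasure {x} = ENNReal.ofReal (q.coeff x) := fun x => by
    rw [PMF.toMeasure_apply_singleton _ _ (measurableSet_singleton x)]; rfl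
  refine ⟨⟨p.toMeasure, inferInstance⟩, ?_, fun x => ?_⟩
  · rw [ae_iff_of_countable]
    intro x hx
    by_contra! h
    apply hx
    change p.toMeasure {x} = 0
    rw [hp, hq.coeff_eq_zero x h, ENNReal.ofReal_zero]
  · change (p.toMeasure {x}).toReal = _
    rw [hp, ENNReal.toReal_ofReal (hq.coeff_nonneg x)]

/-- The converse of `IsSIIRV.exists_polynomial`. The hard family of the lower bound is built from
polynomials and realised by this. -/
theorem exists_isSIIRV {n k : ℕ} (q : Fin n → Polynomial ℝ) (hq : ∀ i, IsProbPoly k (q i)) :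
    ∃ P : ProbabilityMeasure ℕ, IsSIIRV n k P ∧
      ∀ x, (P : Measure ℕ).real {x} = (∏ i, q i).coeff x := by
  choose Q hQ hQq using fun i => (hq i).exists_probabilityMeasure
  have hm : Measurable (fun x : Fin n → ℕ => ∑ i, x i) := by fun_prop
  refine ⟨⟨(Measure.pi fun i => (Q i : Measure ℕ)).map (fun x : Fin n → ℕ => ∑ i, x i),
    Measure.isProbabilityMeasure_map hm.aemeasurable⟩, ⟨Q, hQ, rfl⟩, fun x => ?_⟩
  change ((Measure.pi fun i => (Q i : Measure ℕ)).map _).real {x} = _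
  rw [map_sum_pi_real_singleton Q hQ]
  congr 2
  ext1 i
  ext y
  rw [coeff_genPoly (hQ i), hQq]

/-! ### Mean and variance in terms of the generating polynomial. -/

/-- Mean of the distribution with generating polynomial `q`. -/
noncomputable def polyMean (q : Polynomial ℝ) : ℝ := q.derivative.eval 1

/-- Variance of the distribution with generating polynomial `q`. -/
noncomputable def polyVar (q : Polynomial ℝ) : ℝ :=
  q.derivative.derivative.eval 1 + q.derivative.eval 1 - q.derivative.eval 1 ^ 2

theorem polyMean_mul {p q : Polynomial ℝ} (hp : p.eval 1 = 1) (hq : q.eval 1 = 1) :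
    polyMean (p * q) = polyMean p + polyMean q := by
  simp [polyMean, Polynomial.derivative_mul, hp, hq]

theorem polyVar_mul {p q : Polynomial ℝ} (hp : p.eval 1 = 1) (hq : q.eval 1 = 1) :
    polyVar (p * q) = polyVar p + polyVar q := by
  simp only [polyVar, Polynomial.derivative_mul, Polynomial.derivative_add, Polynomial.eval_add,
    Polynomial.eval_mul, hp, hq]
  ring

theorem eval_one_prod {ι : Type*} (s : Finset ι) {q : ι → Polynomial ℝ}
    (hq : ∀ i ∈ s, (q i).eval 1 = 1) : (∏ i ∈ s, q i).eval 1 = 1 := by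
  rw [Polynomial.eval_prod]; exact Finset.prod_eq_one hq

theorem polyMean_prod {ι : Type*} (s : Finset ι) {q : ι → Polynomial ℝ}
    (hq : ∀ i ∈ s, (q i).eval 1 = 1) : polyMean (∏ i ∈ s, q i) = ∑ i ∈ s, polyMean (q i) := by
  classical
  induction s using Finset.induction_on with
  | empty => simp [polyMean]
  | insert a s ha ih =>
    rw [Finset.prod_insert ha, Finset.sum_insert ha, polyMean_mul (hq a (by simp))
      (eval_one_prod s fun i hi => hq i (by simp [hi])), ih fun i hi => hq i (by simp [hi])]

theorem polyVar_prod {ι : Type*} (s : Finset ι) {q : ι → Polynomial ℝ}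
    (hq : ∀ i ∈ s, (q i).eval 1 = 1) : polyVar (∏ i ∈ s, q i) = ∑ i ∈ s, polyVar (q i) := by
  classical
  induction s using Finset.induction_on with
  | empty => simp [polyVar]
  | insert a s ha ih =>
    rw [Finset.prod_insert ha, Finset.sum_insert ha, polyVar_mul (hq a (by simp))
      (eval_one_prod s fun i hi => hq i (by simp [hi])), ih fun i hi => hq i (by simp [hi])]

theorem IsProbPoly.polyMean_eq {k : ℕ} {q : Polynomial ℝ} (hq : IsProbPoly k q) :
    polyMean q = ∑ x ∈ Finset.range k, q.coeff x * x := by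
  rw [polyMean]
  conv_lhs => rw [hq.eq_sum]
  simp [Polynomial.derivative_monomial, Polynomial.eval_finsetSum]

theorem IsProbPoly.polyVar_eq {k : ℕ} {q : Polynomial ℝ} (hq : IsProbPoly k q) :
    polyVar q = ∑ x ∈ Finset.range k, q.coeff x * (x - polyMean q) ^ 2 := by
  have h2 : q.derivative.derivative.eval 1 =
      ∑ x ∈ Finset.range k, q.coeff x * ((x : ℝ) * (x - 1)) := by
    conv_lhs => rw [hq.eq_sum]
    simp only [Polynomial.derivative_sum, Polynomial.derivative_monomial, Polynomial.eval_finsetSum,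
      Polynomial.eval_monomial, one_pow, mul_one]
    refine Finset.sum_congr rfl fun x _ => ?_
    rcases x with _ | x
    · simp
    · push_cast; simp; ring
  have h1 := hq.polyMean_eq
  have h0 := hq.sum_coeff
  have : ∑ x ∈ Finset.range k, q.coeff x * ((x : ℝ) - polyMean q) ^ 2 =
      ∑ x ∈ Finset.range k, q.coeff x * ((x : ℝ) * (x - 1)) +
      (1 - 2 * polyMean q) * ∑ x ∈ Finset.range k, q.coeff x * (x : ℝ) +
      polyMean q ^ 2 * ∑ x ∈ Finset.range k, q.coeff x := by
    rw [Finset.mul_sum, Finset.mul_sum, ← Finset.sum_add_distrib, ← Finset.sum_add_distrib]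
    exact Finset.sum_congr rfl fun x _ => by ring
  rw [this, h0, ← h1, ← h2, polyVar]
  simp only [polyMean]
  ring

theorem IsProbPoly.polyVar_nonneg {k : ℕ} {q : Polynomial ℝ} (hq : IsProbPoly k q) :
    0 ≤ polyVar q := by
  rw [hq.polyVar_eq]
  exact Finset.sum_nonneg fun x _ => mul_nonneg (hq.coeff_nonneg x) (sq_nonneg _)

/-- Variance through two independent copies. In this form it depends only on the law of the
difference, exactly like the energy in `IsProbPoly.charEnergy_eq`, and the two can be compared. -/
theorem IsProbPoly.two_mul_polyVar {k : ℕ} {q : Polynomial ℝ} (hq : IsProbPoly k q) :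
    2 * polyVar q = ∑ x ∈ Finset.range k, ∑ y ∈ Finset.range k,
      q.coeff x * q.coeff y * ((x : ℝ) - y) ^ 2 := by
  have hv := hq.polyVar_eq
  have h0 := hq.sum_coeff
  have h1 : ∑ x ∈ Finset.range k, q.coeff x * ((x : ℝ) - polyMean q) = 0 := by
    simp_rw [mul_sub]
    rw [Finset.sum_sub_distrib, ← hq.polyMean_eq, ← Finset.sum_mul, h0]; ring
  have : ∀ x ∈ Finset.range k, ∑ y ∈ Finset.range k,
      q.coeff x * q.coeff y * ((x : ℝ) - y) ^ 2 = q.coeff x * (x - polyMean q) ^ 2 *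
        (∑ y ∈ Finset.range k, q.coeff y) - 2 * (q.coeff x * (x - polyMean q)) *
        (∑ y ∈ Finset.range k, q.coeff y * ((y : ℝ) - polyMean q)) + q.coeff x *
        (∑ y ∈ Finset.range k, q.coeff y * ((y : ℝ) - polyMean q) ^ 2) := by
    intro x _
    rw [Finset.mul_sum, Finset.mul_sum, Finset.mul_sum, ← Finset.sum_sub_distrib,
      ← Finset.sum_add_distrib]
    exact Finset.sum_congr rfl fun y _ => by ring
  rw [Finset.sum_congr rfl this]
  simp_rw [h0, h1, ← hv, mul_one, mul_zero, sub_zero]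
  rw [Finset.sum_add_distrib, ← hv, ← Finset.sum_mul, h0]
  ring

/-! ### Characteristic functions, their energy and the centred first moment. -/

open Complex in
/-- The point `exp (2 π i ξ)` of the unit circle. -/
noncomputable def unitExp (ξ : ℝ) : ℂ := Complex.exp (2 * Real.pi * ξ * Complex.I)

theorem norm_unitExp (ξ : ℝ) : ‖unitExp ξ‖ = 1 := by
  have := Complex.norm_exp_ofReal_mul_I (2 * Real.pi * ξ)
  rw [unitExp]
  push_cast at this
  exact this

theorem unitExp_pow (ξ : ℝ) (x : ℕ) :
    unitExp ξ ^ x = Complex.exp ((2 * Real.pi * x * ξ : ℝ) * Complex.I) := by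
  rw [unitExp, ← Complex.exp_nat_mul]
  congr 1
  push_cast
  ring

theorem unitExp_pow_re (ξ : ℝ) (x : ℕ) : (unitExp ξ ^ x).re = Real.cos (2 * Real.pi * x * ξ) := by
  rw [unitExp_pow, Complex.exp_ofReal_mul_I_re]

theorem unitExp_pow_im (ξ : ℝ) (x : ℕ) : (unitExp ξ ^ x).im = Real.sin (2 * Real.pi * x * ξ) := by
  rw [unitExp_pow, Complex.exp_ofReal_mul_I_im]

/-- The characteristic function, on the circle, of the distribution with generating
polynomial `q`. -/
noncomputable def polyChar (q : Polynomial ℝ) (ξ : ℝ) : ℂ := Polynomial.aeval (unitExp ξ) q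

/-- The centred first moment against the character `ξ`. -/
noncomputable def polyCharMoment (q : Polynomial ℝ) (ξ : ℝ) : ℂ :=
  Polynomial.aeval (unitExp ξ) (Polynomial.X * q.derivative) - polyMean q * polyChar q ξ

theorem IsProbPoly.aeval_eq {k : ℕ} {q : Polynomial ℝ} (hq : IsProbPoly k q) (z : ℂ) :
    Polynomial.aeval z q = ∑ x ∈ Finset.range k, (q.coeff x : ℂ) * z ^ x := by
  conv_lhs => rw [hq.eq_sum]
  simp [Polynomial.aeval_monomial]

theorem IsProbPoly.polyChar_eq {k : ℕ} {q : Polynomial ℝ} (hq : IsProbPoly k q) (ξ : ℝ) :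
    polyChar q ξ = ∑ x ∈ Finset.range k, (q.coeff x : ℂ) * unitExp ξ ^ x :=
  hq.aeval_eq _

theorem IsProbPoly.polyCharMoment_eq {k : ℕ} {q : Polynomial ℝ} (hq : IsProbPoly k q) (ξ : ℝ) :
    polyCharMoment q ξ =
      ∑ x ∈ Finset.range k, (q.coeff x : ℂ) * ((x : ℂ) - polyMean q) * unitExp ξ ^ x := by
  have h : Polynomial.aeval (unitExp ξ) (Polynomial.X * q.derivative) =
      ∑ x ∈ Finset.range k, (q.coeff x : ℂ) * x * unitExp ξ ^ x := by
    conv_lhs => rw [hq.eq_sum]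
    simp only [Polynomial.derivative_monomial, Finset.mul_sum, map_sum,
      map_mul, Polynomial.aeval_X, Polynomial.aeval_monomial]
    refine Finset.sum_congr rfl fun x _ => ?_
    rcases x with _ | x
    · simp
    · simp [pow_succ]; ring
  rw [polyCharMoment, h, hq.polyChar_eq, Finset.mul_sum, ← Finset.sum_sub_distrib]
  exact Finset.sum_congr rfl fun x _ => by ring

theorem hasDerivAt_unitExp (ξ : ℝ) :
    HasDerivAt unitExp (2 * Real.pi * Complex.I * unitExp ξ) ξ := by
  have h : HasDerivAt (fun ξ : ℝ => 2 * Real.pi * (ξ : ℂ) * Complex.I)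
      (2 * Real.pi * Complex.I) ξ := by
    have h1 : HasDerivAt (fun ξ : ℝ => (ξ : ℂ)) 1 ξ := Complex.ofRealCLM.hasDerivAt
    simpa using (h1.const_mul (2 * Real.pi : ℂ)).mul_const Complex.I
  exact h.cexp.congr_deriv (mul_comm _ _)

/-- The derivative is split into a centred part and a drift proportional to the mean; the drift
disappears once coefficients are weighted by their distance to the mean. -/
theorem hasDerivAt_polyChar (q : Polynomial ℝ) (ξ : ℝ) :
    HasDerivAt (polyChar q)
      (2 * Real.pi * Complex.I * (polyCharMoment q ξ + polyMean q * polyChar q ξ)) ξ := by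
  have h := (q.hasDerivAt_aeval (unitExp ξ)).comp ξ (hasDerivAt_unitExp ξ)
  refine h.congr_deriv ?_
  simp [polyCharMoment]
  ring

theorem polyChar_prod {ι : Type*} (s : Finset ι) (q : ι → Polynomial ℝ) (ξ : ℝ) :
    polyChar (∏ i ∈ s, q i) ξ = ∏ i ∈ s, polyChar (q i) ξ := by
  simp [polyChar, map_prod]

theorem polyCharMoment_prod {ι : Type*} [DecidableEq ι] (s : Finset ι) {q : ι → Polynomial ℝ}
    (hq : ∀ i ∈ s, (q i).eval 1 = 1) (ξ : ℝ) :
    polyCharMoment (∏ i ∈ s, q i) ξ =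
      ∑ i ∈ s, polyCharMoment (q i) ξ * ∏ j ∈ s.erase i, polyChar (q j) ξ := by
  rw [polyCharMoment, Polynomial.derivative_prod_finset, polyMean_prod s hq, polyChar_prod]
  simp only [Finset.mul_sum, map_sum, map_mul, map_prod, Complex.ofReal_sum, Finset.sum_mul,
    ← Finset.sum_sub_distrib]
  refine Finset.sum_congr rfl fun i hi => ?_
  rw [← Finset.mul_prod_erase s (fun i => polyChar (q i) ξ) hi, polyCharMoment]
  simp only [map_mul, polyChar]
  ring

/-- Half of the defect `1 - |χ|²` of the characteristic function. -/
noncomputable def charEnergy (q : Polynomial ℝ) (ξ : ℝ) : ℝ := (1 - ‖polyChar q ξ‖ ^ 2) / 2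

/-- `|χ|²` is the characteristic function of the difference of two independent copies, which is
real. -/
theorem IsProbPoly.charEnergy_eq {k : ℕ} {q : Polynomial ℝ} (hq : IsProbPoly k q) (ξ : ℝ) :
    2 * charEnergy q ξ = ∑ x ∈ Finset.range k, ∑ y ∈ Finset.range k,
      q.coeff x * q.coeff y * (1 - Real.cos (2 * Real.pi * ((x : ℝ) - y) * ξ)) := by
  have h1 : ‖polyChar q ξ‖ ^ 2 = ∑ x ∈ Finset.range k, ∑ y ∈ Finset.range k,
      q.coeff x * q.coeff y * Real.cos (2 * Real.pi * ((x : ℝ) - y) * ξ) := by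
    rw [Complex.sq_norm, Complex.normSq_apply, hq.polyChar_eq]
    simp only [Complex.re_sum, Complex.im_sum, Complex.re_ofReal_mul, Complex.im_ofReal_mul,
      unitExp_pow_re, unitExp_pow_im, Finset.sum_mul_sum, ← Finset.sum_add_distrib]
    refine Finset.sum_congr rfl fun x _ => Finset.sum_congr rfl fun y _ => ?_
    rw [show 2 * Real.pi * ((x : ℝ) - y) * ξ = 2 * Real.pi * x * ξ - 2 * Real.pi * y * ξ by ring,
      Real.cos_sub]
    ring
  have h2 : (1 : ℝ) = ∑ x ∈ Finset.range k, ∑ y ∈ Finset.range k, q.coeff x * q.coeff y := by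
    rw [← Finset.sum_mul_sum, hq.sum_coeff, one_mul]
  rw [charEnergy, h1]
  nth_rewrite 1 [h2]
  simp only [mul_sub, mul_one, Finset.sum_sub_distrib]
  ring

theorem IsProbPoly.charEnergy_nonneg {k : ℕ} {q : Polynomial ℝ} (hq : IsProbPoly k q) (ξ : ℝ) :
    0 ≤ charEnergy q ξ := by
  have h : 0 ≤ 2 * charEnergy q ξ := by
    rw [hq.charEnergy_eq]
    refine Finset.sum_nonneg fun x _ => Finset.sum_nonneg fun y _ => mul_nonneg (mul_nonneg
      (hq.coeff_nonneg _) (hq.coeff_nonneg _)) ?_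
    linarith [Real.cos_le_one (2 * Real.pi * ((x : ℝ) - y) * ξ)]
  linarith

theorem charEnergy_le (q : Polynomial ℝ) (ξ : ℝ) : charEnergy q ξ ≤ 1 / 2 := by
  rw [charEnergy]
  nlinarith [sq_nonneg ‖polyChar q ξ‖]

/-- This is `1 + t ≤ exp t` at `t = |χ|² - 1`; the half in `charEnergy` absorbs the square. -/
theorem norm_polyChar_le (q : Polynomial ℝ) (ξ : ℝ) :
    ‖polyChar q ξ‖ ≤ Real.exp (-charEnergy q ξ) := by
  apply le_of_sq_le_sq _ (Real.exp_pos _).le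
  rw [← Real.exp_nat_mul]
  have := Real.add_one_le_exp (‖polyChar q ξ‖ ^ 2 - 1)
  calc ‖polyChar q ξ‖ ^ 2 ≤ Real.exp (‖polyChar q ξ‖ ^ 2 - 1) := by linarith
    _ = _ := by congr 1; rw [charEnergy]; push_cast; ring

/-- The moment is the covariance of the variable with its character. Since the first factor is
centred, `χ` may be subtracted from the character; Cauchy–Schwarz then applies, and the variance of
the character is `1 - |χ|²`, twice the energy. -/
theorem IsProbPoly.norm_polyCharMoment_le {k : ℕ} {q : Polynomial ℝ} (hq : IsProbPoly k q)
    (ξ : ℝ) :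
    ‖polyCharMoment q ξ‖ ≤ Real.sqrt (polyVar q) * Real.sqrt (2 * charEnergy q ξ) := by
  set c := polyChar q ξ with hc
  have h0 : ∑ x ∈ Finset.range k, (q.coeff x : ℂ) * ((x : ℂ) - polyMean q) = 0 := by
    have : ∑ x ∈ Finset.range k, q.coeff x * ((x : ℝ) - polyMean q) = 0 := by
      simp_rw [mul_sub]
      rw [Finset.sum_sub_distrib, ← hq.polyMean_eq, ← Finset.sum_mul, hq.sum_coeff]; ring
    exact_mod_cast congrArg (fun x : ℝ => (x : ℂ)) this
  have h1 : polyCharMoment q ξ =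
      ∑ x ∈ Finset.range k, (q.coeff x : ℂ) * ((x : ℂ) - polyMean q) * (unitExp ξ ^ x - c) := by
    rw [hq.polyCharMoment_eq]
    simp_rw [mul_sub _ _ c]
    rw [Finset.sum_sub_distrib, ← Finset.sum_mul, h0]
    ring
  have h2 : ∑ x ∈ Finset.range k, q.coeff x * ‖unitExp ξ ^ x - c‖ ^ 2 = 2 * charEnergy q ξ := by
    have : ∀ x ∈ Finset.range k, q.coeff x * ‖unitExp ξ ^ x - c‖ ^ 2 =
        q.coeff x * (1 + ‖c‖ ^ 2) - 2 * ((q.coeff x : ℂ) * unitExp ξ ^ x *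
          (starRingEnd ℂ) c).re := by
      intro x _
      have h3 : ‖unitExp ξ ^ x - c‖ ^ 2 = ‖unitExp ξ ^ x‖ ^ 2 + ‖c‖ ^ 2 -
          2 * (unitExp ξ ^ x * (starRingEnd ℂ) c).re := by
        rw [Complex.sq_norm, Complex.sq_norm, Complex.sq_norm, Complex.normSq_sub]
      rw [h3, norm_pow, norm_unitExp, mul_assoc, Complex.re_ofReal_mul]
      ring
    rw [Finset.sum_congr rfl this, Finset.sum_sub_distrib, ← Finset.sum_mul, hq.sum_coeff,
      ← Finset.mul_sum, ← Complex.re_sum, ← Finset.sum_mul, ← hq.polyChar_eq, ← hc,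
      Complex.mul_conj, Complex.ofReal_re, ← Complex.sq_norm, charEnergy]
    ring
  rw [h1, ← h2, hq.polyVar_eq]
  refine (norm_sum_le _ _).trans ?_
  refine le_trans (le_of_eq ?_) (Real.sum_sqrt_mul_sqrt_le (Finset.range k)
    (f := fun x => q.coeff x * ((x : ℝ) - polyMean q) ^ 2)
    (g := fun x => q.coeff x * ‖unitExp ξ ^ x - c‖ ^ 2) (fun x => mul_nonneg (hq.coeff_nonneg x)
    (sq_nonneg _)) (fun x => mul_nonneg (hq.coeff_nonneg x) (sq_nonneg _)))
  refine Finset.sum_congr rfl fun x _ => ?_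
  rw [Real.sqrt_mul (hq.coeff_nonneg x), Real.sqrt_mul (hq.coeff_nonneg x), Real.sqrt_sq_eq_abs,
    Real.sqrt_sq (norm_nonneg _), norm_mul, norm_mul]
  have h4 : ‖(q.coeff x : ℂ)‖ = q.coeff x := by
    rw [Complex.norm_real, Real.norm_of_nonneg (hq.coeff_nonneg x)]
  have h5 : ‖(x : ℂ) - polyMean q‖ = |(x : ℝ) - polyMean q| := by
    rw [← Real.norm_eq_abs, ← Complex.norm_real]; push_cast; rfl
  rw [h4, h5]
  nth_rewrite 1 [← Real.mul_self_sqrt (hq.coeff_nonneg x)]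
  ring

/-! ### Energy and variance of a product, through weights on differences. -/

section Product

variable {ι : Type*} (s : Finset ι) {k : ℕ} {q : ι → Polynomial ℝ}

theorem norm_polyChar_prod_le :
    ∀ ξ, ‖polyChar (∏ i ∈ s, q i) ξ‖ ≤ Real.exp (-∑ i ∈ s, charEnergy (q i) ξ) := by
  intro ξ
  rw [polyChar_prod, norm_prod, ← Finset.sum_neg_distrib, Real.exp_sum]
  exact Finset.prod_le_prod (fun _ _ => norm_nonneg _) fun i _ => norm_polyChar_le _ _

/-- By the Leibniz rule each term lacks one factor, whose energy is at most `1 / 2`; this explains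
the `1 / 2` in the exponent. Cauchy–Schwarz over the factors adds up variances and energies. -/
theorem norm_polyCharMoment_prod_le (hq : ∀ i ∈ s, IsProbPoly k (q i)) (ξ : ℝ) :
    ‖polyCharMoment (∏ i ∈ s, q i) ξ‖ ≤
      Real.sqrt (polyVar (∏ i ∈ s, q i)) * Real.sqrt (2 * ∑ i ∈ s, charEnergy (q i) ξ) *
        Real.exp (1 / 2 - ∑ i ∈ s, charEnergy (q i) ξ) := by
  classical
  rw [polyCharMoment_prod s (fun i hi => (hq i hi).eval_one),
    polyVar_prod s (fun i hi => (hq i hi).eval_one), Finset.mul_sum]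
  refine (norm_sum_le _ _).trans ?_
  have h1 : ∀ i ∈ s, ‖polyCharMoment (q i) ξ * ∏ j ∈ s.erase i, polyChar (q j) ξ‖ ≤
      Real.sqrt (polyVar (q i)) * Real.sqrt (2 * charEnergy (q i) ξ) *
        Real.exp (1 / 2 - ∑ i ∈ s, charEnergy (q i) ξ) := by
    intro i hi
    rw [norm_mul]
    refine mul_le_mul ((hq i hi).norm_polyCharMoment_le ξ) ?_ (norm_nonneg _) (by positivity)
    rw [← polyChar_prod]
    refine (norm_polyChar_prod_le _ ξ).trans (Real.exp_le_exp.mpr ?_)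
    rw [← Finset.add_sum_erase s (fun i => charEnergy (q i) ξ) hi]
    linarith [charEnergy_le (q i) ξ]
  refine (Finset.sum_le_sum h1).trans ?_
  rw [← Finset.sum_mul]
  refine mul_le_mul_of_nonneg_right ?_ (Real.exp_pos _).le
  have h := Real.sum_sqrt_mul_sqrt_le s.attach (f := fun i : s => polyVar (q i))
    (g := fun i : s => 2 * charEnergy (q i) ξ) (fun i => (hq i i.2).polyVar_nonneg)
    (fun i => by have := (hq i i.2).charEnergy_nonneg ξ; positivity)
  rw [Finset.sum_attach s (fun i => Real.sqrt (polyVar (q i)) * Real.sqrt (2 * charEnergy (q i) ξ)),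
    Finset.sum_attach s (fun i => polyVar (q i)),
    Finset.sum_attach s (fun i => 2 * charEnergy (q i) ξ)] at h
  exact h

/-- The expected number of components for which two independent copies differ by `j`. -/
noncomputable def diffWeight (k : ℕ) (q : ι → Polynomial ℝ) (j : ℕ) : ℝ :=
  ∑ i ∈ s, ∑ x ∈ Finset.range k, ∑ y ∈ Finset.range k,
    if ((x : ℤ) - y).natAbs = j then (q i).coeff x * (q i).coeff y else 0

theorem diffWeight_nonneg (hq : ∀ i ∈ s, IsProbPoly k (q i)) (j : ℕ) :
    0 ≤ diffWeight s k q j := by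
  refine Finset.sum_nonneg fun i hi => Finset.sum_nonneg fun x _ => Finset.sum_nonneg fun y _ => ?_
  split_ifs
  · exact mul_nonneg ((hq i hi).coeff_nonneg _) ((hq i hi).coeff_nonneg _)
  · rfl

theorem sum_diffWeight_mul (g : ℕ → ℝ) :
    ∑ j ∈ Finset.range k, diffWeight s k q j * g j =
      ∑ i ∈ s, ∑ x ∈ Finset.range k, ∑ y ∈ Finset.range k,
        (q i).coeff x * (q i).coeff y * g ((x : ℤ) - y).natAbs := by
  simp only [diffWeight, Finset.sum_mul, ite_mul, zero_mul]
  rw [Finset.sum_comm]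
  refine Finset.sum_congr rfl fun i _ => ?_
  rw [Finset.sum_comm]
  refine Finset.sum_congr rfl fun x hx => ?_
  rw [Finset.sum_comm]
  refine Finset.sum_congr rfl fun y hy => ?_
  rw [Finset.sum_ite_eq, if_pos]
  simp only [Finset.mem_range] at hx hy ⊢
  omega

/-- Together with `two_mul_polyVar_prod`, this expresses energy and variance by the same weights, so
that a large variance forces a large energy. -/
theorem sum_charEnergy_eq (hq : ∀ i ∈ s, IsProbPoly k (q i)) (ξ : ℝ) :
    2 * ∑ i ∈ s, charEnergy (q i) ξ =
      ∑ j ∈ Finset.range k, diffWeight s k q j * (1 - Real.cos (2 * Real.pi * j * ξ)) := by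
  rw [sum_diffWeight_mul s (fun j => 1 - Real.cos (2 * Real.pi * j * ξ)), Finset.mul_sum]
  refine Finset.sum_congr rfl fun i hi => ?_
  rw [(hq i hi).charEnergy_eq]
  refine Finset.sum_congr rfl fun x _ => Finset.sum_congr rfl fun y _ => ?_
  congr 2
  rw [Nat.cast_natAbs]
  push_cast
  rcases abs_choice ((x : ℝ) - y) with h | h <;> rw [h]
  rw [← Real.cos_neg]
  congr 1
  ring

theorem two_mul_polyVar_prod (hq : ∀ i ∈ s, IsProbPoly k (q i)) :
    2 * polyVar (∏ i ∈ s, q i) = ∑ j ∈ Finset.range k, diffWeight s k q j * (j : ℝ) ^ 2 := by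
  rw [sum_diffWeight_mul s (fun j => (j : ℝ) ^ 2),
    polyVar_prod s (fun i hi => (hq i hi).eval_one), Finset.mul_sum]
  refine Finset.sum_congr rfl fun i hi => ?_
  rw [(hq i hi).two_mul_polyVar]
  refine Finset.sum_congr rfl fun x _ => Finset.sum_congr rfl fun y _ => ?_
  rw [Nat.cast_natAbs]
  push_cast
  rw [sq_abs]

/-- `1 - cos (2 π x) = 2 sin² (π x)` and Jordan's inequality `sin (π x) ≥ 2 x` on `[0, 1 / 2]`. -/
theorem eight_mul_sq_le_one_sub_cos {x : ℝ} (hx : |x| ≤ 1 / 2) :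
    8 * x ^ 2 ≤ 1 - Real.cos (2 * Real.pi * x) := by
  wlog h0 : 0 ≤ x generalizing x
  · have := this (x := -x) (by simpa using hx) (by linarith)
    rw [mul_neg, Real.cos_neg, neg_sq] at this
    exact this
  rw [abs_of_nonneg h0] at hx
  have h1 : 2 * x ≤ Real.sin (Real.pi * x) := by
    have := Real.mul_le_sin (x := Real.pi * x) (by positivity)
      (by nlinarith [Real.pi_pos])
    have h2 : 2 / Real.pi * (Real.pi * x) = 2 * x := by field_simp
    linarith
  have h3 : Real.cos (2 * Real.pi * x) = 1 - 2 * Real.sin (Real.pi * x) ^ 2 := by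
    rw [show 2 * Real.pi * x = 2 * (Real.pi * x) by ring, Real.cos_two_mul, Real.cos_sq']
    ring
  rw [h3]
  nlinarith

/-- Near the origin the energy is at least a multiple of the variance. -/
theorem polyVar_le_sum_charEnergy (hq : ∀ i ∈ s, IsProbPoly k (q i)) {ξ : ℝ}
    (hξ : k * |ξ| ≤ 1 / 2) :
    8 * polyVar (∏ i ∈ s, q i) * ξ ^ 2 ≤ ∑ i ∈ s, charEnergy (q i) ξ := by
  have h1 := two_mul_polyVar_prod s hq
  have h2 := sum_charEnergy_eq s hq ξ
  have h3 : ∑ j ∈ Finset.range k, diffWeight s k q j * (j : ℝ) ^ 2 * (8 * ξ ^ 2) ≤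
      ∑ j ∈ Finset.range k, diffWeight s k q j * (1 - Real.cos (2 * Real.pi * j * ξ)) := by
    refine Finset.sum_le_sum fun j hj => ?_
    rw [mul_assoc]
    refine mul_le_mul_of_nonneg_left ?_ (diffWeight_nonneg s hq j)
    have hj' : (j : ℝ) ≤ k := by exact_mod_cast (Finset.mem_range.mp hj).le
    have := eight_mul_sq_le_one_sub_cos (x := j * ξ)
      (by rw [abs_mul, Nat.abs_cast]
          exact (mul_le_mul_of_nonneg_right hj' (abs_nonneg _)).trans hξ)
    calc (j : ℝ) ^ 2 * (8 * ξ ^ 2) = 8 * (j * ξ) ^ 2 := by ring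
      _ ≤ _ := this
      _ = _ := by rw [mul_assoc (2 * Real.pi)]
  rw [← Finset.sum_mul, ← h1, ← h2] at h3
  linarith

end Product

/-! ### Rounding the difference weights to a multiset of size `k`. -/

/-- A list of the `k` elements of a multiset. -/
noncomputable def symFun {k : ℕ} (M : Sym (Fin k) k) (i : Fin k) : ℕ :=
  (M.1.toList.get (i.cast (by rw [Multiset.length_toList]; exact M.2.symm)) : Fin k)

theorem sum_symFun {k : ℕ} (M : Sym (Fin k) k) (g : ℕ → ℝ) :
    ∑ i, g (symFun M i) = (M.1.map fun j : Fin k => g j).sum := by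
  have hl : k = M.1.toList.length := by rw [Multiset.length_toList]; exact M.2.symm
  conv_rhs => rw [← Multiset.coe_toList M.1]
  rw [Multiset.map_coe, Multiset.sum_coe, ← List.sum_ofFn]
  simp only [symFun]
  conv_rhs => rw [← List.ofFn_get M.1.toList, List.map_ofFn]
  rw [List.sum_ofFn, List.sum_ofFn]
  exact Fintype.sum_equiv (finCongr hl) _ _ fun i => rfl

theorem symFun_mem {k : ℕ} (M : Sym (Fin k) k) (i : Fin k) :
    ∃ j ∈ M.1, symFun M i = (j : ℕ) := by
  refine ⟨_, ?_, rfl⟩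
  rw [← Multiset.mem_toList]
  exact List.get_mem _ _

/-- Weights of sufficient total mass dominate, up to the unit `u`, a multiset of size `k`. -/
theorem exists_sym_le {k : ℕ} (w : ℕ → ℝ) (hw : ∀ j, 0 ≤ w j) {u : ℝ} (hu : 0 < u)
    (h : 2 * k * u ≤ ∑ j ∈ (Finset.range k).erase 0, w j) :
    ∃ M : Sym (Fin k) k, (∀ i, 1 ≤ symFun M i) ∧ ∀ g : ℕ → ℝ, (∀ j, 0 ≤ g j) →
      u * ∑ i, g (symFun M i) ≤ ∑ j ∈ Finset.range k, w j * g j := by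
  classical
  -- Multiplicity `⌊w j / u⌋`, with the difference `0` left out because it carries no energy.
  let l : Fin k → ℕ := fun j => if (j : ℕ) = 0 then 0 else ⌊w j / u⌋₊
  let M₀ : Multiset (Fin k) := ∑ j, l j • {j}
  have hcard : k ≤ Multiset.card M₀ := by
    have h1 : (Multiset.card M₀ : ℝ) = ∑ j, (l j : ℝ) := by simp [M₀]
    -- Each floor loses at most `1`, so at least `2 k - k = k` elements remain; this is the reason
    -- for the factor `2` in the hypothesis.
    have h2 : ∀ j : Fin k, (if (j : ℕ) = 0 then 0 else w j / u) - 1 ≤ (l j : ℝ) := by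
      intro j
      by_cases hj : (j : ℕ) = 0
      · simp [l, hj]
      · simp only [l, hj, if_false]
        linarith [Nat.lt_floor_add_one (w j / u)]
    have h3 := Finset.sum_le_sum fun j (_ : j ∈ Finset.univ) => h2 j
    rw [Finset.sum_sub_distrib, Fin.sum_univ_eq_sum_range (fun j => if j = 0 then 0 else w j / u),
      ← h1] at h3
    have h4 : ∑ j ∈ Finset.range k, (if j = 0 then 0 else w j / u) =
        (∑ j ∈ (Finset.range k).erase 0, w j) / u := by
      rw [Finset.sum_div, ← Finset.filter_ne', Finset.sum_filter]
      exact Finset.sum_congr rfl fun j _ => by by_cases hj : j = 0 <;> simp [hj]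
    rw [h4] at h3
    have h5 : 2 * (k : ℝ) ≤ (∑ j ∈ (Finset.range k).erase 0, w j) / u := by
      rwa [le_div_iff₀ hu]
    simp at h3
    exact_mod_cast (by linarith : (k : ℝ) ≤ Multiset.card M₀)
  obtain ⟨M, hM⟩ := Multiset.exists_mem_of_ne_zero (s := Multiset.powersetCard k M₀) (by
    rw [← Multiset.card_pos, Multiset.card_powersetCard]
    exact Nat.choose_pos hcard)
  rw [Multiset.mem_powersetCard] at hM
  refine ⟨Sym.mk M hM.2, fun i => ?_, fun g hg => ?_⟩
  · obtain ⟨j, hj, hji⟩ := symFun_mem (Sym.mk M hM.2) i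
    rw [hji]
    have hj' : j ∈ M₀ := Multiset.mem_of_le hM.1 hj
    rw [Multiset.mem_sum] at hj'
    obtain ⟨a, _, ha⟩ := hj'
    have hja : j = a := Multiset.mem_singleton.mp (Multiset.mem_of_mem_nsmul ha)
    subst hja
    by_contra! h0
    have : (j : ℕ) = 0 := by omega
    simp [l, this] at ha
  · have h0 : ∑ i, g (symFun (Sym.mk M hM.2) i) = (M.map fun j : Fin k => g j).sum :=
      sum_symFun _ g
    rw [h0]
    have h1 : (M.map fun j : Fin k => g j).sum ≤ (M₀.map fun j : Fin k => g j).sum := by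
      obtain ⟨M', hM'⟩ := Multiset.le_iff_exists_add.mp hM.1
      rw [hM', Multiset.map_add, Multiset.sum_add]
      have : 0 ≤ (M'.map fun j : Fin k => g j).sum := by
        apply Multiset.sum_nonneg
        intro x hx
        obtain ⟨j, _, rfl⟩ := Multiset.mem_map.mp hx
        exact hg _
      linarith
    have h2 : (M₀.map fun j : Fin k => g j).sum = ∑ j : Fin k, (l j : ℝ) * g j := by
      simp only [M₀]
      have h3 := map_sum (Multiset.mapAddMonoidHom fun j : Fin k => g j)
        (fun j => l j • {j}) Finset.univ
      simp only [Multiset.coe_mapAddMonoidHom] at h3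
      rw [h3, Multiset.sum_sum]
      simp [Multiset.map_nsmul, Multiset.sum_nsmul]
    calc u * (M.map fun j : Fin k => g j).sum ≤ u * ∑ j : Fin k, (l j : ℝ) * g j := by
          rw [← h2]; exact mul_le_mul_of_nonneg_left h1 hu.le
      _ = ∑ j : Fin k, u * l j * g j := by
          rw [Finset.mul_sum]; exact Finset.sum_congr rfl fun j _ => by ring
      _ ≤ ∑ j : Fin k, w j * g j := by
          refine Finset.sum_le_sum fun j _ => mul_le_mul_of_nonneg_right ?_ (hg _)
          by_cases hj : (j : ℕ) = 0
          · simp [l, hj, hw]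
          · simp only [l, hj, if_false]
            rw [← le_div_iff₀' hu]
            exact Nat.floor_le (div_nonneg (hw _) hu.le)
      _ = _ := Fin.sum_univ_eq_sum_range (fun j => w j * g j) k

/-- The number of candidates enters only through a union bound, where an exponential in `k` costs
`O(k / ε²)` samples. -/
theorem card_sym_fin_le (k : ℕ) : Fintype.card (Sym (Fin k) k) ≤ 4 ^ k := by
  rw [Sym.card_sym_eq_choose, Fintype.card_fin]
  calc (k + k - 1).choose k ≤ (2 * k).choose k := Nat.choose_le_choose _ (by omega)
    _ = Nat.centralBinom k := rfl
    _ ≤ 2 ^ (2 * k) := Nat.choose_le_two_pow _ _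
    _ = 4 ^ k := by rw [pow_mul]; norm_num

/-! ### The trigonometric energy of a multiset and the measure of its sublevel sets. -/

/-- The trigonometric polynomial `u / 2 * ∑ (1 - cos (2 π jᵢ ξ))`. -/
noncomputable def trigEnergy {k : ℕ} (u : ℝ) (t : Fin k → ℕ) (ξ : ℝ) : ℝ :=
  u / 2 * ∑ i, (1 - Real.cos (2 * Real.pi * t i * ξ))

/-- The derivative of `trigEnergy`. -/
noncomputable def trigEnergyDeriv {k : ℕ} (u : ℝ) (t : Fin k → ℕ) (ξ : ℝ) : ℝ :=
  u / 2 * ∑ i, 2 * Real.pi * t i * Real.sin (2 * Real.pi * t i * ξ)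

section TrigEnergy

variable {k : ℕ} {u : ℝ} (t : Fin k → ℕ)

theorem trigEnergy_nonneg (hu : 0 ≤ u) (ξ : ℝ) : 0 ≤ trigEnergy u t ξ :=
  mul_nonneg (by linarith) (Finset.sum_nonneg fun i _ => by
    linarith [Real.cos_le_one (2 * Real.pi * t i * ξ)])

theorem hasDerivAt_trigEnergy (ξ : ℝ) :
    HasDerivAt (trigEnergy u t) (trigEnergyDeriv u t ξ) ξ := by
  refine HasDerivAt.const_mul (u / 2) (HasDerivAt.fun_sum fun i _ => ?_)
  have h : HasDerivAt (fun ξ : ℝ => 2 * Real.pi * t i * ξ) (2 * Real.pi * t i) ξ := by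
    simpa using (hasDerivAt_id ξ).const_mul (2 * Real.pi * t i)
  exact ((h.cos).const_sub 1).congr_deriv (by ring)

theorem continuous_trigEnergy : Continuous (trigEnergy u t) := by
  unfold trigEnergy; fun_prop

theorem continuous_trigEnergyDeriv : Continuous (trigEnergyDeriv u t) := by
  unfold trigEnergyDeriv; fun_prop

theorem trigEnergy_periodic : Function.Periodic (trigEnergy u t) 1 := by
  intro ξ
  simp only [trigEnergy]
  congr 1
  refine Finset.sum_congr rfl fun i _ => ?_
  rw [show 2 * Real.pi * t i * (ξ + 1) = 2 * Real.pi * t i * ξ + t i * (2 * Real.pi) by ring,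
    Real.cos_add_nat_mul_two_pi]

/-- A nonnegative function with controlled second derivative has squared derivative bounded by
itself; here this is Cauchy–Schwarz and `sin² ≤ 2 (1 - cos)`. With `u k³ ≤ σ²` the cutoff then
varies on the frequency scale `1 / σ`, so its kernel lives on the scale `σ`. -/
theorem trigEnergyDeriv_sq_le (ht : ∀ i, t i ≤ k) (ξ : ℝ) :
    trigEnergyDeriv u t ξ ^ 2 ≤ 4 * Real.pi ^ 2 * (u * k ^ 3) * trigEnergy u t ξ := by
  have h1 := Finset.sum_mul_sq_le_sq_mul_sq Finset.univ (fun i => (t i : ℝ))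
    (fun i => Real.sin (2 * Real.pi * t i * ξ))
  have h2 : ∑ i, (t i : ℝ) ^ 2 ≤ k ^ 3 := by
    calc ∑ i, (t i : ℝ) ^ 2 ≤ ∑ _i : Fin k, (k : ℝ) ^ 2 := by
          refine Finset.sum_le_sum fun i _ => ?_
          have : (t i : ℝ) ≤ k := by exact_mod_cast ht i
          gcongr
      _ = k ^ 3 := by simp; ring
  have h3 : ∑ i, Real.sin (2 * Real.pi * t i * ξ) ^ 2 ≤
      2 * ∑ i, (1 - Real.cos (2 * Real.pi * t i * ξ)) := by
    rw [Finset.mul_sum]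
    refine Finset.sum_le_sum fun i _ => ?_
    rw [Real.sin_sq]
    nlinarith [Real.cos_le_one (2 * Real.pi * t i * ξ), Real.neg_one_le_cos (2 * Real.pi * t i * ξ)]
  have h4 : trigEnergyDeriv u t ξ =
      u * Real.pi * ∑ i, (t i : ℝ) * Real.sin (2 * Real.pi * t i * ξ) := by
    rw [trigEnergyDeriv, Finset.mul_sum, Finset.mul_sum]
    exact Finset.sum_congr rfl fun i _ => by ring
  have h5 : (∑ i, (t i : ℝ) * Real.sin (2 * Real.pi * t i * ξ)) ^ 2 ≤
      k ^ 3 * (2 * ∑ i, (1 - Real.cos (2 * Real.pi * t i * ξ))) :=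
    h1.trans (mul_le_mul h2 h3 (Finset.sum_nonneg fun i _ => sq_nonneg _) (by positivity))
  rw [h4, mul_pow, trigEnergy]
  calc (u * Real.pi) ^ 2 * _ ≤ (u * Real.pi) ^ 2 *
        (k ^ 3 * (2 * ∑ i, (1 - Real.cos (2 * Real.pi * t i * ξ)))) :=
        mul_le_mul_of_nonneg_left h5 (sq_nonneg _)
    _ = _ := by ring

/-- Dilation by a positive integer does not change the integral of a `1`-periodic function over a
period. This reduces to `j = 1`, where the integrand on `[-1 / 2, 1 / 2]` lies below a Gaussian. -/
theorem integral_exp_cos_le {a : ℝ} (ha : 0 < a) {j : ℕ} (hj : 1 ≤ j) :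
    ∫ ξ in (0 : ℝ)..1, Real.exp (-a * (1 - Real.cos (2 * Real.pi * j * ξ))) ≤
      Real.sqrt (Real.pi / (8 * a)) := by
  set g : ℝ → ℝ := fun ξ => Real.exp (-a * (1 - Real.cos (2 * Real.pi * ξ))) with hg
  have hgc : Continuous g := by fun_prop
  have hper : Function.Periodic g 1 := fun ξ => by
    simp only [hg]
    rw [show 2 * Real.pi * (ξ + 1) = 2 * Real.pi * ξ + 2 * Real.pi by ring,
      Real.cos_add_two_pi]
  have hj0 : (j : ℝ) ≠ 0 := by positivity
  have h1 : ∫ ξ in (0 : ℝ)..1, Real.exp (-a * (1 - Real.cos (2 * Real.pi * j * ξ))) =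
      ∫ ξ in (0 : ℝ)..1, g ξ := by
    have h2 : ∀ ξ : ℝ, Real.exp (-a * (1 - Real.cos (2 * Real.pi * j * ξ))) = g (j * ξ) :=
      fun ξ => by simp only [hg, mul_assoc]
    simp_rw [h2]
    rw [intervalIntegral.integral_comp_mul_left (fun x => g x) hj0]
    have h3 := hper.intervalIntegral_add_zsmul_eq (j : ℤ) 0
      (fun a b => hgc.intervalIntegrable _ _)
    simp only [zsmul_eq_mul, mul_one, zero_add, Int.cast_natCast] at h3
    rw [mul_zero, mul_one, h3, smul_eq_mul, inv_mul_cancel_left₀ hj0]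
  have h4 := hper.intervalIntegral_add_eq 0 (-(1 / 2))
  rw [h1]
  norm_num at h4
  rw [h4]
  have h5 : ∫ x in (-(1 / 2) : ℝ)..(1 / 2), g x ≤
      ∫ x in (-(1 / 2) : ℝ)..(1 / 2), Real.exp (-(8 * a) * x ^ 2) := by
    apply intervalIntegral.integral_mono_on (by norm_num) (hgc.intervalIntegrable _ _)
      (Continuous.intervalIntegrable (by fun_prop) _ _)
    intro x hx
    apply Real.exp_le_exp.mpr
    have := eight_mul_sq_le_one_sub_cos (x := x) (abs_le.mpr ⟨hx.1, hx.2⟩)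
    nlinarith
  refine h5.trans ?_
  rw [← integral_gaussian, intervalIntegral.integral_of_le (by norm_num)]
  exact setIntegral_le_integral (integrable_exp_neg_mul_sq (by positivity))
    (Filter.Eventually.of_forall fun x => (Real.exp_pos _).le)

/-- The exponent is an average over the `k` frequencies, so by Jensen the integrand is at most the
average of single-frequency integrands, which all satisfy the same bound. The arithmetic relations
between the frequencies are irrelevant, and the decay is governed by the total weight `u k`. -/
theorem integral_exp_trigEnergy_le (hu : 0 < u) (hk : 1 ≤ k) (ht : ∀ i, 1 ≤ t i) {l : ℝ}
    (hl : 0 < l) :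
    ∫ ξ in (0 : ℝ)..1, Real.exp (-(l * trigEnergy u t ξ)) ≤
      Real.sqrt (Real.pi / (4 * (l * u * k))) := by
  have hk0 : (0 : ℝ) < k := by exact_mod_cast hk
  set a : ℝ := l * u * k / 2 with ha
  have ha0 : 0 < a := by positivity
  have h1 : ∀ ξ, Real.exp (-(l * trigEnergy u t ξ)) ≤
      ∑ i, (1 / k : ℝ) * Real.exp (-a * (1 - Real.cos (2 * Real.pi * t i * ξ))) := by
    intro ξ
    have h := convexOn_exp.map_sum_le (t := Finset.univ) (w := fun _ : Fin k => (1 / k : ℝ))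
      (p := fun i => -a * (1 - Real.cos (2 * Real.pi * t i * ξ))) (fun _ _ => by positivity)
      (by simp; field_simp) (fun _ _ => Set.mem_univ _)
    simp only [smul_eq_mul] at h
    refine le_trans (le_of_eq ?_) h
    congr 1
    rw [← Finset.mul_sum, ← Finset.mul_sum, trigEnergy, ha]
    generalize ∑ i, (1 - Real.cos (2 * Real.pi * t i * ξ)) = S
    field_simp
  have hc : ∀ i, Continuous fun ξ : ℝ =>
      (1 / k : ℝ) * Real.exp (-a * (1 - Real.cos (2 * Real.pi * t i * ξ))) := fun i => by fun_prop
  calc ∫ ξ in (0 : ℝ)..1, Real.exp (-(l * trigEnergy u t ξ))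
      ≤ ∫ ξ in (0 : ℝ)..1, ∑ i, (1 / k : ℝ) *
          Real.exp (-a * (1 - Real.cos (2 * Real.pi * t i * ξ))) := by
        apply intervalIntegral.integral_mono_on (by norm_num)
        · exact Continuous.intervalIntegrable (by have := continuous_trigEnergy (u := u) t; fun_prop) _ _
        · exact Continuous.intervalIntegrable (continuous_finsetSum _ fun i _ => hc i) _ _
        · exact fun ξ _ => h1 ξ
    _ = ∑ i, (1 / k : ℝ) * ∫ ξ in (0 : ℝ)..1,
          Real.exp (-a * (1 - Real.cos (2 * Real.pi * t i * ξ))) := by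
        rw [intervalIntegral.integral_finsetSum fun i _ => (hc i).intervalIntegrable _ _]
        simp_rw [intervalIntegral.integral_const_mul]
    _ ≤ ∑ _i : Fin k, (1 / k : ℝ) * Real.sqrt (Real.pi / (8 * a)) := by
        refine Finset.sum_le_sum fun i _ => mul_le_mul_of_nonneg_left ?_ (by positivity)
        exact integral_exp_cos_le ha0 (ht i)
    _ = Real.sqrt (Real.pi / (8 * a)) := by
        simp; field_simp
    _ = _ := by congr 2; rw [ha]; ring

end TrigEnergy

/-! ### Fourier coefficients on the circle and weighted Parseval identities. -/

/-- Fourier coefficients on `[0, 1]`. -/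
noncomputable def circleCoeff (f : ℝ → ℂ) (n : ℤ) : ℂ :=
  ∫ ξ in (0 : ℝ)..1, Complex.exp ((-(2 * Real.pi * n * ξ) : ℝ) * Complex.I) * f ξ

theorem circleCoeff_eq_fourierCoeffOn (f : ℝ → ℂ) (n : ℤ) :
    circleCoeff f n = fourierCoeffOn (zero_lt_one' ℝ) f n := by
  rw [fourierCoeffOn_eq_integral, circleCoeff]
  simp only [sub_zero, div_one, one_smul, smul_eq_mul]
  congr 1
  ext ξ
  rw [fourier_coe_apply]
  congr 2
  push_cast
  ring

theorem hasSum_circleCoeff_sq {f : ℝ → ℂ} (hf : Continuous f) :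
    HasSum (fun n => ‖circleCoeff f n‖ ^ 2) (∫ ξ in (0 : ℝ)..1, ‖f ξ‖ ^ 2) := by
  have hL : MemLp f 2 (volume.restrict (Set.Ioc (0 : ℝ) 1)) := by
    obtain ⟨C, hC⟩ := (isCompact_Icc (a := (0 : ℝ)) (b := 1)).exists_bound_of_continuousOn
      hf.continuousOn
    refine MemLp.of_bound hf.aestronglyMeasurable C ?_
    filter_upwards [ae_restrict_mem measurableSet_Ioc] with x hx
    exact hC x (Set.Ioc_subset_Icc_self hx)
  have h := hasSum_sq_fourierCoeffOn (zero_lt_one' ℝ) hL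
  simpa [circleCoeff_eq_fourierCoeffOn] using h

theorem circleCoeff_deriv {f f' : ℝ → ℂ} (hf : ∀ ξ, HasDerivAt f (f' ξ) ξ) (hf' : Continuous f')
    (hper : f 1 = f 0) (n : ℤ) :
    circleCoeff f' n = 2 * Real.pi * Complex.I * n * circleCoeff f n := by
  rcases eq_or_ne n 0 with rfl | hn
  · simp only [circleCoeff, Int.cast_zero, mul_zero, zero_mul, neg_zero, Complex.ofReal_zero,
      Complex.exp_zero, one_mul]
    rw [intervalIntegral.integral_eq_sub_of_hasDerivAt (fun x _ => hf x)
      (hf'.intervalIntegrable _ _), hper, sub_self]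
  · have h := fourierCoeffOn_of_hasDerivAt (zero_lt_one' ℝ) hn (fun x _ => hf x)
      (hf'.intervalIntegrable _ _)
    rw [← circleCoeff_eq_fourierCoeffOn, ← circleCoeff_eq_fourierCoeffOn, hper, sub_self, mul_zero]
      at h
    have h1 : (Real.pi : ℂ) ≠ 0 := by exact_mod_cast Real.pi_ne_zero
    have h2 : (n : ℂ) ≠ 0 := by exact_mod_cast hn
    rw [h]
    have := Complex.I_ne_zero
    field_simp
    simp

theorem continuous_circleCoeff_integrand {f : ℝ → ℂ} (hf : Continuous f) (n : ℤ) :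
    Continuous fun ξ : ℝ => Complex.exp ((-(2 * Real.pi * n * ξ) : ℝ) * Complex.I) * f ξ := by
  fun_prop

theorem circleCoeff_sub {f g : ℝ → ℂ} (hf : Continuous f) (hg : Continuous g) (n : ℤ) :
    circleCoeff (fun ξ => f ξ - g ξ) n = circleCoeff f n - circleCoeff g n := by
  simp only [circleCoeff, mul_sub]
  exact intervalIntegral.integral_sub ((continuous_circleCoeff_integrand hf n).intervalIntegrable _ _)
    ((continuous_circleCoeff_integrand hg n).intervalIntegrable _ _)

theorem circleCoeff_const_mul (c : ℂ) (f : ℝ → ℂ) (n : ℤ) :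
    circleCoeff (fun ξ => c * f ξ) n = c * circleCoeff f n := by
  simp only [circleCoeff, mul_left_comm _ c]
  exact intervalIntegral.integral_const_mul _ _

theorem circleCoeff_sum {ι : Type*} (s : Finset ι) {f : ι → ℝ → ℂ} (hf : ∀ i ∈ s, Continuous (f i))
    (n : ℤ) : circleCoeff (fun ξ => ∑ i ∈ s, f i ξ) n = ∑ i ∈ s, circleCoeff (f i) n := by
  simp only [circleCoeff, Finset.mul_sum]
  exact intervalIntegral.integral_finsetSum fun i hi =>
    (continuous_circleCoeff_integrand (hf i hi) n).intervalIntegrable _ _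

theorem circleCoeff_unitExp_pow_mul (f : ℝ → ℂ) (y : ℕ) (n : ℤ) :
    circleCoeff (fun ξ => unitExp ξ ^ y * f ξ) n = circleCoeff f (n - y) := by
  simp only [circleCoeff]
  congr 1
  ext ξ
  rw [← mul_assoc, unitExp_pow, ← Complex.exp_add]
  congr 2
  push_cast
  ring

theorem circleCoeff_one (n : ℤ) : circleCoeff (fun _ => 1) n = if n = 0 then 1 else 0 := by
  split_ifs with h
  · simp [circleCoeff, h]
  · have h1 := circleCoeff_deriv (f := fun _ => 1) (f' := fun _ => 0)
      (fun ξ => hasDerivAt_const ξ (1 : ℂ)) continuous_const rfl n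
    have h2 : circleCoeff (fun _ => 0) n = 0 := by simp [circleCoeff]
    rw [h2] at h1
    have h3 : (2 * Real.pi * Complex.I * n : ℂ) ≠ 0 := by
      simp [Real.pi_ne_zero, h]
    exact (mul_eq_zero.mp h1.symm).resolve_left h3

/-- Parseval for `f' - 2 π i m f`, whose `n`-th coefficient is `2 π i (n - m)` times that of `f`. -/
theorem hasSum_weighted_circleCoeff_sq {f f' : ℝ → ℂ} (hf : ∀ ξ, HasDerivAt f (f' ξ) ξ)
    (hf' : Continuous f') (hper : f 1 = f 0) (m : ℝ) :
    HasSum (fun n : ℤ => 4 * Real.pi ^ 2 * ((n : ℝ) - m) ^ 2 * ‖circleCoeff f n‖ ^ 2)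
      (∫ ξ in (0 : ℝ)..1, ‖f' ξ - 2 * Real.pi * Complex.I * m * f ξ‖ ^ 2) := by
  have hfc : Continuous f := continuous_iff_continuousAt.mpr fun ξ => (hf ξ).continuousAt
  have h := hasSum_circleCoeff_sq (f := fun ξ => f' ξ - 2 * Real.pi * Complex.I * m * f ξ)
    (by fun_prop)
  convert h using 2 with n
  rw [circleCoeff_sub hf' (by fun_prop), circleCoeff_const_mul, circleCoeff_deriv hf hf' hper,
    ← sub_mul, norm_mul, mul_pow]
  congr 1
  rw [show (2 * Real.pi * Complex.I * n - 2 * Real.pi * Complex.I * m : ℂ) =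
    ((2 * Real.pi * (n - m) : ℝ) : ℂ) * Complex.I by push_cast; ring, norm_mul, Complex.norm_real,
    Complex.norm_I, mul_one, Real.norm_eq_abs, sq_abs]
  ring

theorem HasSum.tsum_ofReal {ι : Type*} {f : ι → ℝ} {a : ℝ} (h : HasSum f a) (h0 : ∀ i, 0 ≤ f i) :
    ∑' i, ENNReal.ofReal (f i) = ENNReal.ofReal a := by
  rw [← ENNReal.ofReal_tsum_of_nonneg h0 h.summable, h.tsum_eq]

/-! ### The smooth multiplier and the size of its kernel. -/

/-- A smooth function equal to `1` on `(-∞, 1]` and to `0` on `[2, ∞)`. -/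
noncomputable def smoothCutoff (x : ℝ) : ℝ := Real.smoothTransition (2 - x)

theorem contDiff_smoothCutoff : ContDiff ℝ 1 smoothCutoff :=
  Real.smoothTransition.contDiff.comp (contDiff_const.sub contDiff_id)

theorem smoothCutoff_of_le {x : ℝ} (hx : x ≤ 1) : smoothCutoff x = 1 :=
  Real.smoothTransition.one_of_one_le (by linarith)

theorem smoothCutoff_of_ge {x : ℝ} (hx : 2 ≤ x) : smoothCutoff x = 0 :=
  Real.smoothTransition.zero_of_nonpos (by linarith)

theorem smoothCutoff_nonneg (x : ℝ) : 0 ≤ smoothCutoff x := Real.smoothTransition.nonneg _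

theorem smoothCutoff_le_one (x : ℝ) : smoothCutoff x ≤ 1 := Real.smoothTransition.le_one _

theorem deriv_smoothCutoff_of_lt {x : ℝ} (hx : x < 1) : deriv smoothCutoff x = 0 := by
  have : smoothCutoff =ᶠ[nhds x] fun _ => 1 := by
    filter_upwards [Iio_mem_nhds hx] with y hy using smoothCutoff_of_le (le_of_lt hy)
  rw [this.deriv_eq, deriv_const]

theorem deriv_smoothCutoff_of_gt {x : ℝ} (hx : 2 < x) : deriv smoothCutoff x = 0 := by
  have : smoothCutoff =ᶠ[nhds x] fun _ => 0 := by
    filter_upwards [Ioi_mem_nhds hx] with y hy using smoothCutoff_of_ge (le_of_lt hy)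
  rw [this.deriv_eq, deriv_const]

theorem continuous_deriv_smoothCutoff : Continuous (deriv smoothCutoff) :=
  contDiff_smoothCutoff.continuous_deriv le_rfl

theorem exists_deriv_smoothCutoff_bound : ∃ B : ℝ, 0 ≤ B ∧ ∀ x, deriv smoothCutoff x ^ 2 ≤ B := by
  obtain ⟨B, hB⟩ := (isCompact_Icc (a := (1 : ℝ)) (b := 2)).exists_bound_of_continuousOn
    ((continuous_deriv_smoothCutoff.pow 2).continuousOn)
  refine ⟨max B 0, le_max_right _ _, fun x => ?_⟩
  by_cases h1 : x < 1
  · rw [deriv_smoothCutoff_of_lt h1]; simp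
  by_cases h2 : 2 < x
  · rw [deriv_smoothCutoff_of_gt h2]; simp
  · have := hB x ⟨not_lt.mp h1, not_lt.mp h2⟩
    rw [Real.norm_eq_abs] at this
    exact (le_abs_self _).trans (this.trans (le_max_left _ _))

/-- A bound for the squared derivative of `smoothCutoff`. -/
noncomputable def cutoffBound : ℝ := exists_deriv_smoothCutoff_bound.choose

theorem cutoffBound_nonneg : 0 ≤ cutoffBound := exists_deriv_smoothCutoff_bound.choose_spec.1

theorem deriv_smoothCutoff_sq_le (x : ℝ) : deriv smoothCutoff x ^ 2 ≤ cutoffBound :=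
  exists_deriv_smoothCutoff_bound.choose_spec.2 x

/-- The Fourier multiplier that localises to small values of `trigEnergy`. -/
noncomputable def multiplier {k : ℕ} (u : ℝ) (t : Fin k → ℕ) (Λ ξ : ℝ) : ℝ :=
  smoothCutoff (trigEnergy u t ξ / Λ)

/-- The derivative of `multiplier`. -/
noncomputable def multiplierDeriv {k : ℕ} (u : ℝ) (t : Fin k → ℕ) (Λ ξ : ℝ) : ℝ :=
  deriv smoothCutoff (trigEnergy u t ξ / Λ) * (trigEnergyDeriv u t ξ / Λ)

section Multiplier

variable {k : ℕ} {u Λ : ℝ} (t : Fin k → ℕ)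

theorem hasDerivAt_multiplier (ξ : ℝ) :
    HasDerivAt (multiplier u t Λ) (multiplierDeriv u t Λ ξ) ξ := by
  have h1 := (contDiff_smoothCutoff.differentiable (by norm_num)
    (trigEnergy u t ξ / Λ)).hasDerivAt
  exact h1.comp ξ ((hasDerivAt_trigEnergy t ξ).div_const Λ)

theorem continuous_multiplier : Continuous (multiplier u t Λ) :=
  contDiff_smoothCutoff.continuous.comp ((continuous_trigEnergy t).div_const Λ)

theorem continuous_multiplierDeriv : Continuous (multiplierDeriv u t Λ) :=
  (continuous_deriv_smoothCutoff.comp ((continuous_trigEnergy t).div_const Λ)).mul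
    ((continuous_trigEnergyDeriv t).div_const Λ)

theorem multiplier_one_eq_zero : multiplier u t Λ 1 = multiplier u t Λ 0 := by
  have := trigEnergy_periodic (u := u) t 0
  rw [zero_add] at this
  rw [multiplier, multiplier, this]

/-- The multiplier vanishes once the energy reaches `2 Λ`, and below that the right-hand side is at
least `1`. The indicator of a sublevel set is thus replaced by an exponential whose integral is
known. -/
theorem multiplier_sq_le (ξ : ℝ) :
    multiplier u t Λ ξ ^ 2 ≤ Real.exp 2 * Real.exp (-(Λ⁻¹ * trigEnergy u t ξ)) := by
  rw [← Real.exp_add]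
  by_cases h : 2 ≤ trigEnergy u t ξ / Λ
  · rw [multiplier, smoothCutoff_of_ge h, zero_pow two_ne_zero]; exact (Real.exp_pos _).le
  · have h1 : multiplier u t Λ ξ ^ 2 ≤ 1 :=
      pow_le_one₀ (smoothCutoff_nonneg _) (smoothCutoff_le_one _)
    refine h1.trans (Real.one_le_exp ?_)
    rw [div_eq_inv_mul] at h
    linarith

/-- The derivative of the cutoff lives on the transition region `Λ ≤ f ≤ 2 Λ`; there
`trigEnergyDeriv_sq_le` applies. -/
theorem multiplierDeriv_sq_eq_zero_or (hΛ : 1 ≤ Λ) (ht : ∀ i, t i ≤ k)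
    (ξ : ℝ) :
    multiplierDeriv u t Λ ξ ^ 2 = 0 ∨ (Λ ≤ trigEnergy u t ξ ∧ trigEnergy u t ξ ≤ 2 * Λ ∧
      multiplierDeriv u t Λ ξ ^ 2 ≤
        cutoffBound * (4 * Real.pi ^ 2 * (u * k ^ 3) * (trigEnergy u t ξ / Λ ^ 2))) := by
  have hΛ0 : 0 < Λ := by linarith
  by_cases h1 : trigEnergy u t ξ / Λ < 1
  · left; rw [multiplierDeriv, deriv_smoothCutoff_of_lt h1]; ring
  by_cases h2 : 2 < trigEnergy u t ξ / Λ
  · left; rw [multiplierDeriv, deriv_smoothCutoff_of_gt h2]; ring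
  right
  rw [not_lt, le_div_iff₀ hΛ0, one_mul] at h1
  rw [not_lt, div_le_iff₀ hΛ0] at h2
  refine ⟨h1, h2, ?_⟩
  rw [multiplierDeriv, mul_pow, div_pow]
  refine mul_le_mul (deriv_smoothCutoff_sq_le _) ?_ (by positivity) cutoffBound_nonneg
  rw [← mul_div_assoc]
  gcongr
  exact trigEnergyDeriv_sq_le t ht ξ

theorem multiplierDeriv_sq_le (hΛ : 1 ≤ Λ) (ht : ∀ i, t i ≤ k) (hu : 0 ≤ u) (ξ : ℝ) :
    multiplierDeriv u t Λ ξ ^ 2 ≤ 8 * Real.pi ^ 2 * cutoffBound * (u * k ^ 3) * Real.exp 2 *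
      Real.exp (-(Λ⁻¹ * trigEnergy u t ξ)) := by
  have hB := cutoffBound_nonneg
  rcases multiplierDeriv_sq_eq_zero_or t hΛ ht ξ with h | ⟨h1, h2, h3⟩
  · rw [h]; positivity
  have hΛ0 : 0 < Λ := by linarith
  refine h3.trans ?_
  have h4 : trigEnergy u t ξ / Λ ^ 2 ≤ 2 := by
    rw [div_le_iff₀ (by positivity)]
    nlinarith
  have h5 : 1 ≤ Real.exp 2 * Real.exp (-(Λ⁻¹ * trigEnergy u t ξ)) := by
    rw [← Real.exp_add]
    apply Real.one_le_exp
    have : Λ⁻¹ * trigEnergy u t ξ ≤ 2 := by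
      rw [inv_mul_le_iff₀ hΛ0]; linarith
    linarith
  calc cutoffBound * (4 * Real.pi ^ 2 * (u * k ^ 3) * (trigEnergy u t ξ / Λ ^ 2))
      ≤ cutoffBound * (4 * Real.pi ^ 2 * (u * k ^ 3) * 2) * 1 := by
        rw [mul_one]; gcongr
    _ ≤ cutoffBound * (4 * Real.pi ^ 2 * (u * k ^ 3) * 2) *
        (Real.exp 2 * Real.exp (-(Λ⁻¹ * trigEnergy u t ξ))) := by gcongr
    _ = _ := by ring

/-- The bound for the measure of the set of relevant frequencies. -/
noncomputable def freqBound (k : ℕ) (u Λ : ℝ) : ℝ := Real.sqrt (Real.pi * Λ / (4 * (u * k)))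

theorem freqBound_nonneg (k : ℕ) (u Λ : ℝ) : 0 ≤ freqBound k u Λ := Real.sqrt_nonneg _

theorem integral_exp_inv_trigEnergy_le (hΛ : 1 ≤ Λ) (hu : 0 < u) (hk : 1 ≤ k)
    (ht : ∀ i, 1 ≤ t i) :
    ∫ ξ in (0 : ℝ)..1, Real.exp (-(Λ⁻¹ * trigEnergy u t ξ)) ≤ freqBound k u Λ := by
  have hΛ0 : 0 < Λ := by linarith
  refine (integral_exp_trigEnergy_le t hu hk ht (inv_pos.mpr hΛ0)).trans (le_of_eq ?_)
  rw [freqBound]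
  congr 1
  field_simp

/-- The weighted `ℓ²` norm of the smoothing kernel. -/
theorem tsum_multiplierCoeff_le (hΛ : 1 ≤ Λ) (hu : 0 < u) (hk : 1 ≤ k) (ht : ∀ i, 1 ≤ t i)
    (ht' : ∀ i, t i ≤ k) {σ : ℝ} (hσ : 0 < σ) (hs : u * k ^ 3 ≤ σ ^ 2) :
    ∑' n : ℤ, ENNReal.ofReal ((1 + ((n : ℝ) / σ) ^ 2) *
      ‖circleCoeff (fun ξ => (multiplier u t Λ ξ : ℂ)) n‖ ^ 2) ≤
      ENNReal.ofReal ((1 + 2 * cutoffBound) * Real.exp 2 * freqBound k u Λ) := by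
  have hB := cutoffBound_nonneg
  have hΛ0 : 0 < Λ := by linarith
  have hc : Continuous fun ξ => (multiplier u t Λ ξ : ℂ) :=
    Complex.continuous_ofReal.comp (continuous_multiplier t)
  have hc' : Continuous fun ξ => (multiplierDeriv u t Λ ξ : ℂ) :=
    Complex.continuous_ofReal.comp (continuous_multiplierDeriv t)
  have h1 := hasSum_circleCoeff_sq hc
  have h2 := hasSum_weighted_circleCoeff_sq (f := fun ξ => (multiplier u t Λ ξ : ℂ))
    (fun ξ => (hasDerivAt_multiplier t ξ).ofReal_comp) hc'
    (by simp only [multiplier_one_eq_zero]) 0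
  -- The factor converts the Parseval weight `4 π² n²` of the derivative into `(n / σ)²`.
  have h3 := (h1.add (h2.mul_left (1 / (4 * Real.pi ^ 2 * σ ^ 2))))
  have hpi := Real.pi_pos
  have h4 := h3.tsum_ofReal (fun n => by positivity)
  have hint : ∫ ξ in (0 : ℝ)..1, ‖(multiplier u t Λ ξ : ℂ)‖ ^ 2 ≤
      Real.exp 2 * freqBound k u Λ := by
    refine le_trans ?_ (mul_le_mul_of_nonneg_left (integral_exp_inv_trigEnergy_le t hΛ hu hk ht)
      (Real.exp_pos _).le)
    rw [← intervalIntegral.integral_const_mul]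
    have hce := continuous_trigEnergy (u := u) t
    refine intervalIntegral.integral_mono_on (by norm_num)
      (Continuous.intervalIntegrable (by fun_prop) _ _)
      (Continuous.intervalIntegrable (by fun_prop) _ _) fun ξ _ => ?_
    rw [Complex.norm_real, Real.norm_eq_abs, sq_abs]
    exact multiplier_sq_le t ξ
  have hint' : ∫ ξ in (0 : ℝ)..1, ‖(multiplierDeriv u t Λ ξ : ℂ) -
      2 * Real.pi * Complex.I * (0 : ℝ) * (multiplier u t Λ ξ : ℂ)‖ ^ 2 ≤
      8 * Real.pi ^ 2 * cutoffBound * (u * k ^ 3) * Real.exp 2 * freqBound k u Λ := by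
    refine le_trans ?_ (mul_le_mul_of_nonneg_left (integral_exp_inv_trigEnergy_le t hΛ hu hk ht)
      (by positivity))
    rw [← intervalIntegral.integral_const_mul]
    have hce := continuous_trigEnergy (u := u) t
    refine intervalIntegral.integral_mono_on (by norm_num)
      (Continuous.intervalIntegrable (by fun_prop) _ _)
      (Continuous.intervalIntegrable (by fun_prop) _ _) fun ξ _ => ?_
    simp only [Complex.ofReal_zero, mul_zero, zero_mul, sub_zero]
    rw [Complex.norm_real, Real.norm_eq_abs, sq_abs]
    exact multiplierDeriv_sq_le t hΛ ht' hu.le ξ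
  have heq : ∀ n : ℤ, (1 + ((n : ℝ) / σ) ^ 2) *
      ‖circleCoeff (fun ξ => (multiplier u t Λ ξ : ℂ)) n‖ ^ 2 =
      ‖circleCoeff (fun ξ => (multiplier u t Λ ξ : ℂ)) n‖ ^ 2 + 1 / (4 * Real.pi ^ 2 * σ ^ 2) *
      (4 * Real.pi ^ 2 * ((n : ℝ) - 0) ^ 2 *
        ‖circleCoeff (fun ξ => (multiplier u t Λ ξ : ℂ)) n‖ ^ 2) := by
    intro n
    field_simp
    ring
  simp_rw [heq]
  rw [h4]
  refine ENNReal.ofReal_le_ofReal ?_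
  have hG := freqBound_nonneg k u Λ
  have h5 : 1 / (4 * Real.pi ^ 2 * σ ^ 2) * (8 * Real.pi ^ 2 * cutoffBound * (u * k ^ 3) *
      Real.exp 2 * freqBound k u Λ) ≤ 2 * cutoffBound * Real.exp 2 * freqBound k u Λ := by
    rw [one_div_mul_eq_div, div_le_iff₀ (by positivity)]
    calc 8 * Real.pi ^ 2 * cutoffBound * (u * k ^ 3) * Real.exp 2 * freqBound k u Λ
        ≤ 8 * Real.pi ^ 2 * cutoffBound * σ ^ 2 * Real.exp 2 * freqBound k u Λ := by gcongr
      _ = _ := by ring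
  have h6 := mul_le_mul_of_nonneg_left hint' (by positivity : 0 ≤ 1 / (4 * Real.pi ^ 2 * σ ^ 2))
  calc _ ≤ Real.exp 2 * freqBound k u Λ + 2 * cutoffBound * Real.exp 2 * freqBound k u Λ :=
        add_le_add hint (h6.trans h5)
    _ = _ := by ring

end Multiplier

/-! ### The bias of smoothing. -/

theorem continuous_polyChar (q : Polynomial ℝ) : Continuous (polyChar q) :=
  continuous_iff_continuousAt.mpr fun ξ => (hasDerivAt_polyChar q ξ).continuousAt

theorem continuous_unitExp : Continuous unitExp :=
  continuous_iff_continuousAt.mpr fun ξ => (hasDerivAt_unitExp ξ).continuousAt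

theorem continuous_polyCharMoment (q : Polynomial ℝ) : Continuous (polyCharMoment q) := by
  unfold polyCharMoment
  exact ((Polynomial.continuous_aeval _).comp continuous_unitExp).sub
    (continuous_const.mul (continuous_polyChar q))

theorem unitExp_one : unitExp 1 = unitExp 0 := by
  simp [unitExp, Complex.exp_two_pi_mul_I]

/-- A linear factor of the energy is paid for with half of an exponential. The proof squares `1 + x
/ 4 ≤ exp (x / 4)` and uses `(1 + x / 4)² ≥ x`. -/
theorem mul_exp_neg_half_le_one {x : ℝ} : x * Real.exp (-(x / 2)) ≤ 1 := by
  rw [Real.exp_neg, ← div_eq_mul_inv, div_le_one (Real.exp_pos _)]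
  have h1 := Real.add_one_le_exp (x / 4)
  have h2 : Real.exp (x / 2) = Real.exp (x / 4) ^ 2 := by
    rw [← Real.exp_nat_mul]; congr 1; push_cast; ring
  rw [h2]
  have h3 := Real.exp_pos (x / 4)
  rcases le_or_gt x (-4) with hx | hx
  · nlinarith
  · have : (x / 4 + 1) ^ 2 ≤ Real.exp (x / 4) ^ 2 := by
      apply pow_le_pow_left₀ (by linarith) h1
    nlinarith [sq_nonneg (x / 4 - 1)]

theorem circleCoeff_polyChar_mul {k : ℕ} {q : Polynomial ℝ} (hq : IsProbPoly k q) {f : ℝ → ℂ}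
    (hf : Continuous f) (n : ℤ) :
    circleCoeff (fun ξ => polyChar q ξ * f ξ) n =
      ∑ y ∈ Finset.range k, (q.coeff y : ℂ) * circleCoeff f (n - y) := by
  have h : (fun ξ => polyChar q ξ * f ξ) =
      fun ξ => ∑ y ∈ Finset.range k, (q.coeff y : ℂ) * (unitExp ξ ^ y * f ξ) := by
    ext ξ
    rw [hq.polyChar_eq, Finset.sum_mul]
    exact Finset.sum_congr rfl fun y _ => by ring
  have hc := continuous_unitExp
  rw [h, circleCoeff_sum _ (fun y _ => by fun_prop)]
  simp_rw [circleCoeff_const_mul, circleCoeff_unitExp_pow_mul]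

theorem circleCoeff_polyChar {k : ℕ} {q : Polynomial ℝ} (hq : IsProbPoly k q) (x : ℕ) :
    circleCoeff (polyChar q) x = q.coeff x := by
  have h := circleCoeff_polyChar_mul hq (f := fun _ => 1) continuous_const x
  simp only [mul_one, circleCoeff_one] at h
  rw [show polyChar q = fun ξ => polyChar q ξ from rfl, h]
  simp only [sub_eq_zero, Nat.cast_inj, mul_ite, mul_one, mul_zero]
  rw [Finset.sum_ite_eq]
  split_ifs with hx
  · rfl
  · rw [hq.coeff_eq_zero x (by simpa using hx)]; rfl

/-- The factor `1 - f` measures what is lost in expectation: a product of characteristic function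
and multiplier is the convolution of the distribution with the kernel. -/
theorem circleCoeff_bias {k : ℕ} {q : Polynomial ℝ} (hq : IsProbPoly k q) {f : ℝ → ℂ}
    (hf : Continuous f) (x : ℕ) :
    circleCoeff (fun ξ => polyChar q ξ * (1 - f ξ)) x = (q.coeff x : ℂ) -
      ∑ y ∈ Finset.range k, (q.coeff y : ℂ) * circleCoeff f (x - y) := by
  have h : (fun ξ => polyChar q ξ * (1 - f ξ)) =
      fun ξ => polyChar q ξ - polyChar q ξ * f ξ := by
    ext ξ; ring
  rw [h, circleCoeff_sub (continuous_polyChar q) (by have := continuous_polyChar q; fun_prop),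
    circleCoeff_polyChar hq, circleCoeff_polyChar_mul hq hf]

section Bias

variable {ι : Type*} {s : Finset ι} {k K : ℕ} {q : ι → Polynomial ℝ} {u Λ : ℝ} {t : Fin k → ℕ}

/-- Only frequencies with `f > Λ` matter. There `exp (-2 f)` is split in two: `exp (-Λ / 2)` is the
small factor, while `exp (-f / Λ)` is kept so that the integral still sees the measure of the
relevant frequencies. -/
theorem biasSq_le (hdom : ∀ ξ, trigEnergy u t ξ ≤ ∑ i ∈ s, charEnergy (q i) ξ)
    (hΛ : 1 ≤ Λ) (hu : 0 < u) (ξ : ℝ) :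
    ‖polyChar (∏ i ∈ s, q i) ξ * (1 - (multiplier u t Λ ξ : ℂ))‖ ^ 2 ≤
      Real.exp (-(Λ / 2)) * Real.exp (-(Λ⁻¹ * trigEnergy u t ξ)) := by
  have hΛ0 : 0 < Λ := by linarith
  have h0 := trigEnergy_nonneg t hu.le ξ
  rw [norm_mul, mul_pow]
  have h1 : ‖(1 : ℂ) - multiplier u t Λ ξ‖ = |1 - multiplier u t Λ ξ| := by
    rw [← Real.norm_eq_abs, ← Complex.norm_real]; push_cast; rfl
  rw [h1, sq_abs]
  by_cases hc : trigEnergy u t ξ / Λ ≤ 1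
  · rw [multiplier, smoothCutoff_of_le hc, sub_self, zero_pow two_ne_zero, mul_zero]; positivity
  rw [not_le, lt_div_iff₀ hΛ0, one_mul] at hc
  have h2 : (1 - multiplier u t Λ ξ) ^ 2 ≤ 1 :=
    pow_le_one₀ (by linarith [smoothCutoff_le_one (trigEnergy u t ξ / Λ), multiplier.eq_1 u t Λ ξ])
      (by linarith [smoothCutoff_nonneg (trigEnergy u t ξ / Λ), multiplier.eq_1 u t Λ ξ])
  have h3 : ‖polyChar (∏ i ∈ s, q i) ξ‖ ^ 2 ≤ Real.exp (-(trigEnergy u t ξ)) ^ 2 := by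
    gcongr
    exact (norm_polyChar_prod_le s ξ).trans (Real.exp_le_exp.mpr (by linarith [hdom ξ]))
  have h4 : Λ⁻¹ * trigEnergy u t ξ ≤ trigEnergy u t ξ :=
    mul_le_of_le_one_left h0 (inv_le_one_of_one_le₀ hΛ)
  calc _ ≤ Real.exp (-(trigEnergy u t ξ)) ^ 2 * 1 := by gcongr
    _ = Real.exp (2 * -(trigEnergy u t ξ)) := by rw [mul_one, ← Real.exp_nat_mul]; norm_num
    _ ≤ _ := by
      rw [← Real.exp_add]
      apply Real.exp_le_exp.mpr
      linarith

/-- The same estimate for the centred derivative of the bias. The product rule gives one term with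
the centred moment and one with the derivative of the multiplier; each contributes a factor `V` and
a factor linear in the energy, absorbed by the exponential. -/
theorem biasDerivSq_le (hq : ∀ i ∈ s, IsProbPoly K (q i))
    (hdom : ∀ ξ, trigEnergy u t ξ ≤ ∑ i ∈ s, charEnergy (q i) ξ)
    (hΛ : 1 ≤ Λ) (hu : 0 < u) (ht : ∀ i, t i ≤ k) {V : ℝ} (hV : polyVar (∏ i ∈ s, q i) = V)
    (hs : u * k ^ 3 ≤ V) (ξ : ℝ) :
    ‖2 * Real.pi * Complex.I * polyCharMoment (∏ i ∈ s, q i) ξ * (1 - (multiplier u t Λ ξ : ℂ)) -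
      polyChar (∏ i ∈ s, q i) ξ * (multiplierDeriv u t Λ ξ : ℂ)‖ ^ 2 ≤
      4 * Real.pi ^ 2 * V * (4 * Real.exp 1 + 2 * cutoffBound) * Real.exp (-(Λ / 2)) *
        Real.exp (-(Λ⁻¹ * trigEnergy u t ξ)) := by
  have hΛ0 : 0 < Λ := by linarith
  have hB := cutoffBound_nonneg
  have h0 := trigEnergy_nonneg t hu.le ξ
  have hs0 : 0 ≤ u * (k : ℝ) ^ 3 := by positivity
  have hV0 : 0 ≤ V := hs0.trans hs
  have h4 : Λ⁻¹ * trigEnergy u t ξ ≤ trigEnergy u t ξ :=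
    mul_le_of_le_one_left h0 (inv_le_one_of_one_le₀ hΛ)
  set F := ∑ i ∈ s, charEnergy (q i) ξ with hF
  set f := trigEnergy u t ξ with hf
  have hFf : f ≤ F := hdom ξ
  have hF0 : 0 ≤ F := h0.trans hFf
  by_cases hc : f < Λ
  · have h1 : multiplier u t Λ ξ = 1 :=
      smoothCutoff_of_le (by rw [div_le_one hΛ0]; exact hc.le)
    have h2 : multiplierDeriv u t Λ ξ = 0 := by
      rw [multiplierDeriv, deriv_smoothCutoff_of_lt (by rw [div_lt_one hΛ0]; exact hc), zero_mul]
    rw [h1, h2]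
    simp
    positivity
  rw [not_lt] at hc
  -- As `f ≥ Λ`, a third of the exponent `3 f / 2` gives `Λ / 2` and the rest gives `f / Λ`.
  have hE : Real.exp (-(3 / 2 * f)) ≤ Real.exp (-(Λ / 2)) * Real.exp (-(Λ⁻¹ * f)) := by
    rw [← Real.exp_add]
    exact Real.exp_le_exp.mpr (by linarith)
  have hab : ∀ a b : ℂ, ‖a - b‖ ^ 2 ≤ 2 * ‖a‖ ^ 2 + 2 * ‖b‖ ^ 2 := fun a b => by
    have := norm_sub_le a b
    nlinarith [norm_nonneg a, norm_nonneg b, norm_nonneg (a - b), sq_nonneg (‖a‖ - ‖b‖)]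
  have hA : ‖2 * Real.pi * Complex.I * polyCharMoment (∏ i ∈ s, q i) ξ *
      (1 - (multiplier u t Λ ξ : ℂ))‖ ^ 2 ≤
      8 * Real.pi ^ 2 * V * Real.exp 1 * Real.exp (-(3 / 2 * f)) := by
    have h1 : ‖(1 : ℂ) - multiplier u t Λ ξ‖ = |1 - multiplier u t Λ ξ| := by
      rw [← Real.norm_eq_abs, ← Complex.norm_real]; push_cast; rfl
    have h2 : (1 - multiplier u t Λ ξ) ^ 2 ≤ 1 :=
      pow_le_one₀
        (by linarith [smoothCutoff_le_one (trigEnergy u t ξ / Λ), multiplier.eq_1 u t Λ ξ])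
        (by linarith [smoothCutoff_nonneg (trigEnergy u t ξ / Λ), multiplier.eq_1 u t Λ ξ])
    have h3 : ‖polyCharMoment (∏ i ∈ s, q i) ξ‖ ^ 2 ≤
        V * (2 * F) * Real.exp (1 - 2 * F) := by
      have h := norm_polyCharMoment_prod_le s hq ξ
      rw [hV, ← hF] at h
      calc _ ≤ (Real.sqrt V * Real.sqrt (2 * F) * Real.exp (1 / 2 - F)) ^ 2 := by gcongr
        _ = V * (2 * F) * Real.exp (1 / 2 - F) ^ 2 := by
          rw [mul_pow, mul_pow, Real.sq_sqrt hV0, Real.sq_sqrt (by linarith)]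
        _ = _ := by rw [← Real.exp_nat_mul]; congr 2; push_cast; ring
    -- Of the decay `exp (-2 F)`, the part `exp (-F / 2)` absorbs the factor `F`, and `exp (-3 F /
    -- 2)` is left.
    have h5 : F * Real.exp (1 - 2 * F) ≤ Real.exp 1 * Real.exp (-(3 / 2 * f)) := by
      calc F * Real.exp (1 - 2 * F) =
          (F * Real.exp (-(F / 2))) * (Real.exp 1 * Real.exp (-(3 / 2 * F))) := by
            rw [mul_assoc, ← Real.exp_add, ← Real.exp_add]; congr 2; ring
        _ ≤ 1 * (Real.exp 1 * Real.exp (-(3 / 2 * f))) := by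
            gcongr
            exact mul_exp_neg_half_le_one
        _ = _ := one_mul _
    rw [norm_mul, mul_pow, h1, sq_abs]
    have h6 : ‖2 * Real.pi * Complex.I * polyCharMoment (∏ i ∈ s, q i) ξ‖ ^ 2 =
        4 * Real.pi ^ 2 * ‖polyCharMoment (∏ i ∈ s, q i) ξ‖ ^ 2 := by
      rw [norm_mul, norm_mul, norm_mul, Complex.norm_I, Complex.norm_real,
        Real.norm_of_nonneg Real.pi_pos.le, Complex.norm_ofNat]
      ring
    rw [h6]
    calc _ ≤ 4 * Real.pi ^ 2 * (V * (2 * F) * Real.exp (1 - 2 * F)) * 1 := by gcongr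
      _ = 8 * Real.pi ^ 2 * V * (F * Real.exp (1 - 2 * F)) := by ring
      _ ≤ 8 * Real.pi ^ 2 * V * (Real.exp 1 * Real.exp (-(3 / 2 * f))) := by gcongr
      _ = _ := by ring
  have hB' : ‖polyChar (∏ i ∈ s, q i) ξ * (multiplierDeriv u t Λ ξ : ℂ)‖ ^ 2 ≤
      4 * Real.pi ^ 2 * V * cutoffBound * Real.exp (-(3 / 2 * f)) := by
    have h3 : ‖polyChar (∏ i ∈ s, q i) ξ‖ ^ 2 ≤ Real.exp (-f) ^ 2 := by
      gcongr
      exact (norm_polyChar_prod_le s ξ).trans (Real.exp_le_exp.mpr (by linarith))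
    have h5 : multiplierDeriv u t Λ ξ ^ 2 ≤ cutoffBound * (4 * Real.pi ^ 2 * V * f) := by
      rcases multiplierDeriv_sq_eq_zero_or t hΛ ht (u := u) ξ with h | ⟨_, _, h⟩
      · rw [h]; positivity
      · refine h.trans ?_
        have : f / Λ ^ 2 ≤ f := div_le_self h0 (one_le_pow₀ hΛ)
        gcongr
    rw [norm_mul, mul_pow, Complex.norm_real, Real.norm_eq_abs, sq_abs]
    calc _ ≤ Real.exp (-f) ^ 2 * (cutoffBound * (4 * Real.pi ^ 2 * V * f)) := by gcongr
      _ = 4 * Real.pi ^ 2 * V * cutoffBound *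
          ((f * Real.exp (-(f / 2))) * Real.exp (-(3 / 2 * f))) := by
        rw [← Real.exp_nat_mul, mul_assoc f, ← Real.exp_add]
        rw [show -(f / 2) + -(3 / 2 * f) = (2 : ℕ) * -f by push_cast; ring]
        ring
      _ ≤ 4 * Real.pi ^ 2 * V * cutoffBound * (1 * Real.exp (-(3 / 2 * f))) := by
        gcongr
        exact mul_exp_neg_half_le_one
      _ = _ := by ring
  refine (hab _ _).trans ?_
  calc _ ≤ 2 * (8 * Real.pi ^ 2 * V * Real.exp 1 * Real.exp (-(3 / 2 * f))) +
        2 * (4 * Real.pi ^ 2 * V * cutoffBound * Real.exp (-(3 / 2 * f))) := by gcongr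
    _ = 4 * Real.pi ^ 2 * V * (4 * Real.exp 1 + 2 * cutoffBound) * Real.exp (-(3 / 2 * f)) := by
      ring
    _ ≤ 4 * Real.pi ^ 2 * V * (4 * Real.exp 1 + 2 * cutoffBound) *
        (Real.exp (-(Λ / 2)) * Real.exp (-(Λ⁻¹ * f))) := by gcongr
    _ = _ := by ring

/-- The weighted `ℓ²` norm of the bias of the smoothing kernel. -/
theorem tsum_bias_le (hq : ∀ i ∈ s, IsProbPoly K (q i))
    (hdom : ∀ ξ, trigEnergy u t ξ ≤ ∑ i ∈ s, charEnergy (q i) ξ)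
    (hΛ : 1 ≤ Λ) (hu : 0 < u) (hk : 1 ≤ k) (ht : ∀ i, t i ≤ k) (ht' : ∀ i, 1 ≤ t i) {σ : ℝ}
    (hσ : 0 < σ) (hV : polyVar (∏ i ∈ s, q i) = σ ^ 2) (hs : u * k ^ 3 ≤ σ ^ 2) :
    ∑' n : ℤ, ENNReal.ofReal ((1 + (((n : ℝ) - polyMean (∏ i ∈ s, q i)) / σ) ^ 2) *
      ‖circleCoeff (fun ξ => polyChar (∏ i ∈ s, q i) ξ * (1 - (multiplier u t Λ ξ : ℂ))) n‖ ^ 2) ≤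
      ENNReal.ofReal ((1 + 4 * Real.exp 1 + 2 * cutoffBound) * Real.exp (-(Λ / 2)) *
        freqBound k u Λ) := by
  have hB := cutoffBound_nonneg
  have hG := freqBound_nonneg k u Λ
  have hpi := Real.pi_pos
  set p := ∏ i ∈ s, q i with hp
  set m := polyMean p with hm
  have hcm : Continuous fun ξ => (multiplier u t Λ ξ : ℂ) :=
    Complex.continuous_ofReal.comp (continuous_multiplier t)
  have hcm' : Continuous fun ξ => (multiplierDeriv u t Λ ξ : ℂ) :=
    Complex.continuous_ofReal.comp (continuous_multiplierDeriv t)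
  have hcp := continuous_polyChar p
  have hcp' := continuous_polyCharMoment p
  have hce := continuous_trigEnergy (u := u) t
  have h1 := hasSum_circleCoeff_sq
    (f := fun ξ => polyChar p ξ * (1 - (multiplier u t Λ ξ : ℂ))) (by fun_prop)
  have h2 := hasSum_weighted_circleCoeff_sq
    (f := fun ξ => polyChar p ξ * (1 - (multiplier u t Λ ξ : ℂ)))
    (fun ξ => (hasDerivAt_polyChar p ξ).mul ((hasDerivAt_multiplier t ξ).ofReal_comp.const_sub 1))
    (by fun_prop)
    (by simp only [multiplier_one_eq_zero, polyChar, unitExp_one]) m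
  have h3 := (h1.add (h2.mul_left (1 / (4 * Real.pi ^ 2 * σ ^ 2))))
  have h4 := h3.tsum_ofReal (fun n => by positivity)
  have hint : ∫ ξ in (0 : ℝ)..1, ‖polyChar p ξ * (1 - (multiplier u t Λ ξ : ℂ))‖ ^ 2 ≤
      Real.exp (-(Λ / 2)) * freqBound k u Λ := by
    refine le_trans ?_ (mul_le_mul_of_nonneg_left (integral_exp_inv_trigEnergy_le t hΛ hu hk ht')
      (Real.exp_pos _).le)
    rw [← intervalIntegral.integral_const_mul]
    refine intervalIntegral.integral_mono_on (by norm_num)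
      (Continuous.intervalIntegrable (by fun_prop) _ _)
      (Continuous.intervalIntegrable (by fun_prop) _ _) fun ξ _ => ?_
    exact biasSq_le hdom hΛ hu ξ
  have hint' := intervalIntegral.integral_mono_on (a := 0) (b := 1) (μ := volume) (by norm_num)
    (f := fun ξ => ‖2 * Real.pi * Complex.I * polyCharMoment p ξ *
      (1 - (multiplier u t Λ ξ : ℂ)) - polyChar p ξ * (multiplierDeriv u t Λ ξ : ℂ)‖ ^ 2)
    (Continuous.intervalIntegrable (by fun_prop) _ _)
    (Continuous.intervalIntegrable (by fun_prop) _ _)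
    fun ξ _ => biasDerivSq_le hq hdom hΛ hu ht hV hs ξ
  rw [intervalIntegral.integral_const_mul] at hint'
  have hint'' := hint'.trans (mul_le_mul_of_nonneg_left
    (integral_exp_inv_trigEnergy_le t hΛ hu hk ht') (by positivity))
  have heq : ∀ n : ℤ, (1 + (((n : ℝ) - m) / σ) ^ 2) *
      ‖circleCoeff (fun ξ => polyChar p ξ * (1 - (multiplier u t Λ ξ : ℂ))) n‖ ^ 2 =
      ‖circleCoeff (fun ξ => polyChar p ξ * (1 - (multiplier u t Λ ξ : ℂ))) n‖ ^ 2 +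
        1 / (4 * Real.pi ^ 2 * σ ^ 2) * (4 * Real.pi ^ 2 * ((n : ℝ) - m) ^ 2 *
        ‖circleCoeff (fun ξ => polyChar p ξ * (1 - (multiplier u t Λ ξ : ℂ))) n‖ ^ 2) := by
    intro n
    field_simp
  simp_rw [heq]
  rw [h4]
  refine ENNReal.ofReal_le_ofReal ?_
  -- Centring at the mean removes the drift term of the derivative.
  have hcongr : ∀ ξ, 2 * Real.pi * Complex.I * (polyCharMoment p ξ + polyMean p * polyChar p ξ) *
      (1 - (multiplier u t Λ ξ : ℂ)) + polyChar p ξ * -(multiplierDeriv u t Λ ξ : ℂ) -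
      2 * Real.pi * Complex.I * m * (polyChar p ξ * (1 - (multiplier u t Λ ξ : ℂ))) =
      2 * Real.pi * Complex.I * polyCharMoment p ξ *
      (1 - (multiplier u t Λ ξ : ℂ)) - polyChar p ξ * (multiplierDeriv u t Λ ξ : ℂ) := by
    intro ξ
    rw [hm]
    ring
  simp_rw [hcongr]
  have h6 := mul_le_mul_of_nonneg_left hint'' (by positivity : 0 ≤ 1 / (4 * Real.pi ^ 2 * σ ^ 2))
  have h7 : 1 / (4 * Real.pi ^ 2 * σ ^ 2) * (4 * Real.pi ^ 2 * σ ^ 2 *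
      (4 * Real.exp 1 + 2 * cutoffBound) * Real.exp (-(Λ / 2)) * freqBound k u Λ) =
      (4 * Real.exp 1 + 2 * cutoffBound) * Real.exp (-(Λ / 2)) * freqBound k u Λ := by
    field_simp
  rw [h7] at h6
  calc _ ≤ Real.exp (-(Λ / 2)) * freqBound k u Λ +
        (4 * Real.exp 1 + 2 * cutoffBound) * Real.exp (-(Λ / 2)) * freqBound k u Λ :=
        add_le_add hint h6
    _ = _ := by ring

end Bias

/-! ### Kernel estimators: weighted mean squared error and `ℓ¹` error. -/

/-- The distribution `P` on `ℕ` has generating polynomial `p`. -/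
def HasGenPoly (K : ℕ) (p : Polynomial ℝ) (P : Measure ℕ) : Prop :=
  IsProbPoly K p ∧ ∀ x, P.real {x} = p.coeff x

theorem HasGenPoly.ae_lt {K : ℕ} {p : Polynomial ℝ} {P : Measure ℕ} [IsFiniteMeasure P]
    (h : HasGenPoly K p P) : ∀ᵐ x ∂P, x < K := by
  rw [ae_iff_of_countable]
  intro x hx
  by_contra! hK
  apply hx
  rw [← measureReal_eq_zero_iff, h.2, h.1.coeff_eq_zero x hK]

theorem HasGenPoly.integral_eq {K : ℕ} {p : Polynomial ℝ} {P : Measure ℕ} [IsFiniteMeasure P]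
    (h : HasGenPoly K p P) (g : ℕ → ℝ) :
    ∫ y, g y ∂P = ∑ y ∈ Finset.range K, p.coeff y * g y := by
  rw [integral_eq_sum_range h.ae_lt]
  simp [h.2]

theorem HasGenPoly.memLp {K : ℕ} {p : Polynomial ℝ} {P : Measure ℕ} [IsFiniteMeasure P]
    (h : HasGenPoly K p P) (g : ℕ → ℝ) (r : ℝ≥0∞) : MemLp g r P := by
  refine MemLp.of_bound (measurable_of_countable g).aestronglyMeasurable
    (∑ y ∈ Finset.range K, ‖g y‖) ?_
  filter_upwards [h.ae_lt] with y hy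
  exact Finset.single_le_sum (f := fun y => ‖g y‖) (fun _ _ => norm_nonneg _)
    (Finset.mem_range.mpr hy)

theorem IsProbabilityMeasure.integral_sub_sq {Ω : Type*} {mΩ : MeasurableSpace Ω} {μ : Measure Ω}
    [IsProbabilityMeasure μ] {X : Ω → ℝ} (hX : MemLp X 2 μ) (c : ℝ) :
    ∫ ω, (X ω - c) ^ 2 ∂μ = Var[X; μ] + (∫ ω, X ω ∂μ - c) ^ 2 := by
  have h1 : MemLp (fun ω => X ω - c) 2 μ := hX.sub (memLp_const c)
  have h2 := variance_eq_sub h1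
  have h3 := variance_sub_const (X := X) (μ := μ) hX.aestronglyMeasurable c
  have h4 : ∫ ω, (X ω - c) ∂μ = ∫ ω, X ω ∂μ - c := by
    rw [integral_sub (hX.integrable one_le_two) (integrable_const c)]
    simp
  rw [h3, h4] at h2
  have h5 : ∫ ω, (X ω - c) ^ 2 ∂μ = μ[(fun ω => X ω - c) ^ 2] := rfl
  rw [h5]
  linarith

/-- Variance plus squared bias; the variance of one term is bounded by its second moment. -/
theorem lintegral_average_sub_sq_le {ι : Type*} [Fintype ι] [Nonempty ι] {K : ℕ}
    {p : Polynomial ℝ} {P : Measure ℕ} [IsProbabilityMeasure P] (h : HasGenPoly K p P)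
    (g : ℕ → ℝ) (c : ℝ) :
    ∫⁻ ω : ι → ℕ, ENNReal.ofReal (((∑ i, g (ω i)) / Fintype.card ι - c) ^ 2)
      ∂(Measure.pi fun _ => P) ≤
    ENNReal.ofReal ((∑ y ∈ Finset.range K, p.coeff y * g y ^ 2) / Fintype.card ι +
      (c - ∑ y ∈ Finset.range K, p.coeff y * g y) ^ 2) := by
  have hN : (Fintype.card ι : ℝ) ≠ 0 := by exact_mod_cast Fintype.card_ne_zero
  have hN0 : (0 : ℝ) < Fintype.card ι := by positivity
  set μ : Measure (ι → ℕ) := Measure.pi fun _ => P with hμ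
  have hg : ∀ i : ι, MemLp (fun ω : ι → ℕ => g (ω i)) 2 μ := fun i =>
    (h.memLp g 2).comp_measurePreserving (measurePreserving_eval (fun _ : ι => P) i)
  have hS : MemLp (fun ω : ι → ℕ => (∑ i, g (ω i)) / Fintype.card ι) 2 μ := by
    have := (memLp_finsetSum (μ := μ) (p := 2) Finset.univ
      (f := fun i (ω : ι → ℕ) => g (ω i)) fun i _ => hg i).const_mul (Fintype.card ι : ℝ)⁻¹
    simpa only [div_eq_inv_mul] using this
  have hmean : ∀ i : ι, ∫ ω, g (ω i) ∂μ = ∑ y ∈ Finset.range K, p.coeff y * g y := fun i => by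
    rw [← h.integral_eq]
    exact integral_comp_eval (μ := fun _ : ι => P) (i := i)
      (measurable_of_countable g).aestronglyMeasurable
  have hES : ∫ ω, (∑ i, g (ω i)) / Fintype.card ι ∂μ =
      ∑ y ∈ Finset.range K, p.coeff y * g y := by
    rw [integral_div, integral_finsetSum _ fun i _ => (hg i).integrable one_le_two]
    simp_rw [hmean]
    simp
  have hvar : Var[fun ω : ι → ℕ => (∑ i, g (ω i)) / Fintype.card ι; μ] ≤
      (∑ y ∈ Finset.range K, p.coeff y * g y ^ 2) / Fintype.card ι := by
    have h1 := variance_sum_pi (μ := fun _ : ι => P) (X := fun _ : ι => g)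
      (fun i => h.memLp g 2)
    have h2 : (∑ i, fun ω : ι → ℕ => g (ω i)) = fun ω => ∑ i, g (ω i) := by
      ext ω; simp
    rw [h2, ← hμ] at h1
    simp_rw [div_eq_inv_mul]
    rw [variance_const_mul, h1]
    have h3 : Var[g; P] ≤ ∑ y ∈ Finset.range K, p.coeff y * g y ^ 2 := by
      rw [← h.integral_eq (fun y => g y ^ 2)]
      exact variance_le_expectation_sq (measurable_of_countable g).aestronglyMeasurable
    simp only [Finset.sum_const, Finset.card_univ, nsmul_eq_mul]
    calc _ = (Fintype.card ι : ℝ)⁻¹ * Var[g; P] := by field_simp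
      _ ≤ _ := by gcongr
  have hint : Integrable (fun ω : ι → ℕ => ((∑ i, g (ω i)) / Fintype.card ι - c) ^ 2) μ :=
    (hS.sub (memLp_const c)).integrable_sq
  rw [← ofReal_integral_eq_lintegral_ofReal hint (Filter.Eventually.of_forall fun ω => sq_nonneg _)]
  apply ENNReal.ofReal_le_ofReal
  rw [IsProbabilityMeasure.integral_sub_sq hS, hES]
  have : (∑ y ∈ Finset.range K, p.coeff y * g y - c) ^ 2 =
    (c - ∑ y ∈ Finset.range K, p.coeff y * g y) ^ 2 := by ring
  rw [this]
  linarith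

/-- The kernel density estimator with kernel `κ` from the sample `ω`. -/
noncomputable def kernelEstimator {ι : Type*} [Fintype ι] (κ : ℤ → ℝ) (ω : ι → ℕ) (x : ℕ) : ℝ :=
  (∑ i, κ ((x : ℤ) - ω i)) / Fintype.card ι

/-- The quadratic weight is submultiplicative up to a factor `2`, so it can be moved from the point
`x` to the sample `y` and the displacement `x - y`. The sample part averages to `1 + V / σ² ≤ 2` and
the displacement part sums to `a`, which together give `4 a`. -/
theorem lintegral_tsum_kernelEstimator_le {ι : Type*} [Fintype ι] [Nonempty ι] {K : ℕ}
    {p : Polynomial ℝ} {P : Measure ℕ} [IsProbabilityMeasure P] (h : HasGenPoly K p P)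
    {κ : ℤ → ℝ} {σ a b : ℝ} (hσ : 0 < σ) (hV : polyVar p ≤ σ ^ 2) (ha0 : 0 ≤ a) (hb0 : 0 ≤ b)
    (ha : ∑' z : ℤ, ENNReal.ofReal ((1 + ((z : ℝ) / σ) ^ 2) * κ z ^ 2) ≤ ENNReal.ofReal a)
    (hb : ∑' x : ℕ, ENNReal.ofReal ((1 + (((x : ℝ) - polyMean p) / σ) ^ 2) *
      (p.coeff x - ∑ y ∈ Finset.range K, p.coeff y * κ ((x : ℤ) - y)) ^ 2) ≤ ENNReal.ofReal b) :
    ∫⁻ ω : ι → ℕ, ∑' x : ℕ, ENNReal.ofReal ((1 + (((x : ℝ) - polyMean p) / σ) ^ 2) *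
      (kernelEstimator κ ω x - p.coeff x) ^ 2) ∂(Measure.pi fun _ => P) ≤
    ENNReal.ofReal (4 * a / Fintype.card ι + b) := by
  have hN0 : (0 : ℝ) < Fintype.card ι := by exact_mod_cast Fintype.card_pos
  set m := polyMean p with hm
  set W : ℝ → ℝ := fun x => 1 + ((x - m) / σ) ^ 2 with hW
  have hW0 : ∀ x, 0 ≤ W x := fun x => by positivity
  rw [lintegral_tsum (fun x => (measurable_of_countable _).aemeasurable)]
  have h1 : ∀ x : ℕ, ∫⁻ ω : ι → ℕ, ENNReal.ofReal (W x * (kernelEstimator κ ω x - p.coeff x) ^ 2)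
      ∂(Measure.pi fun _ => P) ≤
      (∑ y ∈ Finset.range K, ENNReal.ofReal (p.coeff y * (2 * W y) / Fintype.card ι) *
        ENNReal.ofReal ((1 + ((((x : ℤ) - (y : ℤ) : ℤ) : ℝ) / σ) ^ 2) * κ ((x : ℤ) - y) ^ 2)) +
      ENNReal.ofReal (W x * (p.coeff x -
        ∑ y ∈ Finset.range K, p.coeff y * κ ((x : ℤ) - y)) ^ 2) := by
    intro x
    simp_rw [ENNReal.ofReal_mul (hW0 _)]
    rw [lintegral_const_mul _ (measurable_of_countable _)]
    refine (mul_le_mul_right (lintegral_average_sub_sq_le h (fun y => κ ((x : ℤ) - y))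
      (p.coeff x)) _).trans ?_
    rw [ENNReal.ofReal_add (div_nonneg (Finset.sum_nonneg fun y _ => mul_nonneg
      (h.1.coeff_nonneg y) (sq_nonneg _)) hN0.le) (sq_nonneg _), mul_add]
    refine add_le_add ?_ le_rfl
    rw [← ENNReal.ofReal_mul (hW0 _)]
    have hz : ∀ y : ℕ, 0 ≤ p.coeff y * (2 * W y) / Fintype.card ι := fun y =>
      div_nonneg (mul_nonneg (h.1.coeff_nonneg y) (by linarith [hW0 y])) hN0.le
    simp_rw [← ENNReal.ofReal_mul (hz _)]
    rw [← ENNReal.ofReal_sum_of_nonneg fun y _ => mul_nonneg (hz y) (by positivity)]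
    apply ENNReal.ofReal_le_ofReal
    rw [mul_div_assoc', Finset.mul_sum, Finset.sum_div]
    refine Finset.sum_le_sum fun y _ => ?_
    -- `1 + (A + B)² ≤ 2 (1 + A²) (1 + B²)`.
    have hWW : W x ≤ 2 * W y * (1 + (((x : ℝ) - y) / σ) ^ 2) := by
      simp only [hW]
      have e : ((x : ℝ) - m) / σ = ((x : ℝ) - y) / σ + ((y : ℝ) - m) / σ := by ring
      rw [e]
      generalize ((x : ℝ) - y) / σ = A
      generalize ((y : ℝ) - m) / σ = B
      nlinarith [sq_nonneg (A - B), mul_nonneg (sq_nonneg A) (sq_nonneg B)]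
    have := h.1.coeff_nonneg y
    push_cast
    rw [div_mul_eq_mul_div]
    apply div_le_div_of_nonneg_right _ hN0.le
    calc W x * (p.coeff y * κ ((x : ℤ) - y) ^ 2)
        ≤ (2 * W y * (1 + (((x : ℝ) - y) / σ) ^ 2)) * (p.coeff y * κ ((x : ℤ) - y) ^ 2) := by
          gcongr
      _ = _ := by ring
  refine (ENNReal.tsum_le_tsum h1).trans ?_
  rw [ENNReal.tsum_add, ENNReal.ofReal_add (by positivity) hb0]
  refine add_le_add ?_ hb
  rw [Summable.tsum_finsetSum fun y _ => ENNReal.summable]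
  simp_rw [ENNReal.tsum_mul_left]
  have h2 : ∀ y : ℕ, ∑' x : ℕ, ENNReal.ofReal ((1 + ((((x : ℤ) - (y : ℤ) : ℤ) : ℝ) / σ) ^ 2) *
      κ ((x : ℤ) - y) ^ 2) ≤ ENNReal.ofReal a := by
    intro y
    refine le_trans ?_ ha
    exact ENNReal.tsum_comp_le_tsum_of_injective (f := fun x : ℕ => (x : ℤ) - y)
      (fun x x' hx => by simpa using hx)
      (fun z : ℤ => ENNReal.ofReal ((1 + ((z : ℝ) / σ) ^ 2) * κ z ^ 2))
  refine (Finset.sum_le_sum fun y _ => mul_le_mul_right (h2 y) _).trans ?_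
  rw [← Finset.sum_mul, ← ENNReal.ofReal_sum_of_nonneg fun y _ => div_nonneg (mul_nonneg
    (h.1.coeff_nonneg y) (by linarith [hW0 y])) hN0.le, ← ENNReal.ofReal_mul' ha0]
  apply ENNReal.ofReal_le_ofReal
  rw [← Finset.sum_div, div_mul_eq_mul_div]
  apply div_le_div_of_nonneg_right _ hN0.le
  refine mul_le_mul_of_nonneg_right ?_ ha0
  have h3 : ∑ y ∈ Finset.range K, p.coeff y * (2 * W y) = 2 * (1 + polyVar p / σ ^ 2) := by
    rw [h.1.polyVar_eq, Finset.sum_div, mul_add, mul_one, Finset.mul_sum]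
    have : (2 : ℝ) = 2 * ∑ y ∈ Finset.range K, p.coeff y := by rw [h.1.sum_coeff, mul_one]
    nth_rewrite 2 [this]
    rw [Finset.mul_sum, ← Finset.sum_add_distrib]
    refine Finset.sum_congr rfl fun y _ => ?_
    simp only [hW]
    rw [div_pow]
    ring
  rw [h3]
  have : polyVar p / σ ^ 2 ≤ 1 := by rw [div_le_one (by positivity)]; exact hV
  linarith

/-- Mean value theorem for `arctan`. The intermediate point is within `1 / σ ≤ 1` of `y / σ`, which
costs at most a factor `3`. -/
theorem one_div_le_arctan_sub {σ : ℝ} (hσ : 1 ≤ σ) (y : ℝ) :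
    1 / (1 + (y / σ) ^ 2) ≤ 3 * σ * (Real.arctan ((y + 1) / σ) - Real.arctan (y / σ)) := by
  have hσ0 : 0 < σ := by linarith
  have hlt : y / σ < (y + 1) / σ := by gcongr; linarith
  obtain ⟨c, hc, hc'⟩ := exists_deriv_eq_slope Real.arctan hlt
    Real.continuous_arctan.continuousOn Real.differentiable_arctan.differentiableOn
  have e : (y + 1) / σ - y / σ = 1 / σ := by ring
  rw [e, Real.deriv_arctan] at hc'
  have hd : Real.arctan ((y + 1) / σ) - Real.arctan (y / σ) = 1 / (1 + c ^ 2) / σ := by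
    beta_reduce at hc'
    rw [hc']; field_simp
  rw [hd]
  have e2 : 3 * σ * (1 / (1 + c ^ 2) / σ) = 3 / (1 + c ^ 2) := by field_simp
  rw [e2, div_le_div_iff₀ (by positivity) (by positivity)]
  have h1 : c - y / σ ≤ 1 := by
    have : (1 : ℝ) / σ ≤ 1 := by rw [div_le_one hσ0]; exact hσ
    linarith [hc.2]
  have h2 : 0 ≤ c - y / σ := by linarith [hc.1]
  generalize y / σ = a at *
  nlinarith [sq_nonneg (c - 2 * a), sq_nonneg (c - a), sq_nonneg a]

/-- The arctangent bounds telescope to at most `3 π σ`. -/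
theorem tsum_inv_weight_le {σ : ℝ} (hσ : 1 ≤ σ) (m : ℝ) :
    ∑' x : ℕ, ENNReal.ofReal (1 / (1 + (((x : ℝ) - m) / σ) ^ 2)) ≤ ENNReal.ofReal (10 * σ) := by
  refine ENNReal.tsum_le_of_sum_range_le fun n => ?_
  rw [← ENNReal.ofReal_sum_of_nonneg fun x _ => by positivity]
  apply ENNReal.ofReal_le_ofReal
  have h1 : ∀ x : ℕ, 1 / (1 + (((x : ℝ) - m) / σ) ^ 2) ≤
      3 * σ * (Real.arctan (((x + 1 : ℕ) - m) / σ) - Real.arctan (((x : ℝ) - m) / σ)) := by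
    intro x
    have := one_div_le_arctan_sub hσ ((x : ℝ) - m)
    rw [show (x : ℝ) - m + 1 = ((x + 1 : ℕ) - m) by push_cast; ring] at this
    exact this
  refine (Finset.sum_le_sum fun x _ => h1 x).trans ?_
  rw [← Finset.mul_sum, Finset.sum_range_sub (fun x : ℕ => Real.arctan (((x : ℝ) - m) / σ))]
  have h2 := Real.arctan_lt_pi_div_two (((n : ℝ) - m) / σ)
  have h3 := Real.neg_pi_div_two_lt_arctan ((((0 : ℕ) : ℝ) - m) / σ)
  have h4 := Real.pi_lt_d2
  nlinarith

/-- Cauchy–Schwarz against the inverse weight, which has sum at most `10 σ`. It is used in pointwise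
form: with weight `w`, `|d| ≤ (η / 20 σ) / w + (5 σ / η) w d²`, and each of the two sums is at most
`η / 2`. -/
theorem tsum_abs_le_of_weighted {d : ℕ → ℝ} {σ m η : ℝ} (hσ : 1 ≤ σ) (hη : 0 < η)
    (h : ∑' x : ℕ, ENNReal.ofReal ((1 + (((x : ℝ) - m) / σ) ^ 2) * d x ^ 2) ≤
      ENNReal.ofReal (η ^ 2 / (10 * σ))) :
    ∑' x : ℕ, ENNReal.ofReal |d x| ≤ ENNReal.ofReal η := by
  have hσ0 : 0 < σ := by linarith
  have h1 : ∀ x : ℕ, ENNReal.ofReal |d x| ≤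
      ENNReal.ofReal (η / (20 * σ)) * ENNReal.ofReal (1 / (1 + (((x : ℝ) - m) / σ) ^ 2)) +
      ENNReal.ofReal (5 * σ / η) *
        ENNReal.ofReal ((1 + (((x : ℝ) - m) / σ) ^ 2) * d x ^ 2) := by
    intro x
    rw [← ENNReal.ofReal_mul (by positivity), ← ENNReal.ofReal_mul (by positivity),
      ← ENNReal.ofReal_add (by positivity) (by positivity)]
    apply ENNReal.ofReal_le_ofReal
    have hw : 0 < 1 + (((x : ℝ) - m) / σ) ^ 2 := by positivity
    generalize 1 + (((x : ℝ) - m) / σ) ^ 2 = w at hw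
    rw [← sq_abs (d x)]
    generalize |d x| = D
    have h2 : 0 ≤ (η / (20 * σ)) / w * (1 - 10 * σ / η * w * D) ^ 2 := by positivity
    have h3 : (η / (20 * σ)) / w * (1 - 10 * σ / η * w * D) ^ 2 =
        η / (20 * σ) * (1 / w) + 5 * σ / η * (w * D ^ 2) - D := by
      field_simp
      ring
    linarith
  refine (ENNReal.tsum_le_tsum h1).trans ?_
  rw [ENNReal.tsum_add, ENNReal.tsum_mul_left, ENNReal.tsum_mul_left]
  refine (add_le_add (mul_le_mul_right (tsum_inv_weight_le hσ m) _)
    (mul_le_mul_right h _)).trans ?_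
  rw [← ENNReal.ofReal_mul (by positivity), ← ENNReal.ofReal_mul (by positivity),
    ← ENNReal.ofReal_add (by positivity) (by positivity)]
  apply ENNReal.ofReal_le_ofReal
  apply le_of_eq
  field_simp
  norm_num

/-- With large probability, the kernel estimator is close to the distribution in `ℓ¹`. -/
theorem measure_kernelEstimator_le {ι : Type*} [Fintype ι] [Nonempty ι] {K : ℕ}
    {p : Polynomial ℝ} {P : Measure ℕ} [IsProbabilityMeasure P] (h : HasGenPoly K p P)
    {κ : ℤ → ℝ} {σ a b η : ℝ} (hσ : 1 ≤ σ) (hη : 0 < η) (hV : polyVar p ≤ σ ^ 2) (ha0 : 0 ≤ a)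
    (hb0 : 0 ≤ b)
    (ha : ∑' z : ℤ, ENNReal.ofReal ((1 + ((z : ℝ) / σ) ^ 2) * κ z ^ 2) ≤ ENNReal.ofReal a)
    (hb : ∑' x : ℕ, ENNReal.ofReal ((1 + (((x : ℝ) - polyMean p) / σ) ^ 2) *
      (p.coeff x - ∑ y ∈ Finset.range K, p.coeff y * κ ((x : ℤ) - y)) ^ 2) ≤ ENNReal.ofReal b) :
    (Measure.pi fun _ : ι => P) {ω | ENNReal.ofReal η <
      ∑' x : ℕ, ENNReal.ofReal |kernelEstimator κ ω x - p.coeff x|} ≤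
    ENNReal.ofReal (10 * σ * (4 * a / Fintype.card ι + b) / η ^ 2) := by
  have hσ0 : 0 < σ := by linarith
  have h1 := lintegral_tsum_kernelEstimator_le (ι := ι) h hσ0 hV ha0 hb0 ha hb
  have hpos : 0 < η ^ 2 / (10 * σ) := by positivity
  have h2 := meas_ge_le_lintegral_div (μ := Measure.pi fun _ : ι => P)
    (f := fun ω : ι → ℕ => ∑' x : ℕ, ENNReal.ofReal ((1 + (((x : ℝ) - polyMean p) / σ) ^ 2) *
      (kernelEstimator κ ω x - p.coeff x) ^ 2)) (measurable_of_countable _).aemeasurable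
    (ε := ENNReal.ofReal (η ^ 2 / (10 * σ))) (by simpa using hpos) ENNReal.ofReal_ne_top
  refine (measure_mono ?_).trans (h2.trans ((ENNReal.div_le_div_right h1 _).trans ?_))
  · intro ω hω
    simp only [Set.mem_ofPred_eq] at hω ⊢
    by_contra! hlt
    exact absurd (tsum_abs_le_of_weighted hσ hη hlt.le) (not_le.mpr hω)
  · rw [← ENNReal.ofReal_div_of_pos hpos]
    apply ENNReal.ofReal_le_ofReal
    apply le_of_eq
    field_simp

/-! ### The candidate kernels and the error of the right one. -/

/-- The kernels among which the learning algorithm selects: the point mass, and the smoothing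
kernels that belong to multisets of `k` elements of `{0, …, k - 1}`. -/
noncomputable def candidateKernel (k : ℕ) (s Λ : ℝ) : Option (Sym (Fin k) k) → ℤ → ℝ
  | none, z => if z = 0 then 1 else 0
  | some M, z => (circleCoeff (fun ξ => (multiplier (s ^ 2 / k ^ 3) (symFun M) Λ ξ : ℂ)) z).re

/-- The point mass gives the empirical distribution, which is unbiased. It serves the case `σ ≤ k`,
where its error is already of the right order. -/
theorem measure_pointKernelEstimator_le {ι : Type*} [Fintype ι] [Nonempty ι] {K k : ℕ}
    {p : Polynomial ℝ} {P : Measure ℕ} [IsProbabilityMeasure P] (h : HasGenPoly K p P)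
    {σ η : ℝ} (hσ : 1 ≤ σ) (hη : 0 < η) (hV : polyVar p ≤ σ ^ 2) (s Λ : ℝ) :
    (Measure.pi fun _ : ι => P) {ω | ENNReal.ofReal η <
      ∑' x : ℕ, ENNReal.ofReal |kernelEstimator (candidateKernel k s Λ none) ω x - p.coeff x|} ≤
    ENNReal.ofReal (40 * σ / (Fintype.card ι * η ^ 2)) := by
  have h1 := measure_kernelEstimator_le (ι := ι) h (κ := candidateKernel k s Λ none) (a := 1)
    (b := 0) hσ hη hV zero_le_one le_rfl ?_ ?_
  · refine h1.trans (ENNReal.ofReal_le_ofReal (le_of_eq ?_))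
    rw [add_zero]
    field_simp
    norm_num
  · rw [tsum_eq_single 0]
    · simp [candidateKernel]
    · intro z hz
      simp [candidateKernel, hz]
  · rw [ENNReal.tsum_eq_zero.mpr]
    · exact zero_le
    · intro x
      have : ∑ y ∈ Finset.range K, p.coeff y * candidateKernel k s Λ none ((x : ℤ) - y) =
          p.coeff x := by
        simp only [candidateKernel, sub_eq_zero, Nat.cast_inj, mul_ite, mul_one, mul_zero]
        rw [Finset.sum_ite_eq]
        split_ifs with hx
        · rfl
        · rw [h.1.coeff_eq_zero x (by simpa using hx)]
      rw [this]
      simp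

/-- Since `∑ w j * j² = 2 σ²` and `j ≤ k`, the nonzero differences have total weight at least `2 σ²
/ k²`, hence at least `2 k` units of `s² / k³`. This is what `exists_sym_le` requires. -/
theorem exists_sym_trigEnergy_le {ι : Type*} {I : Finset ι} {k : ℕ} {q : ι → Polynomial ℝ}
    (hq : ∀ i ∈ I, IsProbPoly k (q i)) (hk : 1 ≤ k) {σ s : ℝ} (hs0 : 0 < s) (hs : s ≤ σ)
    (hV : polyVar (∏ i ∈ I, q i) = σ ^ 2) :
    ∃ M : Sym (Fin k) k, (∀ i, 1 ≤ symFun M i) ∧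
      ∀ ξ, trigEnergy (s ^ 2 / k ^ 3) (symFun M) ξ ≤ ∑ i ∈ I, charEnergy (q i) ξ := by
  have hk0 : (0 : ℝ) < k := by exact_mod_cast hk
  have hu : 0 < s ^ 2 / (k : ℝ) ^ 3 := by positivity
  obtain ⟨M, hM, hM'⟩ := exists_sym_le (k := k) (diffWeight I k q) (diffWeight_nonneg I hq) hu (by
    have h1 := two_mul_polyVar_prod I hq
    have h2 : ∑ j ∈ Finset.range k, diffWeight I k q j * (j : ℝ) ^ 2 =
        ∑ j ∈ (Finset.range k).erase 0, diffWeight I k q j * (j : ℝ) ^ 2 := by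
      rw [← Finset.add_sum_erase (Finset.range k) _ (Finset.mem_range.mpr hk)]
      simp
    have h3 : ∑ j ∈ (Finset.range k).erase 0, diffWeight I k q j * (j : ℝ) ^ 2 ≤
        (∑ j ∈ (Finset.range k).erase 0, diffWeight I k q j) * (k : ℝ) ^ 2 := by
      rw [Finset.sum_mul]
      refine Finset.sum_le_sum fun j hj => mul_le_mul_of_nonneg_left ?_ (diffWeight_nonneg I hq j)
      have : (j : ℝ) ≤ k := by
        exact_mod_cast (Finset.mem_range.mp (Finset.mem_of_mem_erase hj)).le
      gcongr
    rw [← h2, ← h1, hV] at h3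
    have h4 : s ^ 2 ≤ σ ^ 2 := by gcongr
    rw [← div_le_iff₀ (by positivity)] at h3
    refine le_trans ?_ h3
    rw [le_div_iff₀ (by positivity)]
    calc 2 * k * (s ^ 2 / k ^ 3) * k ^ 2 = 2 * s ^ 2 := by field_simp
      _ ≤ _ := by linarith)
  refine ⟨M, hM, fun ξ => ?_⟩
  have h1 := hM' (fun j => 1 - Real.cos (2 * Real.pi * j * ξ))
    (fun j => by linarith [Real.cos_le_one (2 * Real.pi * j * ξ)])
  rw [← sum_charEnergy_eq I hq] at h1
  rw [trigEnergy]
  linarith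

theorem symFun_le {k : ℕ} (M : Sym (Fin k) k) (i : Fin k) : symFun M i ≤ k := by
  obtain ⟨j, _, hj⟩ := symFun_mem M i
  rw [hj]
  exact j.2.le

theorem freqBound_eq {k : ℕ} (hk : 1 ≤ k) {s Λ : ℝ} (hs : 0 < s) :
    freqBound k (s ^ 2 / k ^ 3) Λ = k * Real.sqrt (Real.pi * Λ) / (2 * s) := by
  have hk0 : (0 : ℝ) < k := by exact_mod_cast hk
  rw [freqBound, show Real.pi * Λ / (4 * (s ^ 2 / (k : ℝ) ^ 3 * k)) =
    (k / (2 * s)) ^ 2 * (Real.pi * Λ) by field_simp; norm_num, Real.sqrt_mul (sq_nonneg _),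
    Real.sqrt_sq (by positivity)]
  ring

/-- An absolute constant. -/
noncomputable def kernelConst : ℝ := 1 + 4 * Real.exp 2 + 2 * cutoffBound * Real.exp 2

theorem kernelConst_pos : 0 < kernelConst := by
  have := cutoffBound_nonneg
  have := Real.exp_pos 2
  unfold kernelConst; positivity

/-- Variance and bias both carry the factor `freqBound`, of order `k √Λ / s`, and the passage to
`ℓ¹` brings a factor `σ`. As `s` and `σ` are comparable the scale cancels, and only `k √Λ` remains.
-/
theorem exists_measure_smoothKernelEstimator_le {ι ι' : Type*} [Fintype ι] [Nonempty ι]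
    {I : Finset ι'} {K k : ℕ} {q : ι' → Polynomial ℝ} (hq : ∀ i ∈ I, IsProbPoly k (q i))
    {P : Measure ℕ} [IsProbabilityMeasure P] (h : HasGenPoly K (∏ i ∈ I, q i) P) (hk : 1 ≤ k)
    {σ s η Λ : ℝ} (hσ : 1 ≤ σ) (hη : 0 < η) (hs0 : 0 < s) (hs : s ≤ σ) (hσs : σ ≤ 600 * s)
    (hV : polyVar (∏ i ∈ I, q i) = σ ^ 2) (hΛ : 1 ≤ Λ) :
    ∃ M : Sym (Fin k) k, (Measure.pi fun _ : ι => P) {ω | ENNReal.ofReal η <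
      ∑' x : ℕ, ENNReal.ofReal
        |kernelEstimator (candidateKernel k s Λ (some M)) ω x - (∏ i ∈ I, q i).coeff x|} ≤
    ENNReal.ofReal (24000 * kernelConst * (k * Real.sqrt Λ) *
      (1 / Fintype.card ι + Real.exp (-(Λ / 2))) / η ^ 2) := by
  obtain ⟨M, hM, hdom⟩ := exists_sym_trigEnergy_le hq hk hs0 hs hV
  refine ⟨M, ?_⟩
  have hk0 : (0 : ℝ) < k := by exact_mod_cast hk
  have hB := cutoffBound_nonneg
  have hσ0 : 0 < σ := by linarith
  have hu : 0 < s ^ 2 / (k : ℝ) ^ 3 := by positivity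
  have huk : s ^ 2 / (k : ℝ) ^ 3 * k ^ 3 ≤ σ ^ 2 := by
    rw [div_mul_cancel₀ _ (by positivity)]
    gcongr
  set u := s ^ 2 / (k : ℝ) ^ 3 with hu'
  set G := freqBound k u Λ with hG
  have hG0 : 0 ≤ G := freqBound_nonneg _ _ _
  have hcm : Continuous fun ξ => (multiplier u (symFun M) Λ ξ : ℂ) :=
    Complex.continuous_ofReal.comp (continuous_multiplier _)
  have hA := tsum_multiplierCoeff_le (symFun M) hΛ hu hk hM (symFun_le M) hσ0 huk
  have hBi := tsum_bias_le hq hdom hΛ hu hk (symFun_le M) hM hσ0 hV huk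
  have hre : ∀ z : ℂ, z.re ^ 2 ≤ ‖z‖ ^ 2 := fun z => by
    rw [← sq_abs]; exact pow_le_pow_left₀ (abs_nonneg _) (Complex.abs_re_le_norm z) 2
  have h1 := measure_kernelEstimator_le (ι := ι) h (κ := candidateKernel k s Λ (some M))
    (a := kernelConst * G) (b := kernelConst * Real.exp (-(Λ / 2)) * G) hσ hη hV.le
    (mul_nonneg kernelConst_pos.le hG0)
    (mul_nonneg (mul_nonneg kernelConst_pos.le (Real.exp_pos _).le) hG0) ?_ ?_
  · refine h1.trans (ENNReal.ofReal_le_ofReal ?_)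
    -- The cancellation of the scale; `600` is the allowed ratio of `σ` to its estimate.
    have hGσ : G * σ ≤ 600 * (k * Real.sqrt Λ) := by
      rw [hG, freqBound_eq hk hs0, Real.sqrt_mul Real.pi_pos.le]
      have hpi : Real.sqrt Real.pi ≤ 2 := by
        rw [Real.sqrt_le_left (by norm_num)]
        linarith [Real.pi_lt_d2]
      rw [div_mul_eq_mul_div, div_le_iff₀ (by positivity)]
      calc (k : ℝ) * (Real.sqrt Real.pi * Real.sqrt Λ) * σ
          ≤ k * (2 * Real.sqrt Λ) * (600 * s) := by gcongr
        _ = _ := by ring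
    apply div_le_div_of_nonneg_right _ (sq_nonneg η)
    have hE := Real.exp_pos (-(Λ / 2))
    have hkc := kernelConst_pos
    calc 10 * σ * (4 * (kernelConst * G) / Fintype.card ι + kernelConst * Real.exp (-(Λ / 2)) * G)
        = 10 * kernelConst * (G * σ) * (4 * (1 / Fintype.card ι) + Real.exp (-(Λ / 2))) := by ring
      _ ≤ 10 * kernelConst * (600 * (k * Real.sqrt Λ)) *
          (4 * (1 / Fintype.card ι) + 4 * Real.exp (-(Λ / 2))) := by gcongr; linarith
      _ = _ := by ring
  · refine (ENNReal.tsum_le_tsum fun z => ENNReal.ofReal_le_ofReal ?_).trans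
      (hA.trans (ENNReal.ofReal_le_ofReal ?_))
    · exact mul_le_mul_of_nonneg_left (hre _) (by positivity)
    · refine mul_le_mul_of_nonneg_right ?_ hG0
      unfold kernelConst
      nlinarith [Real.exp_pos 2]
  · refine le_trans ?_ (hBi.trans (ENNReal.ofReal_le_ofReal ?_))
    · refine le_trans ?_ (ENNReal.tsum_comp_le_tsum_of_injective (f := fun x : ℕ => (x : ℤ))
        Nat.cast_injective _)
      refine ENNReal.tsum_le_tsum fun x => ENNReal.ofReal_le_ofReal ?_
      rw [circleCoeff_bias h.1 hcm, Int.cast_natCast]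
      refine mul_le_mul_of_nonneg_left (le_trans (le_of_eq ?_) (hre _)) (by positivity)
      congr 1
      rw [Complex.sub_re, Complex.re_sum, Complex.ofReal_re]
      congr 1
      refine Finset.sum_congr rfl fun y _ => ?_
      rw [Complex.re_ofReal_mul]
      rfl
    · refine mul_le_mul_of_nonneg_right (mul_le_mul_of_nonneg_right ?_ (Real.exp_pos _).le) hG0
      unfold kernelConst
      have h2 : Real.exp 1 ≤ Real.exp 2 := Real.exp_le_exp.mpr (by norm_num)
      have h3 : 1 ≤ Real.exp 2 := Real.one_le_exp (by norm_num)
      nlinarith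

/-! ### Estimating the standard deviation from nine samples. -/

section Scale

open Classical in
theorem HasGenPoly.measureReal_eq {K : ℕ} {p : Polynomial ℝ} {P : Measure ℕ} [IsFiniteMeasure P]
    (h : HasGenPoly K p P) (S : Set ℕ) :
    P.real S = ∑ y ∈ Finset.range K, p.coeff y * (if y ∈ S then 1 else 0) := by
  rw [← h.integral_eq (fun y => if y ∈ S then (1 : ℝ) else 0),
    ← integral_indicator_one S.to_countable.measurableSet]
  rfl

theorem IsProbPoly.sum_cos_le {K : ℕ} {p : Polynomial ℝ} (h : IsProbPoly K p) (ξ : ℝ) (y : ℕ) :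
    ∑ x ∈ Finset.range K, p.coeff x * Real.cos (2 * Real.pi * ((x : ℝ) - y) * ξ) ≤
      ‖polyChar p ξ‖ := by
  have h1 : ∑ x ∈ Finset.range K, p.coeff x * Real.cos (2 * Real.pi * ((x : ℝ) - y) * ξ) =
      (polyChar p ξ * (starRingEnd ℂ) (unitExp ξ ^ y)).re := by
    rw [h.polyChar_eq, Finset.sum_mul, Complex.re_sum]
    refine Finset.sum_congr rfl fun x _ => ?_
    rw [mul_assoc (p.coeff x : ℂ), Complex.re_ofReal_mul, Complex.mul_re, Complex.conj_re, Complex.conj_im,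
      unitExp_pow_re, unitExp_pow_re, unitExp_pow_im, unitExp_pow_im,
      show 2 * Real.pi * ((x : ℝ) - y) * ξ = 2 * Real.pi * x * ξ - 2 * Real.pi * y * ξ by ring,
      Real.cos_sub]
    ring
  rw [h1]
  refine (Complex.re_le_norm _).trans (le_of_eq ?_)
  rw [norm_mul, Complex.norm_conj, norm_pow, norm_unitExp, one_pow, mul_one]

/-- A `k`-SIIRV whose standard deviation is at least `k` is not concentrated. -/
theorem measureReal_abs_sub_lt_le {ι' : Type*} {I : Finset ι'} {K k : ℕ} {q : ι' → Polynomial ℝ}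
    (hq : ∀ i ∈ I, IsProbPoly k (q i)) {P : Measure ℕ} [IsProbabilityMeasure P]
    (h : HasGenPoly K (∏ i ∈ I, q i) P) {σ : ℝ} (hσ : 0 < σ) (hk : k ≤ σ)
    (hV : polyVar (∏ i ∈ I, q i) = σ ^ 2) (y : ℕ) :
    P.real {x : ℕ | |(x : ℝ) - y| < σ / 10} ≤ 3 / 5 := by
  classical
  set p := ∏ i ∈ I, q i with hp
  -- Frequency `1 / (2 σ)` is admissible because `k ≤ σ`, and the energy there is at least `2`.
  have hξ : (k : ℝ) * |1 / (2 * σ)| ≤ 1 / 2 := by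
    rw [abs_of_pos (by positivity), mul_one_div, div_le_iff₀ (by positivity)]
    linarith
  have h1 := polyVar_le_sum_charEnergy I hq hξ
  rw [hV] at h1
  have h2 : 8 * σ ^ 2 * (1 / (2 * σ)) ^ 2 = 2 := by field_simp; norm_num
  rw [h2] at h1
  have h3 := (h.1.sum_cos_le (1 / (2 * σ)) y).trans ((norm_polyChar_prod_le I _).trans
    (Real.exp_le_exp.mpr (neg_le_neg h1)))
  have h4 : Real.exp (-2) ≤ 0.14 := by
    have e1 := Real.exp_one_gt_d9
    rw [Real.exp_neg, show (2 : ℝ) = 1 + 1 by norm_num, Real.exp_add]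
    apply inv_le_of_inv_le₀ (by norm_num)
    nlinarith
  rw [h.measureReal_eq]
  -- At this frequency the cosine is at least `0.95` in the window and at least `-1` elsewhere.
  -- Hence `1.95 P - 1 ≤ exp (-2)`, where `P` is the probability of the window.
  have h5 : ∀ x ∈ Finset.range K, p.coeff x * (1.95 * (if x ∈ {x : ℕ | |(x : ℝ) - y| < σ / 10}
      then (1 : ℝ) else 0) - 1) ≤
      p.coeff x * Real.cos (2 * Real.pi * ((x : ℝ) - y) * (1 / (2 * σ))) := by
    intro x _
    refine mul_le_mul_of_nonneg_left ?_ (h.1.coeff_nonneg x)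
    split_ifs with hx
    · have hx' : |(x : ℝ) - y| < σ / 10 := hx
      have h6 := Real.one_sub_sq_div_two_le_cos
        (x := 2 * Real.pi * ((x : ℝ) - y) * (1 / (2 * σ)))
      have h7 : (2 * Real.pi * ((x : ℝ) - y) * (1 / (2 * σ))) ^ 2 ≤ 0.1 := by
        have h8 : (((x : ℝ) - y) / σ) ^ 2 ≤ (1 / 10) ^ 2 := by
          rw [sq_le_sq, abs_div, abs_of_pos hσ, abs_of_pos (by norm_num : (0 : ℝ) < 1 / 10),
            div_le_iff₀ hσ]
          linarith
        have h9 : (2 * Real.pi * ((x : ℝ) - y) * (1 / (2 * σ))) ^ 2 =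
            Real.pi ^ 2 * (((x : ℝ) - y) / σ) ^ 2 := by field_simp
        rw [h9]
        have := Real.pi_lt_d2
        have := Real.pi_pos
        nlinarith [sq_nonneg (((x : ℝ) - y) / σ)]
      linarith
    · linarith [Real.neg_one_le_cos (2 * Real.pi * ((x : ℝ) - y) * (1 / (2 * σ)))]
  have h6 := Finset.sum_le_sum h5
  have h7 : ∑ x ∈ Finset.range K, p.coeff x * (1.95 * (if x ∈ {x : ℕ | |(x : ℝ) - y| < σ / 10}
      then (1 : ℝ) else 0) - 1) = 1.95 * ∑ x ∈ Finset.range K, p.coeff x *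
      (if x ∈ {x : ℕ | |(x : ℝ) - y| < σ / 10} then (1 : ℝ) else 0) - 1 := by
    rw [eq_sub_iff_add_eq]
    nth_rewrite 3 [← h.1.sum_coeff]
    rw [Finset.mul_sum, ← Finset.sum_add_distrib]
    exact Finset.sum_congr rfl fun x _ => by ring
  rw [h7] at h6
  linarith

theorem measure_lt_abs_sub_mean_le {K : ℕ} {p : Polynomial ℝ} {P : Measure ℕ}
    [IsProbabilityMeasure P] (h : HasGenPoly K p P) {σ : ℝ} (hσ : 0 < σ)
    (hV : polyVar p ≤ σ ^ 2) {c : ℝ} (hc : 0 < c) :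
    P.real {x : ℕ | c * σ < |(x : ℝ) - polyMean p|} ≤ 1 / c ^ 2 := by
  classical
  rw [h.measureReal_eq]
  have h1 : ∑ x ∈ Finset.range K, p.coeff x *
      (if x ∈ {x : ℕ | c * σ < |(x : ℝ) - polyMean p|} then (1 : ℝ) else 0) ≤
      ∑ x ∈ Finset.range K, p.coeff x * ((x : ℝ) - polyMean p) ^ 2 / (c * σ) ^ 2 := by
    refine Finset.sum_le_sum fun x _ => ?_
    rw [mul_div_assoc]
    refine mul_le_mul_of_nonneg_left ?_ (h.1.coeff_nonneg x)
    split_ifs with hx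
    · have hx' : c * σ < |(x : ℝ) - polyMean p| := hx
      rw [le_div_iff₀ (by positivity), one_mul, ← sq_abs ((x : ℝ) - _)]
      gcongr
    · positivity
  refine h1.trans ?_
  rw [← Finset.sum_div, ← h.1.polyVar_eq, div_le_div_iff₀ (by positivity) (by positivity)]
  rw [one_mul, mul_pow]
  nlinarith [sq_nonneg c]

/-- The largest distance of the points `x t` from `y`. -/
noncomputable def spread (z : ℕ × (Fin 8 → ℕ)) : ℕ :=
  Finset.univ.sup fun t => ((z.2 t : ℤ) - z.1).natAbs

/-- If the spread is too small, eight independent samples all lie in a window around the first one,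
which has probability at most `(3 / 5) ^ 8`. If it is too large, one of nine samples is more than
`30 σ` from the mean, which has probability at most `9 / 900` by Chebyshev. -/
theorem measure_spread_bad_le {ι' : Type*} {I : Finset ι'} {K k : ℕ} {q : ι' → Polynomial ℝ}
    (hq : ∀ i ∈ I, IsProbPoly k (q i)) {P : Measure ℕ} [IsProbabilityMeasure P]
    (h : HasGenPoly K (∏ i ∈ I, q i) P) {σ : ℝ} (hσ : 0 < σ) (hk : k ≤ σ)
    (hV : polyVar (∏ i ∈ I, q i) = σ ^ 2) :
    (P.prod (Measure.pi fun _ : Fin 8 => P)) {z | ¬ (σ / 10 ≤ spread z ∧ spread z ≤ 60 * σ)} ≤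
      ENNReal.ofReal (1 / 30) := by
  set m := polyMean (∏ i ∈ I, q i) with hm
  have habs : ∀ a b : ℕ, ((((a : ℤ) - b).natAbs : ℕ) : ℝ) = |(a : ℝ) - b| := fun a b => by
    rw [Nat.cast_natAbs]; push_cast; rfl
  let A : Set (ℕ × (Fin 8 → ℕ)) := {z | ∀ t, |(z.2 t : ℝ) - z.1| < σ / 10}
  let B₀ : Set ℕ := {x | 30 * σ < |(x : ℝ) - m|}
  have hsub : {z : ℕ × (Fin 8 → ℕ) | ¬ (σ / 10 ≤ spread z ∧ spread z ≤ 60 * σ)} ⊆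
      A ∪ ((Prod.fst ⁻¹' B₀) ∪ ⋃ t : Fin 8, (fun z : ℕ × (Fin 8 → ℕ) => z.2 t) ⁻¹' B₀) := by
    intro z hz
    by_contra hcon
    simp only [Set.mem_union, Set.mem_iUnion, not_or, not_exists, Set.mem_preimage] at hcon
    obtain ⟨h1, h2, h3⟩ := hcon
    have h2' : |(z.1 : ℝ) - m| ≤ 30 * σ := not_lt.mp h2
    have h3' : ∀ t, |(z.2 t : ℝ) - m| ≤ 30 * σ := fun t => not_lt.mp (h3 t)
    apply hz
    constructor
    · have h1' : ∃ t, σ / 10 ≤ |(z.2 t : ℝ) - z.1| := by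
        by_contra! hall
        exact h1 hall
      obtain ⟨t, ht⟩ := h1'
      rw [← habs] at ht
      refine ht.trans ?_
      exact Nat.cast_le.mpr
        (Finset.le_sup (f := fun t => ((z.2 t : ℤ) - z.1).natAbs) (Finset.mem_univ t))
    · obtain ⟨t, _, ht⟩ := Finset.exists_mem_eq_sup Finset.univ Finset.univ_nonempty
        (fun t => ((z.2 t : ℤ) - z.1).natAbs)
      rw [spread, ht, habs]
      have h4 := h3' t
      rw [abs_le] at h4 h2' ⊢
      constructor <;> linarith
  refine (measure_mono hsub).trans ((measure_union_le _ _).trans ?_)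
  have hA : (P.prod (Measure.pi fun _ : Fin 8 => P)) A ≤ ENNReal.ofReal ((3 / 5) ^ 8) := by
    rw [Measure.prod_apply A.to_countable.measurableSet]
    have h1 : ∀ y : ℕ, (Measure.pi fun _ : Fin 8 => P) (Prod.mk y ⁻¹' A) ≤
        ENNReal.ofReal ((3 / 5) ^ 8) := by
      intro y
      have h2 : Prod.mk y ⁻¹' A = Set.univ.pi fun _ : Fin 8 =>
          {x : ℕ | |(x : ℝ) - y| < σ / 10} := by
        ext x
        simp [A]
      rw [h2, Measure.pi_pi]
      have h3 := measureReal_abs_sub_lt_le hq h hσ hk hV y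
      rw [Finset.prod_const, Finset.card_univ, Fintype.card_fin, ENNReal.ofReal_pow (by norm_num)]
      gcongr
      rw [← ofReal_measureReal]
      exact ENNReal.ofReal_le_ofReal h3
    calc _ ≤ ∫⁻ _y, ENNReal.ofReal ((3 / 5) ^ 8) ∂P := lintegral_mono h1
      _ = _ := by simp
  have hB₀ : P B₀ ≤ ENNReal.ofReal (1 / 900) := by
    rw [← ofReal_measureReal]
    apply ENNReal.ofReal_le_ofReal
    have := measure_lt_abs_sub_mean_le h hσ hV.le (c := 30) (by norm_num)
    norm_num at this ⊢
    exact this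
  have hB1 : (P.prod (Measure.pi fun _ : Fin 8 => P)) (Prod.fst ⁻¹' B₀) ≤
      ENNReal.ofReal (1 / 900) := by
    rw [(measurePreserving_fst (μ := P) (ν := Measure.pi fun _ : Fin 8 => P)).measure_preimage
      B₀.to_countable.measurableSet.nullMeasurableSet]
    exact hB₀
  have hB2 : (P.prod (Measure.pi fun _ : Fin 8 => P))
      (⋃ t : Fin 8, (fun z : ℕ × (Fin 8 → ℕ) => z.2 t) ⁻¹' B₀) ≤ ENNReal.ofReal (8 / 900) := by
    refine (measure_iUnion_fintype_le _ _).trans ?_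
    have h1 : ∀ t : Fin 8, (P.prod (Measure.pi fun _ : Fin 8 => P))
        ((fun z : ℕ × (Fin 8 → ℕ) => z.2 t) ⁻¹' B₀) ≤ ENNReal.ofReal (1 / 900) := by
      intro t
      have h2 := (measurePreserving_eval (fun _ : Fin 8 => P) t).comp
        (measurePreserving_snd (μ := P) (ν := Measure.pi fun _ : Fin 8 => P))
      have h3 := h2.measure_preimage B₀.to_countable.measurableSet.nullMeasurableSet
      exact le_of_eq_of_le h3 hB₀
    refine (Finset.sum_le_sum fun t _ => h1 t).trans (le_of_eq ?_)
    rw [Finset.sum_const, Finset.card_univ, Fintype.card_fin, nsmul_eq_mul,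
      show ((8 : ℕ) : ℝ≥0∞) = ENNReal.ofReal 8 by simp, ← ENNReal.ofReal_mul (by norm_num)]
    norm_num
  refine (add_le_add hA ((measure_union_le _ _).trans (add_le_add hB1 hB2))).trans ?_
  rw [← ENNReal.ofReal_add (by norm_num) (by norm_num), ← ENNReal.ofReal_add (by norm_num)
    (by norm_num)]
  apply ENNReal.ofReal_le_ofReal
  norm_num

end Scale

/-! ### The `ℓ¹` distance and selection by Yatracos sets. -/

section L1

theorem hasSum_measureReal_singleton (Q : Measure ℕ) [IsFiniteMeasure Q] (A : Set ℕ) :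
    HasSum (fun x => A.indicator (fun x => Q.real {x}) x) (Q.real A) := by
  have h1 : ∑' x, A.indicator (fun x => Q {x}) x = Q A := by
    have := Measure.tsum_indicator_apply_singleton Q A A.to_countable.measurableSet
    exact this
  have h2 : ∀ x, A.indicator (fun x => Q.real {x}) x =
      (A.indicator (fun x => Q {x}) x).toReal := fun x => by
    by_cases hx : x ∈ A <;> simp [hx, measureReal_def]
  simp_rw [h2]
  have h3 : ∑' x, A.indicator (fun x => Q {x}) x ≠ ⊤ := by
    rw [h1]; exact measure_ne_top _ _
  rw [measureReal_def, ← h1, ENNReal.tsum_toReal_eq fun x => ENNReal.ne_top_of_tsum_ne_top h3 x]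
  exact ENNReal.hasSum_toReal h3

/-- The `ℓ¹` distance of two functions on `ℕ`. -/
noncomputable def ellOne (f g : ℕ → ℝ) : ℝ≥0∞ := ∑' x, ENNReal.ofReal |f x - g x|

theorem ellOne_comm (f g : ℕ → ℝ) : ellOne f g = ellOne g f := by
  simp only [ellOne, abs_sub_comm]

theorem ellOne_triangle (f g h : ℕ → ℝ) : ellOne f h ≤ ellOne f g + ellOne g h := by
  unfold ellOne
  rw [← ENNReal.tsum_add]
  refine ENNReal.tsum_le_tsum fun x => ?_
  rw [← ENNReal.ofReal_add (abs_nonneg _) (abs_nonneg _)]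
  exact ENNReal.ofReal_le_ofReal (abs_sub_le _ _ _)

/-- The probability mass function of a measure on `ℕ`. -/
noncomputable def massFun (Q : ProbabilityMeasure ℕ) (x : ℕ) : ℝ := (Q : Measure ℕ).real {x}

theorem summable_abs_of_ellOne_le {f g : ℕ → ℝ} {c : ℝ} (h : ellOne f g ≤ ENNReal.ofReal c) :
    Summable fun x => |f x - g x| := by
  have h1 : ∑' x, ENNReal.ofReal |f x - g x| ≠ ⊤ := (h.trans_lt ENNReal.ofReal_lt_top).ne
  have h2 := ENNReal.summable_toReal h1
  simpa only [ENNReal.toReal_ofReal (abs_nonneg _)] using h2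

theorem tsum_abs_le_of_ellOne_le {f g : ℕ → ℝ} {c : ℝ} (hc : 0 ≤ c)
    (h : ellOne f g ≤ ENNReal.ofReal c) : ∑' x, |f x - g x| ≤ c := by
  have h1 := summable_abs_of_ellOne_le h
  rw [ellOne, ← ENNReal.ofReal_tsum_of_nonneg (fun x => abs_nonneg _) h1] at h
  exact (ENNReal.ofReal_le_ofReal_iff hc).mp h

theorem tvDist_le_of_ellOne_le {P Q : ProbabilityMeasure ℕ} {c : ℝ} (hc : 0 ≤ c)
    (h : ellOne (massFun P) (massFun Q) ≤ ENNReal.ofReal (2 * c)) : tvDist P Q ≤ c := by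
  have := tsum_abs_le_of_ellOne_le (by linarith) h
  unfold tvDist
  simp only [massFun] at this
  linarith

theorem abs_measureReal_sub_le {P Q : ProbabilityMeasure ℕ} {c : ℝ} (hc : 0 ≤ c)
    (h : ellOne (massFun P) (massFun Q) ≤ ENNReal.ofReal c) (A : Set ℕ) :
    |(P : Measure ℕ).real A - (Q : Measure ℕ).real A| ≤ c := by
  have h1 := (hasSum_measureReal_singleton (P : Measure ℕ) A).sub
    (hasSum_measureReal_singleton (Q : Measure ℕ) A)
  have h2 := summable_abs_of_ellOne_le h
  have h3 : ∀ x, ‖A.indicator (fun x => (P : Measure ℕ).real {x}) x -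
      A.indicator (fun x => (Q : Measure ℕ).real {x}) x‖ ≤ |massFun P x - massFun Q x| := by
    intro x
    by_cases hx : x ∈ A <;> simp [hx, massFun]
  rw [← h1.tsum_eq]
  exact (tsum_of_norm_bounded h2.hasSum h3).trans (tsum_abs_le_of_ellOne_le hc h)

/-- The Yatracos set of two distributions. -/
def yatracosSet (P Q : ProbabilityMeasure ℕ) : Set ℕ := {x | massFun Q x < massFun P x}

/-- The two Yatracos sets are where the difference of the mass functions is positive and where it is
negative, so these two events determine the `ℓ¹` distance. -/
theorem ellOne_le_of_yatracosSet {P Q : ProbabilityMeasure ℕ} {c : ℝ}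
    (h1 : (P : Measure ℕ).real (yatracosSet P Q) - (Q : Measure ℕ).real (yatracosSet P Q) ≤ c)
    (h2 : (Q : Measure ℕ).real (yatracosSet Q P) - (P : Measure ℕ).real (yatracosSet Q P) ≤ c) :
    ellOne (massFun P) (massFun Q) ≤ ENNReal.ofReal (2 * c) := by
  have h3 := ((hasSum_measureReal_singleton (P : Measure ℕ) (yatracosSet P Q)).sub
    (hasSum_measureReal_singleton (Q : Measure ℕ) (yatracosSet P Q))).add
    ((hasSum_measureReal_singleton (Q : Measure ℕ) (yatracosSet Q P)).sub
    (hasSum_measureReal_singleton (P : Measure ℕ) (yatracosSet Q P)))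
  have h4 : ∀ x, (yatracosSet P Q).indicator (fun x => (P : Measure ℕ).real {x}) x -
      (yatracosSet P Q).indicator (fun x => (Q : Measure ℕ).real {x}) x +
      ((yatracosSet Q P).indicator (fun x => (Q : Measure ℕ).real {x}) x -
      (yatracosSet Q P).indicator (fun x => (P : Measure ℕ).real {x}) x) =
      |massFun P x - massFun Q x| := by
    intro x
    rcases lt_trichotomy (massFun P x) (massFun Q x) with h | h | h
    · have e1 : x ∉ yatracosSet P Q := not_lt.mpr h.le
      have e2 : x ∈ yatracosSet Q P := h
      rw [abs_of_neg (by linarith)]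
      simp [e1, e2, massFun]
    · have e1 : x ∉ yatracosSet P Q := not_lt.mpr h.le
      have e2 : x ∉ yatracosSet Q P := not_lt.mpr h.ge
      simp [e1, e2, h]
    · have e1 : x ∈ yatracosSet P Q := h
      have e2 : x ∉ yatracosSet Q P := not_lt.mpr h.le
      rw [abs_of_pos (by linarith)]
      simp [e1, e2, massFun]
  simp_rw [h4] at h3
  rw [ellOne, h3.tsum_ofReal fun x => abs_nonneg _]
  exact ENNReal.ofReal_le_ofReal (by linarith)

end L1

instance : Nonempty (ProbabilityMeasure ℕ) := ⟨⟨Measure.dirac 0, inferInstance⟩⟩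

open Classical in
/-- A distribution within `η` of `h` in `ℓ¹`, if there is one. -/
noncomputable def closeMeasure (h : ℕ → ℝ) (η : ℝ) : ProbabilityMeasure ℕ :=
  Classical.epsilon fun Q => ellOne h (massFun Q) ≤ ENNReal.ofReal η

/-- A kernel estimate need not be a probability mass function; replacing it by any nearby
distribution doubles the error. -/
theorem ellOne_closeMeasure_le {h : ℕ → ℝ} {η : ℝ} (hη : 0 ≤ η) {P : ProbabilityMeasure ℕ}
    (hP : ellOne h (massFun P) ≤ ENNReal.ofReal η) :
    ellOne (massFun (closeMeasure h η)) (massFun P) ≤ ENNReal.ofReal (2 * η) := by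
  have h1 : ellOne h (massFun (closeMeasure h η)) ≤ ENNReal.ofReal η :=
    Classical.epsilon_spec (p := fun Q => ellOne h (massFun Q) ≤ ENNReal.ofReal η) ⟨P, hP⟩
  refine (ellOne_triangle _ h _).trans ?_
  rw [ellOne_comm, two_mul, ENNReal.ofReal_add hη hη]
  exact add_le_add h1 hP

open Classical in
/-- The empirical probability of a set. -/
noncomputable def empirical {ι : Type*} [Fintype ι] (ω : ι → ℕ) (A : Set ℕ) : ℝ :=
  (∑ i, if ω i ∈ A then (1 : ℝ) else 0) / Fintype.card ι

/-- Among the distributions `H j`, select one that agrees with the empirical measure on all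
Yatracos sets up to `η`. -/
noncomputable def yatracosSelect {J ι : Type*} [Fintype ι] (H : J → ProbabilityMeasure ℕ)
    (ω : ι → ℕ) (η : ℝ) : ProbabilityMeasure ℕ :=
  Classical.epsilon fun Q => ∃ j, Q = H j ∧ ∀ a b,
    |(Q : Measure ℕ).real (yatracosSet (H a) (H b)) - empirical ω (yatracosSet (H a) (H b))| ≤ η

/-- A good hypothesis passes the test, so the selection is not vacuous. Two hypotheses that pass
differ by at most `2 (δ + Δ)` on each of their Yatracos sets, hence by `4 (δ + Δ)` in `ℓ¹`; the good
one adds `δ`. -/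
theorem ellOne_yatracosSelect_le {J ι : Type*} [Fintype ι] {H : J → ProbabilityMeasure ℕ}
    {ω : ι → ℕ} {P : ProbabilityMeasure ℕ} {δ Δ : ℝ} (hδ : 0 ≤ δ) (hΔ : 0 ≤ Δ)
    (hω : ∀ a b, |empirical ω (yatracosSet (H a) (H b)) -
      (P : Measure ℕ).real (yatracosSet (H a) (H b))| ≤ Δ)
    (hJ : ∃ j, ellOne (massFun (H j)) (massFun P) ≤ ENNReal.ofReal δ) :
    ellOne (massFun (yatracosSelect H ω (δ + Δ))) (massFun P) ≤
      ENNReal.ofReal (5 * δ + 4 * Δ) := by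
  obtain ⟨j, hj⟩ := hJ
  have hjA : ∀ a b, |(H j : Measure ℕ).real (yatracosSet (H a) (H b)) -
      empirical ω (yatracosSet (H a) (H b))| ≤ δ + Δ := fun a b => by
    have h1 := abs_measureReal_sub_le hδ hj (yatracosSet (H a) (H b))
    have h2 := hω a b
    rw [abs_sub_comm] at h2
    exact (abs_sub_le _ _ _).trans (add_le_add h1 h2)
  obtain ⟨i, hi, hiA⟩ := Classical.epsilon_spec (p := fun Q => ∃ j, Q = H j ∧ ∀ a b,
    |(Q : Measure ℕ).real (yatracosSet (H a) (H b)) - empirical ω (yatracosSet (H a) (H b))| ≤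
      δ + Δ) ⟨H j, j, rfl, hjA⟩
  have hsel : yatracosSelect H ω (δ + Δ) = H i := hi
  rw [hi] at hiA
  rw [hsel]
  refine (ellOne_triangle _ (massFun (H j)) _).trans ?_
  rw [show 5 * δ + 4 * Δ = 2 * (2 * (δ + Δ)) + δ by ring,
    ENNReal.ofReal_add (by positivity) hδ]
  refine add_le_add (ellOne_le_of_yatracosSet ?_ ?_) hj
  · have h1 := abs_le.mp (hiA i j)
    have h2 := abs_le.mp (hjA i j)
    linarith [h1.2, h2.1]
  · have h1 := abs_le.mp (hiA j i)
    have h2 := abs_le.mp (hjA j i)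
    linarith [h1.1, h2.2]

/-- Hoeffding's inequality: a centred indicator is sub-Gaussian with parameter `1 / 4`. Both tails
are taken. -/
theorem measure_empirical_ge_le {ι : Type*} [Fintype ι] [Nonempty ι] (P : Measure ℕ)
    [IsProbabilityMeasure P] (A : Set ℕ) {Δ : ℝ} (hΔ : 0 ≤ Δ) :
    (Measure.pi fun _ : ι => P) {ω | Δ < |empirical ω A - P.real A|} ≤
      ENNReal.ofReal (2 * Real.exp (-(2 * Fintype.card ι * Δ ^ 2))) := by
  classical
  have hN0 : (0 : ℝ) < Fintype.card ι := by exact_mod_cast Fintype.card_pos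
  set μ : Measure (ι → ℕ) := Measure.pi fun _ : ι => P with hμ
  let f : ℕ → ℝ := fun x => if x ∈ A then 1 else 0
  have hf : ∫ x, f x ∂P = P.real A := by
    rw [← integral_indicator_one A.to_countable.measurableSet]; rfl
  have hsub : HasSubgaussianMGF (fun x => f x - P.real A) ((‖(1 : ℝ) - 0‖₊ / 2) ^ 2) P := by
    have := hasSubgaussianMGF_of_mem_Icc (μ := P) (X := f) (a := 0) (b := 1)
      (measurable_of_countable f).aemeasurable
      (Filter.Eventually.of_forall fun x => by simp only [f]; split_ifs <;> simp)
    rwa [hf] at this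
  have hc : ((‖(1 : ℝ) - 0‖₊ / 2) ^ 2 : NNReal) = 1 / 4 := by
    simp; norm_num
  rw [hc] at hsub
  have hind : iIndepFun (fun (i : ι) (ω : ι → ℕ) => f (ω i) - P.real A) μ :=
    iIndepFun_pi (μ := fun _ : ι => P) (X := fun _ x => f x - P.real A)
      fun i => (measurable_of_countable _).aemeasurable
  have hsubi : ∀ i : ι, HasSubgaussianMGF (fun ω : ι → ℕ => f (ω i) - P.real A) (1 / 4) μ :=
    fun i => by
      have hmp := measurePreserving_eval (fun _ : ι => P) i
      have h1 : HasSubgaussianMGF (fun x => f x - P.real A) (1 / 4) (μ.map fun ω => ω i) := by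
        rw [show (fun ω : ι → ℕ => ω i) = Function.eval i from rfl, hμ, hmp.map_eq]
        exact hsub
      exact h1.of_map hmp.measurable.aemeasurable
  have hup := HasSubgaussianMGF.measure_sum_ge_le_of_iIndepFun hind (s := Finset.univ)
    (fun i _ => hsubi i) (ε := Fintype.card ι * Δ) (by positivity)
  have hind' : iIndepFun (fun (i : ι) (ω : ι → ℕ) => -(f (ω i) - P.real A)) μ :=
    iIndepFun_pi (μ := fun _ : ι => P) (X := fun _ x => -(f x - P.real A))
      fun i => (measurable_of_countable _).aemeasurable
  have hlo := HasSubgaussianMGF.measure_sum_ge_le_of_iIndepFun hind' (s := Finset.univ)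
    (fun i _ => (hsubi i).neg) (ε := Fintype.card ι * Δ) (by positivity)
  have hexp : -(Fintype.card ι * Δ) ^ 2 / (2 * ((∑ _i : ι, (1 / 4 : NNReal) : NNReal) : ℝ)) =
      -(2 * Fintype.card ι * Δ ^ 2) := by
    simp only [Finset.sum_const, Finset.card_univ, nsmul_eq_mul]
    push_cast
    field_simp
    norm_num
  rw [hexp] at hup hlo
  have hset : {ω : ι → ℕ | Δ < |empirical ω A - P.real A|} ⊆
      {ω | Fintype.card ι * Δ ≤ ∑ i, (f (ω i) - P.real A)} ∪
      {ω | Fintype.card ι * Δ ≤ ∑ i, -(f (ω i) - P.real A)} := by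
    intro ω hω
    have hω' : Δ < |empirical ω A - P.real A| := hω
    have h1 : ∑ i, (f (ω i) - P.real A) = Fintype.card ι * (empirical ω A - P.real A) := by
      rw [Finset.sum_sub_distrib, empirical, mul_sub, mul_div_cancel₀ _ hN0.ne']
      simp [f]
    rcases lt_abs.mp hω' with h | h
    · left
      change Fintype.card ι * Δ ≤ ∑ i, (f (ω i) - P.real A)
      rw [h1]
      gcongr
    · right
      change Fintype.card ι * Δ ≤ ∑ i, -(f (ω i) - P.real A)
      rw [Finset.sum_neg_distrib, h1, ← mul_neg]
      gcongr
  refine (measure_mono hset).trans ((measure_union_le _ _).trans ?_)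
  rw [two_mul, ENNReal.ofReal_add (Real.exp_pos _).le (Real.exp_pos _).le]
  refine add_le_add ?_ ?_
  · rw [← ofReal_measureReal]; exact ENNReal.ofReal_le_ofReal hup
  · rw [← ofReal_measureReal]; exact ENNReal.ofReal_le_ofReal hlo

/-- Conditioning on the first block of samples, on which the objects tested by the second block may
depend. -/
theorem measure_prod_le_of_forall {X Y : Type*} [MeasurableSpace X] [MeasurableSpace Y]
    [Countable X] [Countable Y] [MeasurableSingletonClass X] [MeasurableSingletonClass Y]
    (μ : Measure X) (ν : Measure Y) [IsProbabilityMeasure μ] [SFinite ν] {S : Set (X × Y)}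
    {c : ℝ≥0∞} (h : ∀ x, ν {y | (x, y) ∈ S} ≤ c) : (μ.prod ν) S ≤ c := by
  rw [Measure.prod_apply S.to_countable.measurableSet]
  calc _ ≤ ∫⁻ _x, c ∂μ := lintegral_mono h
    _ = c := by simp

/-! ### The learning algorithm and its sample size. -/

/-- Split a sample into blocks of sizes `1`, `8`, `N₁` and `N₂`. -/
theorem exists_measurePreserving_blocks (N₁ N₂ : ℕ) :
    ∃ φ : (Fin (9 + N₁ + N₂) → ℕ) → (ℕ × (Fin 8 → ℕ)) × ((Fin N₁ → ℕ) × (Fin N₂ → ℕ)),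
      ∀ (P : Measure ℕ) [IsProbabilityMeasure P], MeasurePreserving φ (Measure.pi fun _ => P)
        ((P.prod (Measure.pi fun _ => P)).prod
          ((Measure.pi fun _ => P).prod (Measure.pi fun _ => P))) := by
  have hcard : Fintype.card (Fin (9 + N₁ + N₂)) =
      Fintype.card ((Unit ⊕ Fin 8) ⊕ (Fin N₁ ⊕ Fin N₂)) := by
    simp; ring
  let e := Fintype.equivOfCardEq hcard
  refine ⟨fun ω => (((MeasurableEquiv.funUnique Unit ℕ)
    (fun i => (MeasurableEquiv.piCongrLeft (fun _ => ℕ) e) ω (.inl (.inl i))),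
    fun i => (MeasurableEquiv.piCongrLeft (fun _ => ℕ) e) ω (.inl (.inr i))),
    (fun i => (MeasurableEquiv.piCongrLeft (fun _ => ℕ) e) ω (.inr (.inl i)),
    fun i => (MeasurableEquiv.piCongrLeft (fun _ => ℕ) e) ω (.inr (.inr i)))), ?_⟩
  intro P _
  have h1 := measurePreserving_piCongrLeft (fun _ => P) e
  have h2 := measurePreserving_sumPiEquivProdPi
    (fun _ : (Unit ⊕ Fin 8) ⊕ (Fin N₁ ⊕ Fin N₂) => P)
  have h3 := measurePreserving_sumPiEquivProdPi (fun _ : Unit ⊕ Fin 8 => P)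
  have h4 := measurePreserving_sumPiEquivProdPi (fun _ : Fin N₁ ⊕ Fin N₂ => P)
  have h5 := (measurePreserving_funUnique P Unit).prod
    (MeasurePreserving.id (Measure.pi fun _ : Fin 8 => P))
  exact (((h5.comp h3).prod h4).comp h2).comp h1

/-- The estimate of the standard deviation. -/
noncomputable def scaleEstimate (z : ℕ × (Fin 8 → ℕ)) : ℝ :=
  if spread z = 0 then 1 else (spread z : ℝ) / 60

/-- The hypotheses among which the algorithm selects. -/
noncomputable def candidateHypothesis (k : ℕ) (ε Λ : ℝ) {N₁ : ℕ} (z : ℕ × (Fin 8 → ℕ))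
    (ω : Fin N₁ → ℕ) (j : Option (Sym (Fin k) k)) : ProbabilityMeasure ℕ :=
  closeMeasure (kernelEstimator (candidateKernel k (scaleEstimate z) Λ j) ω) (ε / 10)

/-- The hypothesis that the algorithm outputs. -/
noncomputable def learnedHypothesis (k : ℕ) (ε Λ : ℝ) {N₁ N₂ : ℕ}
    (x : (ℕ × (Fin 8 → ℕ)) × ((Fin N₁ → ℕ) × (Fin N₂ → ℕ))) : ProbabilityMeasure ℕ :=
  yatracosSelect (candidateHypothesis k ε Λ x.1 x.2.1) x.2.2 (ε / 5 + ε / 4)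

/-- If `σ ≤ k`, the point kernel is good whatever the scale estimate. Otherwise the scale is right
up to probability `1 / 30`, and given the scale some multiset kernel is good up to probability `1 /
10`. -/
theorem measure_candidate_bad_le {n k : ℕ} {P : ProbabilityMeasure ℕ} (hP : IsSIIRV n k P)
    (hk : 1 ≤ k) {ε Λ : ℝ} (hε : 0 < ε) (hΛ : 1 ≤ Λ) {N₁ : ℕ} (hN₁ : 0 < N₁)
    (h1 : 40000 * k ≤ N₁ * ε ^ 2)
    (h2 : 24000 * kernelConst * (k * Real.sqrt Λ) * (1 / N₁ + Real.exp (-(Λ / 2))) /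
      (ε / 10) ^ 2 ≤ 1 / 10) :
    ((((P : Measure ℕ).prod (Measure.pi fun _ : Fin 8 => (P : Measure ℕ)))).prod
      (Measure.pi fun _ : Fin N₁ => (P : Measure ℕ)))
      {x | ¬ ∃ j, ellOne (massFun (candidateHypothesis k ε Λ x.1 x.2 j)) (massFun P) ≤
        ENNReal.ofReal (ε / 5)} ≤ ENNReal.ofReal (2 / 15) := by
  have : Nonempty (Fin N₁) := ⟨⟨0, hN₁⟩⟩
  have hN0 : (0 : ℝ) < N₁ := by exact_mod_cast hN₁
  obtain ⟨q, hq, hPq⟩ := hP.exists_polynomial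
  have hgen : HasGenPoly (n * (k - 1) + 1) (∏ i, q i) (P : Measure ℕ) := by
    refine ⟨?_, hPq⟩
    have := IsProbPoly.prod (Finset.univ : Finset (Fin n)) (k := k - 1) (q := q)
      (fun i _ => (hq i).mono (by omega))
    simpa using this
  have hkey : ∀ (z : ℕ × (Fin 8 → ℕ)) (j : Option (Sym (Fin k) k)),
      {ω : Fin N₁ → ℕ | ¬ ∃ j, ellOne (massFun (candidateHypothesis k ε Λ z ω j)) (massFun P) ≤
        ENNReal.ofReal (ε / 5)} ⊆ {ω | ENNReal.ofReal (ε / 10) <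
      ∑' x : ℕ, ENNReal.ofReal |kernelEstimator (candidateKernel k (scaleEstimate z) Λ j) ω x -
        (∏ i, q i).coeff x|} := by
    intro z j ω hω
    by_contra hcon
    rw [Set.mem_ofPred_eq, not_lt] at hcon
    apply hω
    refine ⟨j, ?_⟩
    have h3 : ellOne (kernelEstimator (candidateKernel k (scaleEstimate z) Λ j) ω) (massFun P) ≤
        ENNReal.ofReal (ε / 10) := by
      refine le_of_eq_of_le ?_ hcon
      simp only [ellOne, massFun, hPq]
    have h4 := ellOne_closeMeasure_le (by positivity) h3
    rw [show 2 * (ε / 10) = ε / 5 by ring] at h4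
    exact h4
  have hV0 : 0 ≤ polyVar (∏ i, q i) := hgen.1.polyVar_nonneg
  by_cases hsmall : polyVar (∏ i, q i) ≤ (k : ℝ) ^ 2
  · refine measure_prod_le_of_forall _ _ fun z => (measure_mono (hkey z none)).trans
      ((measure_pointKernelEstimator_le hgen (by exact_mod_cast hk) (by positivity) hsmall _
        _).trans (ENNReal.ofReal_le_ofReal ?_))
    rw [Fintype.card_fin, div_le_iff₀ (by positivity)]
    nlinarith
  · rw [not_le] at hsmall
    set σ := Real.sqrt (polyVar (∏ i, q i)) with hσdef
    have hσ2 : polyVar (∏ i, q i) = σ ^ 2 := (Real.sq_sqrt hV0).symm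
    have hkσ : (k : ℝ) ≤ σ := Real.le_sqrt_of_sq_le hsmall.le
    have hk1 : (1 : ℝ) ≤ k := by exact_mod_cast hk
    have hσ1 : 1 ≤ σ := hk1.trans hkσ
    have hσ0 : 0 < σ := by linarith
    have hbad := measure_spread_bad_le (fun i _ => hq i) hgen hσ0 hkσ hσ2
    set Bz : Set (ℕ × (Fin 8 → ℕ)) := {z | ¬ (σ / 10 ≤ spread z ∧ spread z ≤ 60 * σ)} with hBz
    set S := {x : (ℕ × (Fin 8 → ℕ)) × (Fin N₁ → ℕ) |
      ¬ ∃ j, ellOne (massFun (candidateHypothesis k ε Λ x.1 x.2 j)) (massFun P) ≤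
        ENNReal.ofReal (ε / 5)} with hS
    have hsub : S ⊆ (Prod.fst ⁻¹' Bz) ∪ (S ∩ (Prod.fst ⁻¹' Bzᶜ)) := by
      intro x hx
      by_cases hB : x.1 ∈ Bz
      · exact Or.inl hB
      · exact Or.inr ⟨hx, hB⟩
    refine (measure_mono hsub).trans ((measure_union_le _ _).trans ?_)
    rw [show (2 : ℝ) / 15 = 1 / 30 + 1 / 10 by norm_num, ENNReal.ofReal_add (by norm_num)
      (by norm_num)]
    refine add_le_add ?_ (measure_prod_le_of_forall _ _ fun z => ?_)
    · rw [measurePreserving_fst.measure_preimage Bz.to_countable.measurableSet.nullMeasurableSet]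
      exact hbad
    · by_cases hz : z ∈ Bz
      · have : {y : Fin N₁ → ℕ | (z, y) ∈ S ∩ (Prod.fst ⁻¹' Bzᶜ)} = ∅ := by
          ext y; simp [hz]
        rw [this, measure_empty]
        exact zero_le
      · have hz' : σ / 10 ≤ spread z ∧ (spread z : ℝ) ≤ 60 * σ := not_not.mp hz
        have hsp : spread z ≠ 0 := by
          intro h0
          rw [h0] at hz'
          have := hz'.1
          norm_num at this
          linarith
        have hs : scaleEstimate z = (spread z : ℝ) / 60 := if_neg hsp
        -- With the spread in `[σ / 10, 60 σ]`, a sixtieth of it lies in `[σ / 600, σ]`.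
        obtain ⟨M, hM⟩ := exists_measure_smoothKernelEstimator_le (ι := Fin N₁) (fun i _ => hq i)
          hgen hk (s := scaleEstimate z) (η := ε / 10) (Λ := Λ) hσ1 (by positivity)
          (by rw [hs]; positivity) (by rw [hs]; linarith [hz'.2]) (by rw [hs]; linarith [hz'.1])
          hσ2 hΛ
        refine (measure_mono ?_).trans (hM.trans (ENNReal.ofReal_le_ofReal ?_))
        · intro y hy
          exact hkey z (some M) hy.1
        · rwa [Fintype.card_fin]

/-- Given the first two blocks, the candidates are fixed, and the last block is used only for a
union bound over their Yatracos sets. -/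
theorem measure_select_bad_le {n k : ℕ} {P : ProbabilityMeasure ℕ} (hP : IsSIIRV n k P)
    (hk : 1 ≤ k) {ε Λ : ℝ} (hε : 0 < ε) (hΛ : 1 ≤ Λ) {N₁ N₂ : ℕ} (hN₁ : 0 < N₁) (hN₂ : 0 < N₂)
    (h1 : 40000 * k ≤ N₁ * ε ^ 2)
    (h2 : 24000 * kernelConst * (k * Real.sqrt Λ) * (1 / N₁ + Real.exp (-(Λ / 2))) /
      (ε / 10) ^ 2 ≤ 1 / 10)
    (h3 : 64 * k ≤ N₂ * ε ^ 2) :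
    ((((P : Measure ℕ).prod (Measure.pi fun _ : Fin 8 => (P : Measure ℕ)))).prod
      ((Measure.pi fun _ : Fin N₁ => (P : Measure ℕ)).prod
        (Measure.pi fun _ : Fin N₂ => (P : Measure ℕ))))
      {x | ¬ tvDist (learnedHypothesis k ε Λ x) P ≤ ε} ≤ ENNReal.ofReal (1 / 3) := by
  classical
  have : Nonempty (Fin N₂) := ⟨⟨0, hN₂⟩⟩
  set S₁ := {x : (ℕ × (Fin 8 → ℕ)) × (Fin N₁ → ℕ) |
      ¬ ∃ j, ellOne (massFun (candidateHypothesis k ε Λ x.1 x.2 j)) (massFun P) ≤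
        ENNReal.ofReal (ε / 5)} with hS₁
  have hc := measure_candidate_bad_le hP hk hε hΛ hN₁ h1 h2
  rw [← hS₁] at hc
  set S₂ := {x : ((ℕ × (Fin 8 → ℕ)) × (Fin N₁ → ℕ)) × (Fin N₂ → ℕ) |
    ∃ a b, ε / 4 < |empirical x.2 (yatracosSet (candidateHypothesis k ε Λ x.1.1 x.1.2 a)
      (candidateHypothesis k ε Λ x.1.1 x.1.2 b)) - (P : Measure ℕ).real
      (yatracosSet (candidateHypothesis k ε Λ x.1.1 x.1.2 a)
      (candidateHypothesis k ε Λ x.1.1 x.1.2 b))|} with hS₂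
  have hassoc := measurePreserving_prodAssoc
    ((P : Measure ℕ).prod (Measure.pi fun _ : Fin 8 => (P : Measure ℕ)))
    (Measure.pi fun _ : Fin N₁ => (P : Measure ℕ)) (Measure.pi fun _ : Fin N₂ => (P : Measure ℕ))
  rw [← hassoc.measure_preimage
    (Set.to_countable _).measurableSet.nullMeasurableSet]
  have hsub : (MeasurableEquiv.prodAssoc ⁻¹'
      {x : (ℕ × (Fin 8 → ℕ)) × ((Fin N₁ → ℕ) × (Fin N₂ → ℕ)) |
        ¬ tvDist (learnedHypothesis k ε Λ x) P ≤ ε}) ⊆ (Prod.fst ⁻¹' S₁) ∪ S₂ := by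
    rintro ⟨⟨z, ω₁⟩, ω₂⟩ hx
    by_contra hcon
    rw [Set.mem_union, not_or] at hcon
    apply hx
    have g1 := not_not.mp hcon.1
    have g2 : ∀ a b, |empirical ω₂ (yatracosSet (candidateHypothesis k ε Λ z ω₁ a)
      (candidateHypothesis k ε Λ z ω₁ b)) - (P : Measure ℕ).real
      (yatracosSet (candidateHypothesis k ε Λ z ω₁ a)
      (candidateHypothesis k ε Λ z ω₁ b))| ≤ ε / 4 := by
      intro a b
      by_contra! hab
      exact hcon.2 ⟨a, b, hab⟩
    have g3 := ellOne_yatracosSelect_le (by positivity) (by positivity) g2 g1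
    -- The tolerances `δ = ε / 5` and `Δ = ε / 4` are chosen so that the `ℓ¹` error is `2 ε`, that
    -- is, total variation `ε`.
    rw [show 5 * (ε / 5) + 4 * (ε / 4) = 2 * ε by ring] at g3
    exact tvDist_le_of_ellOne_le hε.le g3
  refine (measure_mono hsub).trans ((measure_union_le _ _).trans ?_)
  rw [show (1 : ℝ) / 3 = 2 / 15 + 1 / 5 by norm_num, ENNReal.ofReal_add (by norm_num)
    (by norm_num)]
  refine add_le_add ?_ ?_
  · rw [measurePreserving_fst.measure_preimage S₁.to_countable.measurableSet.nullMeasurableSet]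
    exact hc
  · refine measure_prod_le_of_forall _ _ fun x => ?_
    have hU : {y : Fin N₂ → ℕ | (x, y) ∈ S₂} =
        ⋃ ab : Option (Sym (Fin k) k) × Option (Sym (Fin k) k), {y : Fin N₂ → ℕ | ε / 4 <
          |empirical y (yatracosSet (candidateHypothesis k ε Λ x.1 x.2 ab.1)
            (candidateHypothesis k ε Λ x.1 x.2 ab.2)) - (P : Measure ℕ).real
          (yatracosSet (candidateHypothesis k ε Λ x.1 x.2 ab.1)
            (candidateHypothesis k ε Λ x.1 x.2 ab.2))|} := by
      ext y
      simp [hS₂]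
    rw [hU]
    refine (measure_iUnion_fintype_le _ _).trans ?_
    refine (Finset.sum_le_sum fun ab _ => measure_empirical_ge_le (P : Measure ℕ) _
      (by positivity)).trans ?_
    rw [Finset.sum_const, Finset.card_univ, Fintype.card_prod, Fintype.card_option, nsmul_eq_mul,
      ← ENNReal.ofReal_natCast, ← ENNReal.ofReal_mul (by positivity)]
    apply ENNReal.ofReal_le_ofReal
    rw [Fintype.card_fin]
    have hk1 : (1 : ℝ) ≤ k := by exact_mod_cast hk
    have hcardle : ((Fintype.card (Sym (Fin k) k) + 1 : ℕ) : ℝ) ≤ 2 * 4 ^ k := by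
      have h4 := card_sym_fin_le k
      have h5 : 1 ≤ 4 ^ k := Nat.one_le_pow _ _ (by norm_num)
      exact_mod_cast (by omega : Fintype.card (Sym (Fin k) k) + 1 ≤ 2 * 4 ^ k)
    -- The exponent is at least `8 k` by `h3`, which beats the `(2 * 4 ^ k)²` pairs of candidates.
    have hexp : Real.exp (-(2 * N₂ * (ε / 4) ^ 2)) ≤ (1 / 1280) ^ k := by
      have e1 : (1280 : ℝ) ≤ Real.exp 8 := by
        have := Real.exp_one_gt_d9
        rw [show (8 : ℝ) = (8 : ℕ) * 1 by norm_num, Real.exp_nat_mul]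
        calc (1280 : ℝ) ≤ 2.7 ^ 8 := by norm_num
          _ ≤ _ := by gcongr; linarith
      have e2 : Real.exp (-8) ≤ 1 / 1280 := by
        rw [Real.exp_neg, one_div]
        exact inv_anti₀ (by norm_num) e1
      calc Real.exp (-(2 * N₂ * (ε / 4) ^ 2)) ≤ Real.exp (k * (-8)) := by
            apply Real.exp_le_exp.mpr; nlinarith
        _ = Real.exp (-8) ^ k := Real.exp_nat_mul _ _
        _ ≤ _ := by gcongr
    push_cast at hcardle ⊢
    calc _ ≤ (2 * 4 ^ k) * (2 * 4 ^ k) * (2 * (1 / 1280 : ℝ) ^ k) := by gcongr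
      _ = 8 * (16 / 1280 : ℝ) ^ k := by
        rw [div_pow, div_pow, one_pow, show (16 : ℝ) = 4 * 4 by norm_num, mul_pow]; ring
      _ ≤ 8 * (16 / 1280 : ℝ) ^ 1 := by
        gcongr ?_ * ?_
        exact pow_le_pow_of_le_one (by norm_num) (by norm_num) hk
      _ ≤ 1 / 5 := by norm_num

theorem exists_learner {k : ℕ} (hk : 1 ≤ k) {ε Λ : ℝ} (hε : 0 < ε) (hΛ : 1 ≤ Λ) {N₁ N₂ : ℕ}
    (hN₁ : 0 < N₁) (hN₂ : 0 < N₂) (h1 : 40000 * k ≤ N₁ * ε ^ 2)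
    (h2 : 24000 * kernelConst * (k * Real.sqrt Λ) * (1 / N₁ + Real.exp (-(Λ / 2))) /
      (ε / 10) ^ 2 ≤ 1 / 10)
    (h3 : 64 * k ≤ N₂ * ε ^ 2) :
    ∃ 𝒜 : Kernel (Fin (9 + N₁ + N₂) → ℕ) (ProbabilityMeasure ℕ), IsMarkovKernel 𝒜 ∧
      ∀ (n : ℕ) (P : ProbabilityMeasure ℕ), IsSIIRV n k P → Learns 𝒜 ε P := by
  obtain ⟨φ, hφ⟩ := exists_measurePreserving_blocks N₁ N₂
  refine ⟨Kernel.deterministic (fun ω => learnedHypothesis k ε Λ (φ ω))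
    (measurable_of_countable _), inferInstance, fun n P hP => ?_⟩
  have hbad := measure_select_bad_le hP hk hε hΛ hN₁ hN₂ h1 h2 h3
  set S := {x : (ℕ × (Fin 8 → ℕ)) × ((Fin N₁ → ℕ) × (Fin N₂ → ℕ)) |
    ¬ tvDist (learnedHypothesis k ε Λ x) P ≤ ε} with hS
  rw [← (hφ (P : Measure ℕ)).measure_preimage S.to_countable.measurableSet.nullMeasurableSet]
    at hbad
  rw [Learns, hypothesisLaw, Measure.deterministic_comp_eq_map]
  refine le_trans ?_ (Measure.le_map_apply (measurable_of_countable _).aemeasurable _)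
  have h4 : (fun ω => learnedHypothesis k ε Λ (φ ω)) ⁻¹' {H | tvDist H P ≤ ε} = (φ ⁻¹' S)ᶜ := by
    ext ω
    simp [hS]
  rw [h4, prob_compl_eq_one_sub (Set.to_countable _).measurableSet]
  have h5 : (2 / 3 : ℝ≥0∞) = 1 - ENNReal.ofReal (1 / 3) := by
    rw [← ENNReal.ofReal_one, ← ENNReal.ofReal_sub _ (by norm_num)]
    rw [show (1 : ℝ) - 1 / 3 = 2 / 3 by norm_num, ENNReal.ofReal_div_of_pos (by norm_num)]
    simp
  rw [h5]
  exact tsub_le_tsub_left hbad 1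

/-- The upper bound for the sample complexity. -/
theorem exists_upper_bound :
    ∃ A₀ C : ℝ, 1 ≤ A₀ ∧ 0 < C ∧ ∀ (A : ℝ) (d : ℕ), A₀ ≤ A → 1 ≤ d → ∀ (k : ℕ) (ε : ℝ), 1 ≤ k →
      0 < ε → ε ≤ 1 / (A * (k : ℝ) ^ d) →
      ∃ (N : ℕ) (𝒜 : Kernel (Fin N → ℕ) (ProbabilityMeasure ℕ)), IsMarkovKernel 𝒜 ∧
        (N : ℝ) ≤ C * ((k : ℝ) / ε ^ 2 * Real.sqrt (Real.log (1 / ε))) ∧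
        ∀ (n : ℕ) (P : ProbabilityMeasure ℕ), 1 ≤ n → IsSIIRV n k P → Learns 𝒜 ε P := by
  have hkc := kernelConst_pos
  have hkc1 : 1 ≤ kernelConst := by
    have := cutoffBound_nonneg
    have := Real.exp_pos 2
    unfold kernelConst
    nlinarith
  -- Chosen so that `144000 kernelConst / c₁` is at most the `1 / 1000` needed at the end of `h2`.
  set c₁ : ℝ := 200000000 * kernelConst with hc₁
  refine ⟨c₁, c₁ + 100, by linarith, by linarith, ?_⟩
  intro A d hA hd k ε hk hε hεA
  have hk1 : (1 : ℝ) ≤ k := by exact_mod_cast hk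
  have hA0 : 0 < A := by linarith
  have hkd : (k : ℝ) ≤ (k : ℝ) ^ d := le_self_pow₀ hk1 (by omega)
  have hkε : k * ε ≤ 1 / c₁ := by
    rw [le_div_iff₀ (by positivity)] at hεA ⊢
    calc k * ε * c₁ ≤ k ^ d * ε * A := by gcongr
      _ = ε * (A * k ^ d) := by ring
      _ ≤ 1 := hεA
  have hε1 : ε ≤ 1 / c₁ := le_trans (by nlinarith) hkε
  have hε2 : ε ≤ 1 / 200000000 := hε1.trans (by
    apply one_div_le_one_div_of_le (by norm_num); rw [hc₁]; linarith)
  set l := Real.log (1 / ε) with hl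
  have hl1 : 1 ≤ l := by
    rw [hl, Real.le_log_iff_exp_le (by positivity)]
    have := Real.exp_one_lt_d9
    rw [le_div_iff₀ hε]
    nlinarith
  have hlε : l ≤ 1 / ε := by
    have := Real.log_le_sub_one_of_pos (x := 1 / ε) (by positivity)
    linarith
  have hsl : 1 ≤ Real.sqrt l := Real.one_le_sqrt.mpr hl1
  have hslε : Real.sqrt l ≤ 1 / ε := by
    refine le_trans ?_ hlε
    rw [Real.sqrt_le_left (by linarith)]
    nlinarith
  -- Makes `exp (-(Λ / 2)) = ε ^ 4`; the bias is then negligible as soon as `k ε` is small, which is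
  -- the only use of the bound on `ε` in terms of `k`.
  set Λ := 8 * l with hΛ
  have hsΛ : Real.sqrt Λ ≤ 3 * Real.sqrt l := by
    rw [hΛ, Real.sqrt_mul (by norm_num)]
    gcongr
    rw [Real.sqrt_le_left (by norm_num)]
    norm_num
  have hexp : Real.exp (-(Λ / 2)) = ε ^ 4 := by
    rw [hΛ, hl, Real.log_div one_ne_zero hε.ne', Real.log_one, zero_sub,
      show -(8 * -Real.log ε / 2) = (4 : ℕ) * Real.log ε by push_cast; ring, Real.exp_nat_mul,
      Real.exp_log hε]
  set Q := (k : ℝ) / ε ^ 2 * Real.sqrt l with hQ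
  have hkεpos : 0 < (k : ℝ) / ε ^ 2 := by positivity
  have hQ1 : 1 ≤ (k : ℝ) / ε ^ 2 := by
    rw [le_div_iff₀ (by positivity)]; nlinarith
  have hkQ : (k : ℝ) / ε ^ 2 ≤ Q := le_mul_of_one_le_right hkεpos.le hsl
  set N₁ := ⌈c₁ * Q⌉₊ with hN₁
  set N₂ := ⌈64 * ((k : ℝ) / ε ^ 2)⌉₊ with hN₂
  have hQpos : 0 < Q := by linarith
  have hN₁l : c₁ * Q ≤ N₁ := Nat.le_ceil _
  have hN₂l : 64 * ((k : ℝ) / ε ^ 2) ≤ N₂ := Nat.le_ceil _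
  have hN₁u : (N₁ : ℝ) < c₁ * Q + 1 := Nat.ceil_lt_add_one (by positivity)
  have hN₂u : (N₂ : ℝ) < 64 * ((k : ℝ) / ε ^ 2) + 1 := Nat.ceil_lt_add_one (by positivity)
  have hN₁pos : 0 < N₁ := Nat.ceil_pos.mpr (by positivity)
  have hN₂pos : 0 < N₂ := Nat.ceil_pos.mpr (by positivity)
  have hN₁0 : (0 : ℝ) < N₁ := by exact_mod_cast hN₁pos
  have h1 : 40000 * (k : ℝ) ≤ N₁ * ε ^ 2 := by
    have : c₁ * ((k : ℝ) / ε ^ 2) ≤ N₁ := le_trans (by gcongr) hN₁l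
    calc 40000 * (k : ℝ) ≤ c₁ * k := by gcongr; rw [hc₁]; linarith
      _ = c₁ * ((k : ℝ) / ε ^ 2) * ε ^ 2 := by field_simp
      _ ≤ N₁ * ε ^ 2 := by gcongr
  have h3 : 64 * (k : ℝ) ≤ N₂ * ε ^ 2 := by
    calc 64 * (k : ℝ) = 64 * ((k : ℝ) / ε ^ 2) * ε ^ 2 := by field_simp
      _ ≤ N₂ * ε ^ 2 := by gcongr
  have h2 : 24000 * kernelConst * (k * Real.sqrt Λ) * (1 / N₁ + Real.exp (-(Λ / 2))) /
      (ε / 10) ^ 2 ≤ 1 / 10 := by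
    rw [hexp, div_le_iff₀ (by positivity)]
    have e1 : k * Real.sqrt l * (1 / N₁) ≤ ε ^ 2 / c₁ := by
      rw [mul_one_div, div_le_div_iff₀ hN₁0 (by positivity)]
      calc k * Real.sqrt l * c₁ = ε ^ 2 * (c₁ * Q) := by rw [hQ]; field_simp
        _ ≤ ε ^ 2 * N₁ := by gcongr
    have e2 : k * Real.sqrt l * ε ^ 4 ≤ ε ^ 2 / c₁ := by
      calc k * Real.sqrt l * ε ^ 4 ≤ k * (1 / ε) * ε ^ 4 := by gcongr
        _ = k * ε * ε ^ 2 := by field_simp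
        _ ≤ 1 / c₁ * ε ^ 2 := by gcongr
        _ = _ := by ring
    calc 24000 * kernelConst * (k * Real.sqrt Λ) * (1 / N₁ + ε ^ 4)
        ≤ 24000 * kernelConst * (k * (3 * Real.sqrt l)) * (1 / N₁ + ε ^ 4) := by gcongr
      _ = 72000 * kernelConst * (k * Real.sqrt l * (1 / N₁) + k * Real.sqrt l * ε ^ 4) := by ring
      _ ≤ 72000 * kernelConst * (ε ^ 2 / c₁ + ε ^ 2 / c₁) := by gcongr
      _ = 144000 / 200000000 * ε ^ 2 := by rw [hc₁]; field_simp; ring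
      _ ≤ _ := by nlinarith [sq_nonneg ε]
  obtain ⟨𝒜, h𝒜, hlearn⟩ := exists_learner hk hε (by linarith) hN₁pos hN₂pos h1 h2 h3
  refine ⟨_, 𝒜, h𝒜, ?_, fun n P _ hP => hlearn n P hP⟩
  push_cast
  nlinarith

/-! ### Total variation as a metric, and learning in expectation. -/

section TotalVariation

theorem ellOne_massFun_ne_top (P Q : ProbabilityMeasure ℕ) :
    ellOne (massFun P) (massFun Q) ≠ ⊤ := by
  have h : ∀ R : ProbabilityMeasure ℕ, ellOne (massFun R) 0 = 1 := fun R => by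
    have h1 := hasSum_measureReal_singleton (R : Measure ℕ) Set.univ
    simp only [Set.indicator_univ, probReal_univ] at h1
    have h2 := h1.tsum_ofReal fun x => measureReal_nonneg
    rw [ENNReal.ofReal_one] at h2
    rw [← h2, ellOne]
    refine tsum_congr fun x => ?_
    simp only [Pi.zero_apply, sub_zero, massFun]
    rw [abs_of_nonneg measureReal_nonneg]
  have h1 := ellOne_triangle (massFun P) 0 (massFun Q)
  rw [ellOne_comm 0, h, h] at h1
  exact (h1.trans_lt (by norm_num)).ne

theorem tvDist_eq (P Q : ProbabilityMeasure ℕ) :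
    tvDist P Q = 1 / 2 * (ellOne (massFun P) (massFun Q)).toReal := by
  have h := ellOne_massFun_ne_top P Q
  rw [ellOne] at h
  rw [tvDist, ellOne, ENNReal.tsum_toReal_eq fun x => ENNReal.ne_top_of_tsum_ne_top h x]
  congr 1
  refine tsum_congr fun x => ?_
  rw [ENNReal.toReal_ofReal (abs_nonneg _)]
  rfl

theorem tvDist_comm (P Q : ProbabilityMeasure ℕ) : tvDist P Q = tvDist Q P := by
  rw [tvDist_eq, tvDist_eq, ellOne_comm]

theorem tvDist_triangle (P Q R : ProbabilityMeasure ℕ) :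
    tvDist P R ≤ tvDist P Q + tvDist Q R := by
  rw [tvDist_eq, tvDist_eq, tvDist_eq, ← mul_add, ← ENNReal.toReal_add
    (ellOne_massFun_ne_top _ _) (ellOne_massFun_ne_top _ _)]
  refine mul_le_mul_of_nonneg_left ?_ (by norm_num)
  exact ENNReal.toReal_mono (ENNReal.add_ne_top.mpr ⟨ellOne_massFun_ne_top _ _,
    ellOne_massFun_ne_top _ _⟩) (ellOne_triangle _ _ _)

theorem measurable_tvDist_left (P : ProbabilityMeasure ℕ) :
    Measurable fun H => tvDist H P := by
  simp_rw [tvDist_eq]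
  refine Measurable.const_mul (Measurable.ennreal_toReal ?_) _
  unfold ellOne
  refine Measurable.tsum fun x => ENNReal.measurable_ofReal.comp ?_
  have h1 : Measurable fun H : ProbabilityMeasure ℕ => massFun H x := by
    unfold massFun
    exact ((Measure.measurable_coe (measurableSet_singleton x)).comp
      measurable_subtype_coe).ennreal_toReal
  exact (h1.sub_const _).abs

theorem measurableSet_tvDist_le (P : ProbabilityMeasure ℕ) (ε : ℝ) :
    MeasurableSet {H | tvDist H P ≤ ε} :=
  measurableSet_le (measurable_tvDist_left P) measurable_const

instance isProbabilityMeasure_hypothesisLaw {N : ℕ}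
    (𝒜 : Kernel (Fin N → ℕ) (ProbabilityMeasure ℕ)) [IsMarkovKernel 𝒜]
    (P : ProbabilityMeasure ℕ) : IsProbabilityMeasure (hypothesisLaw 𝒜 P) := by
  unfold hypothesisLaw; infer_instance

theorem Learns.mono {N : ℕ} {𝒜 : Kernel (Fin N → ℕ) (ProbabilityMeasure ℕ)} {ε ε' : ℝ}
    {P : ProbabilityMeasure ℕ} (h : Learns 𝒜 ε P) (hε : ε ≤ ε') : Learns 𝒜 ε' P := by
  unfold Learns at h ⊢
  exact h.trans (measure_mono fun H hH => le_trans (show tvDist H P ≤ ε from hH) hε)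

/-- Markov's inequality. For this reason the lower bound is proved for learners with accuracy `3 ε`,
which covers both notions. -/
theorem LearnsInExpectation.learns {N : ℕ} {𝒜 : Kernel (Fin N → ℕ) (ProbabilityMeasure ℕ)}
    [IsMarkovKernel 𝒜] {ε : ℝ} (hε : 0 < ε) {P : ProbabilityMeasure ℕ}
    (h : LearnsInExpectation 𝒜 ε P) : Learns 𝒜 (3 * ε) P := by
  unfold LearnsInExpectation at h
  unfold Learns
  have h1 := meas_ge_le_lintegral_div (μ := hypothesisLaw 𝒜 P)
    (f := fun H => ENNReal.ofReal (tvDist H P))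
    (ENNReal.measurable_ofReal.comp (measurable_tvDist_left P)).aemeasurable
    (ε := ENNReal.ofReal (3 * ε)) (by simpa using by linarith) ENNReal.ofReal_ne_top
  have h2 : (hypothesisLaw 𝒜 P) {H | tvDist H P ≤ 3 * ε}ᶜ ≤ ENNReal.ofReal (1 / 3) := by
    refine (measure_mono ?_).trans (h1.trans ((ENNReal.div_le_div_right h _).trans ?_))
    · intro H hH
      have : 3 * ε < tvDist H P := not_le.mp hH
      exact ENNReal.ofReal_le_ofReal this.le
    · rw [← ENNReal.ofReal_div_of_pos (by linarith)]
      apply ENNReal.ofReal_le_ofReal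
      rw [div_le_div_iff₀ (by linarith) (by norm_num)]
      linarith
  rw [← compl_compl {H | tvDist H P ≤ 3 * ε},
    prob_compl_eq_one_sub (measurableSet_tvDist_le P _).compl]
  have h5 : (2 / 3 : ℝ≥0∞) = 1 - ENNReal.ofReal (1 / 3) := by
    rw [← ENNReal.ofReal_one, ← ENNReal.ofReal_sub _ (by norm_num)]
    rw [show (1 : ℝ) - 1 / 3 = 2 / 3 by norm_num, ENNReal.ofReal_div_of_pos (by norm_num)]
    simp
  rw [h5]
  exact tsub_le_tsub_left h2 1

end TotalVariation

/-! ### Chi-square divergence of product measures. -/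

section ProductMeasure

theorem integral_pi_eq_sum {N M : ℕ} (P : ProbabilityMeasure ℕ)
    (hP : ∀ x, M ≤ x → massFun P x = 0) (φ : (Fin N → ℕ) → ℝ) :
    ∫ x, φ x ∂(Measure.pi fun _ : Fin N => (P : Measure ℕ)) =
      ∑ x ∈ Fintype.piFinset fun _ : Fin N => Finset.range M, (∏ i, massFun P (x i)) * φ x := by
  set μ := Measure.pi fun _ : Fin N => (P : Measure ℕ) with hμ
  set s := Fintype.piFinset fun _ : Fin N => Finset.range M with hs
  have hsing : ∀ x : Fin N → ℕ, μ.real {x} = ∏ i, massFun P (x i) := fun x => by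
    rw [measureReal_def, hμ, Measure.pi_singleton, ENNReal.toReal_prod]
    rfl
  have h1 : μ.restrict (s : Set (Fin N → ℕ)) = μ := by
    apply Measure.restrict_eq_self_of_ae_mem
    rw [ae_iff_of_countable]
    intro x hx
    by_contra hxs
    apply hx
    rw [← measureReal_eq_zero_iff, hsing, Finset.prod_eq_zero_iff]
    have : ∃ i, M ≤ x i := by
      by_contra! hlt
      exact hxs (by simpa [hs, Fintype.mem_piFinset] using hlt)
    obtain ⟨i, hi⟩ := this
    exact ⟨i, Finset.mem_univ i, hP _ hi⟩
  conv_lhs => rw [← h1]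
  rw [setIntegral_finset _ IntegrableOn.finset]
  simp [hsing]

/-- The chi-square divergence on `{0, …, M - 1}`. -/
noncomputable def chiSq (M : ℕ) (P Q : ProbabilityMeasure ℕ) : ℝ :=
  ∑ x ∈ Finset.range M, (massFun P x - massFun Q x) ^ 2 / massFun Q x

theorem sum_massFun {M : ℕ} (P : ProbabilityMeasure ℕ) (hP : ∀ x, M ≤ x → massFun P x = 0) :
    ∑ x ∈ Finset.range M, massFun P x = 1 := by
  have h1 := hasSum_measureReal_singleton (P : Measure ℕ) Set.univ
  simp only [Set.indicator_univ, probReal_univ] at h1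
  rw [← h1.tsum_eq]
  exact (tsum_eq_sum fun x hx => hP x (by simpa using hx)).symm

/-- The quantity `1 + χ²` is multiplicative over independent samples. Cauchy–Schwarz bounds the
squared difference of integrals by `(1 + χ²) ^ N - 1 ≤ exp (N γ) - 1`, and this is at most `2 N γ`
when `N γ ≤ 1`. -/
theorem abs_integral_pi_sub_le {N M : ℕ} {P Q : ProbabilityMeasure ℕ}
    (hP : ∀ x, M ≤ x → massFun P x = 0) (hQ : ∀ x, M ≤ x → massFun Q x = 0)
    (hQ0 : ∀ x < M, 0 < massFun Q x) {γ : ℝ} (hγ : chiSq M P Q ≤ γ) (hγ0 : 0 ≤ γ)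
    (hN : N * γ ≤ 1) (φ : (Fin N → ℕ) → ℝ) (hφ : ∀ x, |φ x| ≤ 1) :
    (∫ x, φ x ∂(Measure.pi fun _ : Fin N => (P : Measure ℕ)) -
      ∫ x, φ x ∂(Measure.pi fun _ : Fin N => (Q : Measure ℕ))) ^ 2 ≤ 2 * (N * γ) := by
  rw [integral_pi_eq_sum P hP, integral_pi_eq_sum Q hQ, ← Finset.sum_sub_distrib]
  set s := Fintype.piFinset fun _ : Fin N => Finset.range M with hs
  set p := massFun P
  set q := massFun Q
  have hq : ∀ x ∈ s, 0 < ∏ i, q (x i) := fun x hx =>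
    Finset.prod_pos fun i _ => hQ0 _ (Finset.mem_range.mp (Fintype.mem_piFinset.mp hx i))
  have hqs : ∑ x ∈ s, ∏ i, q (x i) = 1 := by
    rw [hs, ← Finset.prod_univ_sum]
    simp [q, sum_massFun Q hQ]
  have hps : ∑ x ∈ s, ∏ i, p (x i) = 1 := by
    rw [hs, ← Finset.prod_univ_sum]
    simp [p, sum_massFun P hP]
  have hpq : ∑ x ∈ Finset.range M, p x ^ 2 / q x = 1 + chiSq M P Q := by
    have h1 : ∀ x ∈ Finset.range M, p x ^ 2 / q x = (p x - q x) ^ 2 / q x + 2 * p x - q x := by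
      intro x hx
      have := hQ0 x (Finset.mem_range.mp hx)
      have : q x ≠ 0 := this.ne'
      field_simp
      ring
    rw [Finset.sum_congr rfl h1, Finset.sum_sub_distrib, Finset.sum_add_distrib,
      ← Finset.mul_sum, sum_massFun P hP, sum_massFun Q hQ, chiSq]
    ring
  have hpqs : ∑ x ∈ s, (∏ i, p (x i)) ^ 2 / ∏ i, q (x i) = (1 + chiSq M P Q) ^ N := by
    rw [← hpq]
    have := Finset.prod_univ_sum (fun _ : Fin N => Finset.range M) (fun _ x => p x ^ 2 / q x)
    rw [Finset.prod_const, Finset.card_univ, Fintype.card_fin] at this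
    rw [this]
    refine Finset.sum_congr rfl fun x _ => ?_
    rw [Finset.prod_div_distrib, Finset.prod_pow]
  have hcs := Finset.sum_mul_sq_le_sq_mul_sq s (fun x => Real.sqrt (∏ i, q (x i)))
    (fun x => (∏ i, p (x i) - ∏ i, q (x i)) * φ x / Real.sqrt (∏ i, q (x i)))
  have h1 : ∑ x ∈ s, Real.sqrt (∏ i, q (x i)) *
      ((∏ i, p (x i) - ∏ i, q (x i)) * φ x / Real.sqrt (∏ i, q (x i))) =
      ∑ x ∈ s, ((∏ i, p (x i)) * φ x - (∏ i, q (x i)) * φ x) := by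
    refine Finset.sum_congr rfl fun x hx => ?_
    have := (Real.sqrt_pos.mpr (hq x hx)).ne'
    field_simp
  have h2 : ∑ x ∈ s, Real.sqrt (∏ i, q (x i)) ^ 2 = 1 := by
    rw [← hqs]
    exact Finset.sum_congr rfl fun x hx => Real.sq_sqrt (hq x hx).le
  rw [h1, h2, one_mul] at hcs
  refine hcs.trans ?_
  have h3 : ∀ x ∈ s, ((∏ i, p (x i) - ∏ i, q (x i)) * φ x / Real.sqrt (∏ i, q (x i))) ^ 2 ≤
      (∏ i, p (x i)) ^ 2 / ∏ i, q (x i) - 2 * ∏ i, p (x i) + ∏ i, q (x i) := by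
    intro x hx
    have h4 := hq x hx
    have h5 : φ x ^ 2 ≤ 1 := by
      rw [← sq_abs]; exact pow_le_one₀ (abs_nonneg _) (hφ x)
    rw [div_pow, Real.sq_sqrt h4.le, mul_pow]
    have h6 : (∏ i, p (x i)) ^ 2 / ∏ i, q (x i) - 2 * ∏ i, p (x i) + ∏ i, q (x i) =
        (∏ i, p (x i) - ∏ i, q (x i)) ^ 2 / ∏ i, q (x i) := by
      field_simp; ring
    rw [h6]
    apply div_le_div_of_nonneg_right _ h4.le
    exact mul_le_of_le_one_right (sq_nonneg _) h5
  refine (Finset.sum_le_sum h3).trans ?_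
  rw [Finset.sum_add_distrib, Finset.sum_sub_distrib, ← Finset.mul_sum, hpqs, hps, hqs]
  have hchi0 : 0 ≤ chiSq M P Q := Finset.sum_nonneg fun x hx =>
    div_nonneg (sq_nonneg _) (hQ0 x (Finset.mem_range.mp hx)).le
  have h7 : (1 + chiSq M P Q) ^ N ≤ Real.exp (N * γ) := by
    rw [Real.exp_nat_mul]
    gcongr
    linarith [Real.add_one_le_exp γ]
  have h8 := Real.abs_exp_sub_one_le (x := N * γ) (by rw [abs_of_nonneg (by positivity)]; exact hN)
  rw [abs_of_nonneg (by positivity : 0 ≤ N * γ)] at h8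
  have h9 := (abs_le.mp h8).2
  linarith

theorem hypothesisLaw_real_eq {N : ℕ} (𝒜 : Kernel (Fin N → ℕ) (ProbabilityMeasure ℕ))
    [IsMarkovKernel 𝒜] (P : ProbabilityMeasure ℕ) {B : Set (ProbabilityMeasure ℕ)}
    (hB : MeasurableSet B) :
    (hypothesisLaw 𝒜 P).real B =
      ∫ x, (𝒜 x).real B ∂(Measure.pi fun _ : Fin N => (P : Measure ℕ)) := by
  rw [measureReal_def, hypothesisLaw, Measure.bind_apply hB (Kernel.aemeasurable _)]
  rw [integral_eq_lintegral_of_nonneg_ae (Filter.Eventually.of_forall fun x => measureReal_nonneg)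
    (measurable_of_countable _).aestronglyMeasurable]
  congr 1
  refine lintegral_congr fun x => ?_
  rw [ofReal_measureReal]

end ProductMeasure

/-! ### Assouad's lemma. -/

section Assouad

/-- The Hamming distance of two vectors of signs. -/
def hamming {J : Type*} [Fintype J] (S T : J → Bool) : ℕ := (Finset.univ.filter fun j => S j ≠ T j).card

/-- Assouad's method. -/
theorem assouad_false {Ω J : Type*} [MeasurableSpace Ω] [Fintype J] [DecidableEq J] [Nonempty J]
    (μ : (J → Bool) → Measure Ω) [∀ S, IsProbabilityMeasure (μ S)] (G : (J → Bool) → Set Ω)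
    (hG : ∀ S, MeasurableSet (G S)) (hμG : ∀ S, 2 / 3 ≤ (μ S).real (G S))
    (hsep : ∀ S T ω, ω ∈ G S → ω ∈ G T → 10 * hamming S T ≤ Fintype.card J)
    (hnear : ∀ S j B, MeasurableSet B →
      |(μ S).real B - (μ (Function.update S j (!S j))).real B| ≤ 1 / 20) : False := by
  classical
  -- Which of the finitely many sets `G S` contain `ω` is all that the decoder `D` looks at, so its
  -- measurability is immediate.
  let code : Ω → ((J → Bool) → Bool) := fun ω S => decide (ω ∈ G S)
  let choice : ((J → Bool) → Bool) → (J → Bool) := fun T =>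
    if h : ∃ S, T S = true then h.choose else fun _ => true
  let D : Ω → (J → Bool) := fun ω => choice (code ω)
  have hcode : Measurable code := measurable_pi_lambda _ fun S => by
    apply measurable_to_bool
    have : (fun ω => decide (ω ∈ G S)) ⁻¹' {true} = G S := by ext ω; simp
    exact this ▸ hG S
  have hD : Measurable D := (measurable_of_finite choice).comp hcode
  have hDG : ∀ ω S, ω ∈ G S → ω ∈ G (D ω) := by
    intro ω S hω
    have h : ∃ S, code ω S = true := ⟨S, by simpa [code] using hω⟩
    have h1 : D ω = h.choose := dif_pos h
    have h2 := h.choose_spec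
    rw [← h1] at h2
    simpa [code] using h2
  let E : J → Bool → Set Ω := fun j b => {ω | D ω j = b}
  have hE : ∀ j b, MeasurableSet (E j b) := fun j b =>
    ((measurable_pi_apply j).comp hD) (measurableSet_singleton b)
  set m : ℝ := ((Fintype.card J : ℕ) : ℝ) with hm
  have hm0 : 0 < m := by
    rw [hm]
    exact_mod_cast Fintype.card_pos (α := J)
  -- Expected number of wrong signs: at most `m / 10` on `G S`, and at most `m` off it, an event of
  -- probability at most `1 / 3`.
  have hupper : ∀ S, ∑ j, (μ S).real (E j (!S j)) ≤ m / 10 + m / 3 := by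
    intro S
    have h1 : ∀ j, (μ S).real (E j (!S j)) = ∫ ω, (E j (!S j)).indicator 1 ω ∂(μ S) := fun j =>
      (integral_indicator_one (hE j _)).symm
    have h2 : ∀ j, Integrable ((E j (!S j)).indicator (1 : Ω → ℝ)) (μ S) := fun j =>
      (integrable_const (1 : ℝ)).indicator (hE j _)
    have h3 : Integrable (fun ω => m / 10 + m * ((G S)ᶜ).indicator (1 : Ω → ℝ) ω) (μ S) :=
      (integrable_const _).add (((integrable_const (1 : ℝ)).indicator (hG S).compl).const_mul m)
    simp_rw [h1]
    rw [← integral_finsetSum _ fun j _ => h2 j]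
    refine (integral_mono (integrable_finsetSum _ fun j _ => h2 j) h3 fun ω => ?_).trans ?_
    · have h4 : ∑ j, (E j (!S j)).indicator (1 : Ω → ℝ) ω = hamming (D ω) S := by
        rw [hamming, Finset.card_filter]
        push_cast
        refine Finset.sum_congr rfl fun j _ => ?_
        by_cases h : D ω j = S j
        · have : ω ∉ E j (!S j) := by simp [E, h]
          simp [this, h]
        · have : ω ∈ E j (!S j) := by
            simp only [E, Set.mem_ofPred_eq]
            revert h; cases D ω j <;> cases S j <;> simp
          simp [this, h]
      simp only []
      rw [h4]
      by_cases hω : ω ∈ G S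
      · have h5 := hsep _ _ ω (hDG ω S hω) hω
        have h6 : (10 : ℝ) * hamming (D ω) S ≤ m := by rw [hm]; exact_mod_cast h5
        simp [hω]
        linarith
      · have h5 : (hamming (D ω) S : ℝ) ≤ m := by
          rw [hm]
          exact_mod_cast Finset.card_le_univ _
        simp [hω]
        linarith
    · rw [integral_add (integrable_const _)
        (Integrable.const_mul (f := ((G S)ᶜ).indicator (1 : Ω → ℝ))
          ((integrable_const (1 : ℝ)).indicator (hG S).compl) m), integral_const_mul,
        integral_indicator_one (hG S).compl, probReal_compl_eq_one_sub (hG S)]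
      simp
      nlinarith [hμG S]
  -- Two neighbours are nearly indistinguishable, so the decoder errs on sign `j` for one or the
  -- other with total probability at least `19 / 20`.
  have hlower : ∀ S j, 1 - 1 / 20 ≤ (μ S).real (E j (!S j)) +
      (μ (Function.update S j (!S j))).real (E j (!(Function.update S j (!S j)) j)) := by
    intro S j
    rw [Function.update_self, Bool.not_not]
    have h1 := hnear S j (E j (S j)) (hE j _)
    have h2 : E j (!S j) = (E j (S j))ᶜ := by
      ext ω
      simp only [E, Set.mem_compl_iff, Set.mem_ofPred_eq]
      cases D ω j <;> cases S j <;> simp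
    rw [h2, probReal_compl_eq_one_sub (hE j _)]
    linarith [(abs_le.mp h1).2]
  have hinv : ∀ j : J, Function.Involutive
      (fun S : J → Bool => Function.update S j (!S j)) := fun j S => by
    ext i
    by_cases hi : i = j
    · subst hi; simp
    · simp [hi]
  have hsum : ∀ j, ∑ S : J → Bool, (1 - 1 / 20 : ℝ) ≤ 2 * ∑ S, (μ S).real (E j (!S j)) := by
    intro j
    have h1 := Finset.sum_le_sum fun S (_ : S ∈ Finset.univ) => hlower S j
    rw [Finset.sum_add_distrib] at h1
    have h2 := Equiv.sum_comp (hinv j).toPerm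
      (fun S : J → Bool => (μ S).real (E j (!S j)))
    have h3 : ∑ S : J → Bool, (μ (Function.update S j (!S j))).real
        (E j (!(Function.update S j (!S j)) j)) = ∑ S, (μ S).real (E j (!S j)) := h2
    rw [h3] at h1
    linarith
  have h1 := Finset.sum_le_sum fun j (_ : j ∈ Finset.univ) => hsum j
  rw [← Finset.mul_sum, Finset.sum_comm (s := (Finset.univ : Finset J))
    (f := fun j S => (μ S).real (E j (!S j)))] at h1
  have h2 := Finset.sum_le_sum fun S (_ : S ∈ Finset.univ) => hupper S
  simp only [Finset.sum_const, Finset.card_univ, nsmul_eq_mul] at h1 h2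
  rw [← hm] at h1
  have hc : (0 : ℝ) < Fintype.card (J → Bool) := by exact_mod_cast Fintype.card_pos
  -- Averaging over the cube gives `19 / 20 ≤ 2 (1 / 10 + 1 / 3)`, which is false.
  nlinarith [mul_pos hm0 hc]

/-- A family of distributions indexed by a cube which is well separated in total variation, while
neighbours are close in chi-square divergence, is hard to learn. -/
theorem one_lt_mul_of_learns {J : Type*} [Fintype J] [DecidableEq J] [Nonempty J]
    {P : (J → Bool) → ProbabilityMeasure ℕ} {M N : ℕ} {ε γ : ℝ} (hγ0 : 0 ≤ γ)
    (hsupp : ∀ S x, M ≤ x → massFun (P S) x = 0) (hpos : ∀ S, ∀ x < M, 0 < massFun (P S) x)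
    (hchi : ∀ S j, chiSq M (P S) (P (Function.update S j (!S j))) ≤ γ)
    (hsep : ∀ S T, tvDist (P S) (P T) ≤ 6 * ε → 10 * hamming S T ≤ Fintype.card J)
    (𝒜 : Kernel (Fin N → ℕ) (ProbabilityMeasure ℕ)) [IsMarkovKernel 𝒜]
    (hlearn : ∀ S, Learns 𝒜 (3 * ε) (P S)) : 1 < 800 * (N * γ) := by
  by_contra! hcon
  refine assouad_false (fun S => hypothesisLaw 𝒜 (P S))
    (fun S => {H | tvDist H (P S) ≤ 3 * ε}) (fun S => measurableSet_tvDist_le _ _) ?_ ?_ ?_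
  · intro S
    have h1 : (2 / 3 : ℝ≥0∞) ≤ hypothesisLaw 𝒜 (P S) {H | tvDist H (P S) ≤ 3 * ε} := hlearn S
    have h2 := ENNReal.toReal_mono (measure_ne_top _ _) h1
    simpa [measureReal_def] using h2
  · intro S T H hS hT
    have hS' : tvDist H (P S) ≤ 3 * ε := hS
    have hT' : tvDist H (P T) ≤ 3 * ε := hT
    apply hsep
    have h1 := tvDist_triangle (P S) H (P T)
    rw [tvDist_comm (P S) H] at h1
    linarith
  · intro S j B hB
    have hγN : N * γ ≤ 1 := by
      have : 0 ≤ N * γ := by positivity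
      linarith
    have h1 := abs_integral_pi_sub_le (N := N) (hsupp S) (hsupp _) (hpos _) (hchi S j) hγ0 hγN
      (fun x => (𝒜 x).real B) (fun x => by
        rw [abs_of_nonneg measureReal_nonneg]; exact measureReal_le_one)
    rw [← hypothesisLaw_real_eq 𝒜 _ hB, ← hypothesisLaw_real_eq 𝒜 _ hB] at h1
    apply abs_le_of_sq_le_sq _ (by norm_num)
    refine h1.trans ?_
    norm_num
    linarith

end Assouad

/-! ### The `ℓ¹` norm of coefficients and expansion of perturbed products. -/

section PolynomialNorm

open Polynomial

/-- The sum of the absolute values of the coefficients. -/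
noncomputable def coeffNorm (p : ℝ[X]) : ℝ := p.sum fun _ a => |a|

theorem coeffNorm_eq_sum {p : ℝ[X]} {K : ℕ} (h : p.natDegree < K) :
    coeffNorm p = ∑ x ∈ Finset.range K, |p.coeff x| :=
  p.sum_over_range' (by simp) K h

theorem coeffNorm_nonneg (p : ℝ[X]) : 0 ≤ coeffNorm p :=
  Finset.sum_nonneg fun _ _ => abs_nonneg _

theorem sum_abs_coeff_le (p : ℝ[X]) (s : Finset ℕ) : ∑ x ∈ s, |p.coeff x| ≤ coeffNorm p := by
  classical
  rw [← Finset.sum_filter_add_sum_filter_not s (· ∈ p.support)]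
  have h : ∑ x ∈ s with x ∉ p.support, |p.coeff x| = 0 := by
    refine Finset.sum_eq_zero fun x hx => ?_
    have := (Finset.mem_filter.mp hx).2
    simpa using this
  rw [h, add_zero]
  refine Finset.sum_le_sum_of_subset_of_nonneg (fun x hx => (Finset.mem_filter.mp hx).2)
    fun _ _ _ => abs_nonneg _

theorem abs_coeff_le (p : ℝ[X]) (x : ℕ) : |p.coeff x| ≤ coeffNorm p := by
  simpa using sum_abs_coeff_le p {x}

theorem coeffNorm_zero : coeffNorm 0 = 0 := by simp [coeffNorm]

theorem coeffNorm_neg (p : ℝ[X]) : coeffNorm (-p) = coeffNorm p := by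
  rw [coeffNorm_eq_sum (Nat.lt_succ_self _), coeffNorm_eq_sum (Nat.lt_succ_self _), natDegree_neg]
  simp

theorem coeffNorm_add_le (p q : ℝ[X]) : coeffNorm (p + q) ≤ coeffNorm p + coeffNorm q := by
  have hp : p.natDegree < max p.natDegree q.natDegree + 1 := by omega
  have hq : q.natDegree < max p.natDegree q.natDegree + 1 := by omega
  have hpq : (p + q).natDegree < max p.natDegree q.natDegree + 1 :=
    Nat.lt_succ_of_le (natDegree_add_le p q)
  rw [coeffNorm_eq_sum hp, coeffNorm_eq_sum hq, coeffNorm_eq_sum hpq, ← Finset.sum_add_distrib]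
  refine Finset.sum_le_sum fun x _ => ?_
  rw [coeff_add]
  exact abs_add_le _ _

theorem coeffNorm_sub_le (p q : ℝ[X]) : coeffNorm (p - q) ≤ coeffNorm p + coeffNorm q := by
  rw [sub_eq_add_neg, ← coeffNorm_neg q]
  exact coeffNorm_add_le _ _

theorem coeffNorm_sum_le {ι : Type*} (s : Finset ι) (p : ι → ℝ[X]) :
    coeffNorm (∑ i ∈ s, p i) ≤ ∑ i ∈ s, coeffNorm (p i) := by
  classical
  induction s using Finset.induction_on with
  | empty => simp [coeffNorm_zero]
  | insert a s ha ih =>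
    rw [Finset.sum_insert ha, Finset.sum_insert ha]
    exact (coeffNorm_add_le _ _).trans (by linarith)

theorem coeffNorm_monomial_mul_le (n : ℕ) (a : ℝ) (q : ℝ[X]) :
    coeffNorm (monomial n a * q) ≤ |a| * coeffNorm q := by
  have h1 : (monomial n a * q).natDegree < n + (q.natDegree + 1) := by
    have h2 := natDegree_mul_le (p := monomial n a) (q := q)
    have h3 := natDegree_monomial_le a (m := n)
    omega
  rw [coeffNorm_eq_sum h1, Finset.sum_range_add, coeffNorm_eq_sum (Nat.lt_succ_self _),
    Finset.mul_sum]
  have h4 : ∑ x ∈ Finset.range n, |(monomial n a * q).coeff x| = 0 := by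
    refine Finset.sum_eq_zero fun x hx => ?_
    rw [← C_mul_X_pow_eq_monomial, mul_assoc, coeff_C_mul, coeff_X_pow_mul',
      if_neg (by simpa using hx)]
    simp
  rw [h4, zero_add]
  refine Finset.sum_le_sum fun x _ => ?_
  rw [← C_mul_X_pow_eq_monomial, mul_assoc, coeff_C_mul, add_comm n x, coeff_X_pow_mul, abs_mul]

theorem coeffNorm_mul_le (p q : ℝ[X]) : coeffNorm (p * q) ≤ coeffNorm p * coeffNorm q := by
  conv_lhs => rw [p.as_sum_range, Finset.sum_mul]
  refine (coeffNorm_sum_le _ _).trans ?_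
  rw [coeffNorm_eq_sum (p := p) (Nat.lt_succ_self _), Finset.sum_mul]
  exact Finset.sum_le_sum fun x _ => coeffNorm_monomial_mul_le _ _ _

theorem coeffNorm_C_mul_le (a : ℝ) (p : ℝ[X]) : coeffNorm (C a * p) ≤ |a| * coeffNorm p := by
  rw [← monomial_zero_left]
  exact coeffNorm_monomial_mul_le _ _ _

theorem coeffNorm_C_mul {a : ℝ} (ha : 0 < a) (p : ℝ[X]) : coeffNorm (C a * p) = a * coeffNorm p := by
  apply le_antisymm
  · simpa [abs_of_pos ha] using coeffNorm_C_mul_le a p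
  · have h := coeffNorm_C_mul_le a⁻¹ (C a * p)
    rw [← mul_assoc, ← C_mul, inv_mul_cancel₀ ha.ne', C_1, one_mul, abs_of_pos (inv_pos.mpr ha)] at h
    rwa [← le_inv_mul_iff₀ ha]

theorem coeffNorm_X_pow_le (n : ℕ) : coeffNorm (X ^ n) ≤ 1 := by
  have h := coeffNorm_monomial_mul_le n 1 1
  have h1 : coeffNorm (1 : ℝ[X]) = 1 := by
    rw [coeffNorm_eq_sum (K := 1) (by simp)]
    simp
  simpa [h1, ← X_pow_eq_monomial] using h

theorem IsProbPoly.coeffNorm_eq_one {k : ℕ} {q : ℝ[X]} (hq : IsProbPoly k q) :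
    coeffNorm q = 1 := by
  rw [coeffNorm_eq_sum hq.natDegree_lt, ← hq.sum_coeff]
  exact Finset.sum_congr rfl fun x _ => abs_of_nonneg (hq.coeff_nonneg x)

section ProductExpansion

variable {ι : Type*} [DecidableEq ι] {B D : ι → ℝ[X]} {δ : ℝ}

theorem coeffNorm_prod_le (s : Finset ι) (hB : ∀ i ∈ s, coeffNorm (B i) ≤ 1) :
    coeffNorm (∏ i ∈ s, B i) ≤ 1 := by
  induction s using Finset.induction_on with
  | empty =>
    have := coeffNorm_X_pow_le 0
    simpa using this
  | insert a s ha ih =>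
    rw [Finset.prod_insert ha]
    refine (coeffNorm_mul_le _ _).trans ?_
    exact mul_le_one₀ (hB a (by simp)) (coeffNorm_nonneg _) (ih fun i hi => hB i (by simp [hi]))

theorem coeffNorm_prod_add_sub_prod_le (s : Finset ι) (hB : ∀ i ∈ s, coeffNorm (B i) ≤ 1)
    (hD : ∀ i ∈ s, coeffNorm (D i) ≤ δ) :
    coeffNorm (∏ i ∈ s, (B i + D i) - ∏ i ∈ s, B i) ≤ (1 + δ) ^ s.card - 1 := by
  induction s using Finset.induction_on with
  | empty => simp [coeffNorm_zero]
  | insert a s ha ih =>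
    have ih' := ih (fun i hi => hB i (by simp [hi])) fun i hi => hD i (by simp [hi])
    have hBa := hB a (by simp)
    have hDa := hD a (by simp)
    have hδ : 0 ≤ δ := (coeffNorm_nonneg _).trans hDa
    have hP := coeffNorm_prod_le s fun i hi => hB i (by simp [hi])
    rw [Finset.prod_insert ha, Finset.prod_insert ha, Finset.card_insert_of_notMem ha]
    have h : (B a + D a) * ∏ i ∈ s, (B i + D i) - B a * ∏ i ∈ s, B i =
        (B a + D a) * (∏ i ∈ s, (B i + D i) - ∏ i ∈ s, B i) + D a * ∏ i ∈ s, B i := by ring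
    rw [h]
    refine (coeffNorm_add_le _ _).trans ?_
    have h1 := (coeffNorm_mul_le (B a + D a) (∏ i ∈ s, (B i + D i) - ∏ i ∈ s, B i)).trans
      (mul_le_mul ((coeffNorm_add_le _ _).trans (add_le_add hBa hDa)) ih' (coeffNorm_nonneg _)
        (by linarith))
    have h2 := (coeffNorm_mul_le (D a) (∏ i ∈ s, B i)).trans
      (mul_le_mul hDa hP (coeffNorm_nonneg _) hδ)
    rw [pow_succ]
    linarith

/-- The norm is submultiplicative, so terms of order at least two in the perturbations are majorised
by the same terms in the expansion of `(1 + δ) ^ card`. -/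
theorem coeffNorm_prod_add_remainder_le (s : Finset ι) (hB : ∀ i ∈ s, coeffNorm (B i) ≤ 1)
    (hD : ∀ i ∈ s, coeffNorm (D i) ≤ δ) :
    coeffNorm (∏ i ∈ s, (B i + D i) - ∏ i ∈ s, B i - ∑ i ∈ s, D i * ∏ j ∈ s.erase i, B j) ≤
      (1 + δ) ^ s.card - 1 - s.card * δ := by
  induction s using Finset.induction_on with
  | empty => simp [coeffNorm_zero]
  | insert a s ha ih =>
    have ih' := ih (fun i hi => hB i (by simp [hi])) fun i hi => hD i (by simp [hi])
    have hBa := hB a (by simp)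
    have hDa := hD a (by simp)
    have hδ : 0 ≤ δ := (coeffNorm_nonneg _).trans hDa
    have hdiff := coeffNorm_prod_add_sub_prod_le s (fun i hi => hB i (by simp [hi]))
      fun i hi => hD i (by simp [hi])
    rw [Finset.prod_insert ha, Finset.prod_insert ha, Finset.card_insert_of_notMem ha,
      Finset.sum_insert ha, Finset.erase_insert ha]
    have h0 : ∑ i ∈ s, D i * ∏ j ∈ (insert a s).erase i, B j =
        B a * ∑ i ∈ s, D i * ∏ j ∈ s.erase i, B j := by
      rw [Finset.mul_sum]
      refine Finset.sum_congr rfl fun i hi => ?_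
      have hia : a ≠ i := by rintro rfl; exact ha hi
      rw [Finset.erase_insert_of_ne hia, Finset.prod_insert (by simp [ha])]
      ring
    have h : (B a + D a) * ∏ i ∈ s, (B i + D i) - B a * ∏ i ∈ s, B i -
        (D a * ∏ j ∈ s, B j + B a * ∑ i ∈ s, D i * ∏ j ∈ s.erase i, B j) =
        B a * (∏ i ∈ s, (B i + D i) - ∏ i ∈ s, B i - ∑ i ∈ s, D i * ∏ j ∈ s.erase i, B j) +
          D a * (∏ i ∈ s, (B i + D i) - ∏ i ∈ s, B i) := by ring
    rw [h0, h]
    refine (coeffNorm_add_le _ _).trans ?_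
    have h1 := (coeffNorm_mul_le (B a) (∏ i ∈ s, (B i + D i) - ∏ i ∈ s, B i -
      ∑ i ∈ s, D i * ∏ j ∈ s.erase i, B j)).trans
      (mul_le_mul hBa ih' (coeffNorm_nonneg _) zero_le_one)
    have h2 := (coeffNorm_mul_le (D a) (∏ i ∈ s, (B i + D i) - ∏ i ∈ s, B i)).trans
      (mul_le_mul hDa hdiff (coeffNorm_nonneg _) hδ)
    rw [pow_succ]
    push_cast
    linarith

end ProductExpansion

theorem one_add_pow_sub_le {δ : ℝ} (hδ : 0 ≤ δ) {n : ℕ} (h : n * δ ≤ 1) :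
    (1 + δ) ^ n - 1 - n * δ ≤ (n * δ) ^ 2 := by
  have h1 : (1 + δ) ^ n ≤ Real.exp (n * δ) := by
    rw [Real.exp_nat_mul]
    exact pow_le_pow_left₀ (by linarith) (by linarith [Real.add_one_le_exp δ]) n
  have h0 : 0 ≤ n * δ := by positivity
  have h2 := Real.abs_exp_sub_one_sub_id_le (x := n * δ) (by rwa [abs_of_nonneg h0])
  linarith [le_abs_self (Real.exp (n * δ) - 1 - n * δ)]

end PolynomialNorm

/-! ### Sums of Bernoulli variables: where the mass is. -/

section PoissonBinomial

open Polynomial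

/-- The generating polynomial of a Bernoulli distribution. -/
noncomputable def bernoulliPoly (p : ℝ) : ℝ[X] := C (1 - p) + C p * X

theorem coeff_bernoulliPoly_zero (p : ℝ) : (bernoulliPoly p).coeff 0 = 1 - p := by
  simp [bernoulliPoly]

theorem coeff_bernoulliPoly_one (p : ℝ) : (bernoulliPoly p).coeff 1 = p := by
  simp [bernoulliPoly, coeff_C, coeff_one]

theorem coeff_bernoulliPoly_of_two_le (p : ℝ) {x : ℕ} (hx : 2 ≤ x) :
    (bernoulliPoly p).coeff x = 0 := by
  have h1 : x ≠ 0 := by omega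
  have h2 : 1 ≠ x := by omega
  simp [bernoulliPoly, coeff_C, coeff_X, coeff_one, h1, h2]

theorem isProbPoly_bernoulliPoly {p : ℝ} (h0 : 0 ≤ p) (h1 : p ≤ 1) :
    IsProbPoly 2 (bernoulliPoly p) := by
  refine ⟨fun x => ?_, fun x hx => coeff_bernoulliPoly_of_two_le p hx, by simp [bernoulliPoly]⟩
  rcases x with _ | _ | x
  · rw [coeff_bernoulliPoly_zero]; linarith
  · rw [coeff_bernoulliPoly_one]; exact h0
  · rw [coeff_bernoulliPoly_of_two_le p (by omega)]

theorem polyVar_bernoulliPoly (p : ℝ) : polyVar (bernoulliPoly p) = p * (1 - p) := by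
  simp [polyVar, bernoulliPoly]
  ring

theorem charEnergy_bernoulliPoly {p : ℝ} (h0 : 0 ≤ p) (h1 : p ≤ 1) (ξ : ℝ) :
    charEnergy (bernoulliPoly p) ξ = p * (1 - p) * (1 - Real.cos (2 * Real.pi * ξ)) := by
  have h := (isProbPoly_bernoulliPoly h0 h1).charEnergy_eq ξ
  simp only [Finset.sum_range_succ, Finset.sum_range_zero, coeff_bernoulliPoly_zero,
    coeff_bernoulliPoly_one] at h
  have h2 : Real.cos (2 * Real.pi * (((0 : ℕ) : ℝ) - ((1 : ℕ) : ℝ)) * ξ) =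
      Real.cos (2 * Real.pi * ξ) := by
    rw [← Real.cos_neg]; congr 1; push_cast; ring
  have h3 : Real.cos (2 * Real.pi * (((1 : ℕ) : ℝ) - ((0 : ℕ) : ℝ)) * ξ) =
      Real.cos (2 * Real.pi * ξ) := by
    congr 1; push_cast; ring
  rw [h2, h3] at h
  simp at h
  linarith

/-- Generating polynomial of the sum of independent Bernoulli variables. -/
noncomputable def bernoulliProd (p : ℕ → ℝ) (N : ℕ) : ℝ[X] :=
  ∏ i ∈ Finset.range N, bernoulliPoly (p i)

variable {p : ℕ → ℝ} {N : ℕ}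

theorem isProbPoly_bernoulliProd (hp : ∀ i < N, 1 / 4 ≤ p i ∧ p i ≤ 3 / 4) :
    IsProbPoly (N + 1) (bernoulliProd p N) := by
  have h := IsProbPoly.prod (Finset.range N) (k := 1) (q := fun i => bernoulliPoly (p i))
    fun i hi => by
      have := hp i (by simpa using hi)
      exact isProbPoly_bernoulliPoly (by linarith) (by linarith)
  simpa [bernoulliProd] using h

/-- A coefficient is at most the integral of the modulus of the characteristic function, and `p (1 -
p) ≥ 3 / 16` on the allowed range. -/
theorem coeff_bernoulliProd_le (hN : 1 ≤ N) (hp : ∀ i < N, 1 / 4 ≤ p i ∧ p i ≤ 3 / 4) (x : ℕ) :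
    (bernoulliProd p N).coeff x ≤ 3 / (2 * Real.sqrt N) := by
  have hW := isProbPoly_bernoulliProd hp
  have hN0 : (0 : ℝ) < N := by exact_mod_cast hN
  set a : ℝ := 3 / 16 * N with ha
  have ha0 : 0 < a := by positivity
  have h1 : ‖circleCoeff (polyChar (bernoulliProd p N)) x‖ ≤
      ∫ ξ in (0 : ℝ)..1, Real.exp (-a * (1 - Real.cos (2 * Real.pi * (1 : ℕ) * ξ))) := by
    rw [circleCoeff]
    refine intervalIntegral.norm_integral_le_of_norm_le zero_le_one (Filter.Eventually.of_forall
      fun ξ _ => ?_) (Continuous.intervalIntegrable (by fun_prop) _ _)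
    have h2 := norm_polyChar_prod_le (Finset.range N) (q := fun i => bernoulliPoly (p i)) ξ
    have h3 : a * (1 - Real.cos (2 * Real.pi * (1 : ℕ) * ξ)) ≤
        ∑ i ∈ Finset.range N, charEnergy (bernoulliPoly (p i)) ξ := by
      have h4 : ∀ i ∈ Finset.range N, 3 / 16 * (1 - Real.cos (2 * Real.pi * ξ)) ≤
          charEnergy (bernoulliPoly (p i)) ξ := by
        intro i hi
        obtain ⟨h5, h6⟩ := hp i (by simpa using hi)
        rw [charEnergy_bernoulliPoly (by linarith) (by linarith)]
        exact mul_le_mul_of_nonneg_right (by nlinarith)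
          (by linarith [Real.cos_le_one (2 * Real.pi * ξ)])
      have h7 := Finset.sum_le_sum h4
      simp only [Finset.sum_const, Finset.card_range, nsmul_eq_mul] at h7
      simp only [Nat.cast_one, mul_one, ha]
      linarith
    have h8 : ‖polyChar (bernoulliProd p N) ξ‖ ≤
        Real.exp (-a * (1 - Real.cos (2 * Real.pi * (1 : ℕ) * ξ))) :=
      h2.trans (Real.exp_le_exp.mpr (by linarith))
    refine le_trans (le_of_eq ?_) h8
    rw [norm_mul, Complex.norm_exp_ofReal_mul_I, one_mul]
  rw [circleCoeff_polyChar hW x, Complex.norm_real, Real.norm_eq_abs,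
    abs_of_nonneg (hW.coeff_nonneg x)] at h1
  refine (h1.trans (integral_exp_cos_le ha0 le_rfl)).trans ?_
  rw [Real.sqrt_le_left (by positivity), div_pow, mul_pow, Real.sq_sqrt hN0.le, ha]
  have h9 := Real.pi_lt_d2
  rw [div_le_div_iff₀ (by positivity) (by positivity)]
  nlinarith

theorem polyVar_bernoulliProd_le (p : ℕ → ℝ) (N : ℕ) :
    polyVar (bernoulliProd p N) ≤ N / 4 := by
  rw [bernoulliProd, polyVar_prod _ fun i _ => by simp [bernoulliPoly]]
  have h : ∀ i ∈ Finset.range N, polyVar (bernoulliPoly (p i)) ≤ 1 / 4 := fun i _ => by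
    rw [polyVar_bernoulliPoly]
    nlinarith [sq_nonneg (p i - 1 / 2)]
  refine (Finset.sum_le_sum h).trans (le_of_eq ?_)
  simp
  ring

theorem card_filter_abs_sub_le (K : ℕ) (μ : ℝ) {w : ℝ} (hw : 0 ≤ w) :
    (((Finset.range K).filter fun x : ℕ => |(x : ℝ) - μ| ≤ w).card : ℝ) ≤ 2 * w + 1 := by
  have h1 : ((Finset.range K).filter fun x : ℕ => |(x : ℝ) - μ| ≤ w).card ≤
      (Finset.Icc ⌈μ - w⌉ ⌊μ + w⌋).card := by
    refine Finset.card_le_card_of_injOn (fun x : ℕ => (x : ℤ)) (fun x hx => ?_)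
      fun _ _ _ _ h => Int.ofNat_inj.mp h
    have h2 := abs_le.mp (Finset.mem_filter.mp hx).2
    simp only [Finset.coe_Icc, Set.mem_Icc, Int.ceil_le, Int.le_floor, Int.cast_natCast]
    constructor <;> linarith
  have h3 : ((Finset.Icc ⌈μ - w⌉ ⌊μ + w⌋).card : ℝ) ≤ 2 * w + 1 := by
    rw [Int.card_Icc]
    have h4 : (((⌊μ + w⌋ + 1 - ⌈μ - w⌉).toNat : ℤ) : ℝ) ≤ 2 * w + 1 := by
      rw [Int.toNat_eq_max]
      push_cast
      refine max_le ?_ (by linarith)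
      linarith [Int.floor_le (μ + w), Int.le_ceil (μ - w)]
    exact_mod_cast h4
  exact (by exact_mod_cast h1 : _ ≤ _).trans h3

/-- By Chebyshev the points within `√N` of the mean, at most `3 √N` of them, carry mass at least `3
/ 4`. The light ones among them carry at most `1 / 4`, so the heavy ones carry `1 / 2`, while each
has mass at most `3 / (2 √N)`. -/
theorem card_heavy_ge (hN : 1 ≤ N) (hp : ∀ i < N, 1 / 4 ≤ p i ∧ p i ≤ 3 / 4) :
    Real.sqrt N / 3 ≤ (((Finset.range (N + 1)).filter fun x =>
      1 / (12 * Real.sqrt N) ≤ (bernoulliProd p N).coeff x).card : ℝ) := by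
  classical
  have hW := isProbPoly_bernoulliProd hp
  set W := bernoulliProd p N with hWd
  have hN0 : (0 : ℝ) < N := by exact_mod_cast hN
  have hr1 : 1 ≤ Real.sqrt N := by
    rw [Real.one_le_sqrt]; exact_mod_cast hN
  set r := Real.sqrt N with hr
  have hr2 : r ^ 2 = N := Real.sq_sqrt hN0.le
  set μ := polyMean W with hμ
  set H := (Finset.range (N + 1)).filter fun x => 1 / (12 * r) ≤ W.coeff x with hH
  set I := (Finset.range (N + 1)).filter fun x : ℕ => |(x : ℝ) - μ| ≤ r with hI
  have hfar : ∑ x ∈ Finset.range (N + 1) with ¬ |((x : ℕ) : ℝ) - μ| ≤ r, W.coeff x ≤ 1 / 4 := by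
    have h1 : ∑ x ∈ Finset.range (N + 1) with ¬ |((x : ℕ) : ℝ) - μ| ≤ r, W.coeff x * N ≤ polyVar W := by
      rw [hW.polyVar_eq, ← Finset.sum_filter_add_sum_filter_not (Finset.range (N + 1))
        fun x : ℕ => |(x : ℝ) - μ| ≤ r]
      have h2 : 0 ≤ ∑ x ∈ Finset.range (N + 1) with |((x : ℕ) : ℝ) - μ| ≤ r,
          W.coeff x * ((x : ℝ) - μ) ^ 2 :=
        Finset.sum_nonneg fun x _ => mul_nonneg (hW.coeff_nonneg x) (sq_nonneg _)
      have h3 : ∑ x ∈ Finset.range (N + 1) with ¬ |((x : ℕ) : ℝ) - μ| ≤ r, W.coeff x * N ≤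
          ∑ x ∈ Finset.range (N + 1) with ¬ |((x : ℕ) : ℝ) - μ| ≤ r,
            W.coeff x * ((x : ℝ) - μ) ^ 2 := by
        refine Finset.sum_le_sum fun x hx => mul_le_mul_of_nonneg_left ?_ (hW.coeff_nonneg x)
        have h4 := not_le.mp (Finset.mem_filter.mp hx).2
        rw [← hr2, ← sq_abs ((x : ℝ) - μ)]
        exact pow_le_pow_left₀ (by linarith) h4.le 2
      linarith
    rw [← Finset.sum_mul] at h1
    have h5 := h1.trans (polyVar_bernoulliProd_le p N)
    exact le_of_mul_le_mul_right (by linarith) hN0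
  have htot := hW.sum_coeff
  rw [← Finset.sum_filter_add_sum_filter_not (Finset.range (N + 1))
    fun x : ℕ => |(x : ℝ) - μ| ≤ r] at htot
  have hIH : ∑ x ∈ I, W.coeff x ≤ H.card * (3 / (2 * r)) + I.card * (1 / (12 * r)) := by
    rw [← Finset.sum_filter_add_sum_filter_not I (· ∈ H)]
    refine add_le_add ?_ ?_
    · refine (Finset.sum_le_card_nsmul _ _ (3 / (2 * r)) fun x _ =>
        coeff_bernoulliProd_le hN hp x).trans ?_
      rw [nsmul_eq_mul]
      refine mul_le_mul_of_nonneg_right ?_ (by positivity)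
      exact_mod_cast Finset.card_le_card fun x hx => (Finset.mem_filter.mp hx).2
    · refine (Finset.sum_le_card_nsmul _ _ (1 / (12 * r)) fun x hx => ?_).trans ?_
      · by_contra! h
        refine (Finset.mem_filter.mp hx).2 ?_
        rw [hH, Finset.mem_filter]
        exact ⟨(Finset.mem_filter.mp (Finset.mem_filter.mp hx).1).1, h.le⟩
      · rw [nsmul_eq_mul]
        refine mul_le_mul_of_nonneg_right ?_ (by positivity)
        exact_mod_cast Finset.card_le_card (Finset.filter_subset _ _)
  have hIc : (I.card : ℝ) ≤ 3 * r :=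
    (card_filter_abs_sub_le (N + 1) μ (by linarith)).trans (by linarith)
  have h7 : (I.card : ℝ) * (1 / (12 * r)) ≤ 1 / 4 := by
    rw [mul_one_div, div_le_iff₀ (by positivity)]
    linarith
  have h8 : 1 / 2 ≤ (H.card : ℝ) * (3 / (2 * r)) := by linarith
  rw [← mul_div_assoc, le_div_iff₀ (by positivity)] at h8
  linarith

theorem bernoulliProd_succ (p : ℕ → ℝ) (N : ℕ) :
    bernoulliProd p (N + 1) = bernoulliProd p N * bernoulliPoly (p N) :=
  Finset.prod_range_succ _ _

theorem coeff_bernoulliProd_succ_ge (hp : ∀ i < N + 1, 1 / 4 ≤ p i ∧ p i ≤ 3 / 4) (x : ℕ) :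
    (bernoulliProd p N).coeff x / 4 ≤ (bernoulliProd p (N + 1)).coeff x ∧
      (bernoulliProd p N).coeff x / 4 ≤ (bernoulliProd p (N + 1)).coeff (x + 1) := by
  have hW := isProbPoly_bernoulliProd fun i hi => hp i (Nat.lt_succ_of_lt hi)
  obtain ⟨h1, h2⟩ := hp N (Nat.lt_succ_self N)
  have h3 : bernoulliProd p (N + 1) =
      C (1 - p N) * bernoulliProd p N + C (p N) * (bernoulliProd p N * X) := by
    rw [bernoulliProd_succ, bernoulliPoly]; ring
  rw [h3]
  constructor
  · rw [coeff_add, coeff_C_mul, coeff_C_mul]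
    have h4 : 0 ≤ (bernoulliProd p N * X).coeff x := by
      rcases x with _ | x
      · simp
      · rw [coeff_mul_X]; exact hW.coeff_nonneg x
    nlinarith [hW.coeff_nonneg x]
  · rw [coeff_add, coeff_C_mul, coeff_C_mul, coeff_mul_X]
    nlinarith [hW.coeff_nonneg x, hW.coeff_nonneg (x + 1)]

theorem coeff_bernoulliProd_ge (hp : ∀ i < N, 1 / 4 ≤ p i ∧ p i ≤ 3 / 4) {x : ℕ} (hx : x ≤ N) :
    (1 / 4) ^ N ≤ (bernoulliProd p N).coeff x := by
  induction N generalizing x with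
  | zero =>
    obtain rfl : x = 0 := by omega
    simp [bernoulliProd]
  | succ N ih =>
    have ih' := @ih fun i hi => hp i (Nat.lt_succ_of_lt hi)
    have h := coeff_bernoulliProd_succ_ge hp
    rw [pow_succ]
    rcases x with _ | x
    · linarith [ih' (x := 0) (by omega), (h 0).1]
    · linarith [ih' (x := x) (by omega), (h x).2]

/-- Many adjacent pairs of values have large probability. -/
theorem exists_separated_heavy (hN : 1 ≤ N) (hp : ∀ i < N + 1, 1 / 4 ≤ p i ∧ p i ≤ 3 / 4) :
    ∃ Q : Finset ℕ, Q ⊆ Finset.range (N + 1) ∧ (∀ q ∈ Q, q + 1 ∉ Q) ∧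
      Real.sqrt N / 6 ≤ Q.card ∧ ∀ q ∈ Q,
        1 / (48 * Real.sqrt N) ≤ (bernoulliProd p (N + 1)).coeff q ∧
        1 / (48 * Real.sqrt N) ≤ (bernoulliProd p (N + 1)).coeff (q + 1) := by
  classical
  have h1 := card_heavy_ge hN fun i hi => hp i (Nat.lt_succ_of_lt hi)
  set H := (Finset.range (N + 1)).filter fun x =>
      1 / (12 * Real.sqrt N) ≤ (bernoulliProd p N).coeff x with hH
  have hheavy : ∀ q ∈ H, 1 / (48 * Real.sqrt N) ≤ (bernoulliProd p (N + 1)).coeff q ∧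
        1 / (48 * Real.sqrt N) ≤ (bernoulliProd p (N + 1)).coeff (q + 1) := by
    intro q hq
    have h2 := (Finset.mem_filter.mp hq).2
    have h3 := coeff_bernoulliProd_succ_ge hp q
    have h4 : 1 / (48 * Real.sqrt N) = 1 / (12 * Real.sqrt N) / 4 := by
      rw [div_div]; congr 1; ring
    rw [h4]
    constructor <;> linarith
  have h5 : ((H.filter Even).card : ℝ) + ((H.filter fun x => ¬ Even x).card : ℝ) = H.card := by
    exact_mod_cast Finset.card_filter_add_card_filter_not (s := H) Even
  have hsub : H ⊆ Finset.range (N + 1) := Finset.filter_subset _ _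
  -- The more numerous parity class keeps half of the heavy points and contains no two consecutive
  -- ones. One more Bernoulli factor makes both `q` and `q + 1` heavy, at the cost of a factor `4`.
  by_cases h6 : Real.sqrt N / 6 ≤ (H.filter Even).card
  · refine ⟨H.filter Even, (Finset.filter_subset _ _).trans hsub, fun q hq hq' => ?_, h6,
      fun q hq => hheavy q (Finset.mem_filter.mp hq).1⟩
    have h7 := (Finset.mem_filter.mp hq).2
    have h8 := (Finset.mem_filter.mp hq').2
    rw [Nat.even_add_one] at h8
    exact h8 h7
  · refine ⟨H.filter fun x => ¬ Even x, (Finset.filter_subset _ _).trans hsub, fun q hq hq' => ?_,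
      by linarith, fun q hq => hheavy q (Finset.mem_filter.mp hq).1⟩
    have h7 := (Finset.mem_filter.mp hq).2
    have h8 := (Finset.mem_filter.mp hq').2
    rw [Nat.even_add_one] at h8
    exact h8 h7

end PoissonBinomial

/-! ### Expanding monomials in products that omit one Bernoulli factor. -/

section LagrangeExpansion

open Polynomial

/-- On either side of `i` the product is `a ^ m / m!` for some `m`, which is at most `exp a`. -/
theorem prod_erase_div_abs_sub_le {a : ℝ} (ha : 0 ≤ a) {i n : ℕ} (hi : i < n) :
    ∏ j ∈ (Finset.range n).erase i, a / |(i : ℝ) - j| ≤ Real.exp (2 * a) := by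
  have hfac : ∀ m : ℕ, ∏ j ∈ Finset.range m, a / ((j : ℝ) + 1) ≤ Real.exp a := by
    intro m
    rw [Finset.prod_div_distrib, Finset.prod_const, Finset.card_range]
    have h : ∏ j ∈ Finset.range m, ((j : ℝ) + 1) = (m.factorial : ℝ) := by
      rw [← Finset.prod_range_add_one_eq_factorial]
      push_cast
      rfl
    rw [h]
    exact Real.pow_div_factorial_le_exp a ha m
  have hpos : ∀ m : ℕ, 0 ≤ ∏ j ∈ Finset.range m, a / ((j : ℝ) + 1) := fun m =>
    Finset.prod_nonneg fun j _ => by positivity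
  have hsplit : (Finset.range n).erase i = Finset.range i ∪ Finset.Ico (i + 1) n := by
    ext j
    simp only [Finset.mem_erase, Finset.mem_range, Finset.mem_union, Finset.mem_Ico]
    omega
  have hdisj : Disjoint (Finset.range i) (Finset.Ico (i + 1) n) := by
    rw [Finset.disjoint_left]
    intro j h1 h2
    simp only [Finset.mem_range, Finset.mem_Ico] at h1 h2
    omega
  have h1 : ∏ j ∈ Finset.range i, a / |(i : ℝ) - j| = ∏ j ∈ Finset.range i, a / ((j : ℝ) + 1) := by
    rw [← Finset.prod_range_reflect (fun j : ℕ => a / ((j : ℝ) + 1))]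
    refine Finset.prod_congr rfl fun j hj => ?_
    have hj' : j + 1 ≤ i := Finset.mem_range.mp hj
    have h2 : ((i - 1 - j : ℕ) : ℝ) = i - 1 - j := by
      rw [Nat.cast_sub (by omega), Nat.cast_sub (by omega)]
      simp
    have h3 : (j : ℝ) + 1 ≤ i := by exact_mod_cast hj'
    rw [h2, abs_of_nonneg (by linarith)]
    congr 1
    ring
  have h2 : ∏ j ∈ Finset.Ico (i + 1) n, a / |(i : ℝ) - j| =
      ∏ j ∈ Finset.range (n - (i + 1)), a / ((j : ℝ) + 1) := by
    rw [Finset.prod_Ico_eq_prod_range]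
    refine Finset.prod_congr rfl fun j _ => ?_
    push_cast
    rw [show (i : ℝ) - (i + 1 + j) = -(j + 1) by ring, abs_neg, abs_of_nonneg (by positivity)]
  rw [hsplit, Finset.prod_union hdisj, h1, h2, two_mul, Real.exp_add]
  exact mul_le_mul (hfac _) (hfac _) (hpos _) (Real.exp_pos _).le

/-- Equally spaced success probabilities in `[1 / 4, 3 / 4]`. -/
noncomputable def spacedProb (n i : ℕ) : ℝ := 1 / 4 + i / (2 * n)

theorem spacedProb_mem {n i : ℕ} (hi : i < n) : 1 / 4 ≤ spacedProb n i ∧ spacedProb n i ≤ 3 / 4 := by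
  have hn : (0 : ℝ) < n := by exact_mod_cast Nat.zero_lt_of_lt hi
  have h1 : (i : ℝ) ≤ n := by exact_mod_cast hi.le
  have h2 : (i : ℝ) / (2 * n) ≤ 1 / 2 := by
    rw [div_le_div_iff₀ (by positivity) (by norm_num)]
    linarith
  have h3 : 0 ≤ (i : ℝ) / (2 * n) := by positivity
  rw [spacedProb]
  constructor <;> linarith

theorem spacedProb_sub (n i j : ℕ) :
    spacedProb n i - spacedProb n j = ((i : ℝ) - j) / (2 * n) := by
  rw [spacedProb, spacedProb]
  ring

/-- The powers `1, X, …, X ^ (n - 1)` in terms of the products of all but one of the Bernoulli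
factors. -/
theorem exists_X_pow_eq_sum {n : ℕ} (hn : 1 ≤ n) :
    ∃ c : ℕ → ℕ → ℝ, (∀ i < n, ∀ q < n, |c i q| ≤ Real.exp (5 * n)) ∧ ∀ q < n,
      (X : ℝ[X]) ^ q = ∑ i ∈ Finset.range n,
        C (c i q) * ∏ j ∈ (Finset.range n).erase i, bernoulliPoly (spacedProb n j) := by
  have hn0 : (0 : ℝ) < n := by exact_mod_cast hn
  set p := spacedProb n with hp
  have hpos : ∀ i < n, 0 < p i := fun i hi => by linarith [(spacedProb_mem hi).1]
  have hinj : ∀ i j, i ≠ j → p i - p j ≠ 0 := by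
    intro i j hij
    rw [hp, spacedProb_sub]
    have : (i : ℝ) - j ≠ 0 := sub_ne_zero.mpr (by exact_mod_cast hij)
    positivity
  -- The root of the `i`-th Bernoulli polynomial. At `v i` every product that contains this factor
  -- vanishes, so the coefficients are those of Lagrange interpolation at these nodes.
  set v : ℕ → ℝ := fun i => -((1 - p i) / p i) with hv
  have heval : ∀ i < n, ∀ j, (bernoulliPoly (p j)).eval (v i) = (p i - p j) / p i := by
    intro i hi j
    have := (hpos i hi).ne'
    simp only [bernoulliPoly, eval_add, eval_C, eval_mul, eval_X, hv]
    field_simp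
    ring
  refine ⟨fun i q => v i ^ q / ∏ j ∈ (Finset.range n).erase i, ((p i - p j) / p i), ?_, ?_⟩
  · intro i hi q hq
    obtain ⟨h1, h2⟩ := spacedProb_mem hi
    have hv3 : |v i| ≤ 3 := by
      simp only [hv]
      rw [abs_neg, abs_of_nonneg (div_nonneg (by linarith) (hpos i hi).le),
        div_le_iff₀ (hpos i hi)]
      linarith
    have h3 : |v i ^ q| ≤ Real.exp (2 * n) := by
      rw [abs_pow]
      calc |v i| ^ q ≤ 3 ^ q := pow_le_pow_left₀ (abs_nonneg _) hv3 q
        _ ≤ 3 ^ n := pow_le_pow_right₀ (by norm_num) hq.le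
        _ ≤ Real.exp 2 ^ n := pow_le_pow_left₀ (by norm_num)
            (by linarith [Real.add_one_le_exp (2 : ℝ)]) n
        _ = Real.exp (2 * n) := by rw [← Real.exp_nat_mul, mul_comm]
    have h4 : |(∏ j ∈ (Finset.range n).erase i, ((p i - p j) / p i))⁻¹| ≤ Real.exp (3 * n) := by
      rw [← Finset.prod_inv_distrib, Finset.abs_prod]
      -- As `p i ≤ 3 / 4`, each inverse factor `2 n (p i) / |i - j|` is at most `(3 n / 2) / |i -
      -- j|`.
      have h5 := prod_erase_div_abs_sub_le (a := 3 / 2 * n) (by positivity) hi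
      rw [show 2 * (3 / 2 * (n : ℝ)) = 3 * n by ring] at h5
      refine (Finset.prod_le_prod (fun _ _ => abs_nonneg _) fun j hj => ?_).trans h5
      have hij : (i : ℝ) - j ≠ 0 :=
        sub_ne_zero.mpr (by exact_mod_cast (Finset.ne_of_mem_erase hj).symm)
      rw [inv_div, abs_div, abs_of_pos (hpos i hi), hp, spacedProb_sub, abs_div,
        abs_of_pos (by positivity : (0 : ℝ) < 2 * n), div_div_eq_mul_div]
      refine div_le_div_of_nonneg_right ?_ (abs_nonneg _)
      nlinarith
    beta_reduce
    rw [div_eq_mul_inv, abs_mul, show (5 : ℝ) * n = 2 * n + 3 * n by ring, Real.exp_add]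
    exact mul_le_mul h3 h4 (abs_nonneg _) (Real.exp_pos _).le
  · intro q hq
    have hvinj : Set.InjOn v (Finset.range n : Set ℕ) := by
      intro i hi j hj hij
      have hi' := Finset.mem_range.mp (Finset.mem_coe.mp hi)
      have hj' := Finset.mem_range.mp (Finset.mem_coe.mp hj)
      by_contra hne
      refine hinj i j hne ?_
      simp only [hv, neg_inj] at hij
      rw [div_eq_div_iff (hpos i hi').ne' (hpos j hj').ne'] at hij
      linarith
    refine eq_of_degrees_lt_of_eval_index_eq (Finset.range n) hvinj ?_ ?_ ?_
    · rw [degree_X_pow, Finset.card_range]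
      exact_mod_cast hq
    · rw [Finset.card_range, degree_lt_iff_coeff_zero]
      intro m hm
      rw [finsetSum_coeff]
      refine Finset.sum_eq_zero fun i hi => ?_
      have h1 : IsProbPoly (n - 1 + 1) (∏ j ∈ (Finset.range n).erase i, bernoulliPoly (p j)) := by
        have h2 := IsProbPoly.prod ((Finset.range n).erase i) (k := 1)
          (q := fun j => bernoulliPoly (p j)) fun j hj => by
            have := spacedProb_mem (Finset.mem_range.mp (Finset.mem_of_mem_erase hj))
            exact isProbPoly_bernoulliPoly (by linarith [this.1]) (by linarith [this.2])
        rw [Finset.card_erase_of_mem hi, Finset.card_range, mul_one] at h2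
        exact h2
      rw [coeff_C_mul, h1.coeff_eq_zero m (by omega), mul_zero]
    · intro i hi
      have hi' := Finset.mem_range.mp hi
      rw [eval_pow, eval_X, eval_finsetSum, Finset.sum_eq_single i]
      · rw [eval_mul, eval_C, eval_prod, Finset.prod_congr rfl fun j _ => heval i hi' j,
          div_mul_cancel₀]
        rw [Finset.prod_ne_zero_iff]
        intro j hj
        exact div_ne_zero (hinj i j (Finset.ne_of_mem_erase hj).symm) (hpos i hi').ne'
      · intro j hj hji
        rw [eval_mul, eval_prod, Finset.prod_eq_zero (Finset.mem_erase.mpr ⟨hji.symm, hi⟩), mul_zero]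
        rw [heval i hi' i, sub_self, zero_div]
      · exact fun h => absurd hi h

end LagrangeExpansion

/-! ### The perturbed factors and the first order effect of a sign. -/

section Cube

open Polynomial

/-- The positive or the negative part of a real number. -/
noncomputable def signPart (b : Bool) (x : ℝ) : ℝ := if b then max x 0 else max (-x) 0

theorem signPart_nonneg (b : Bool) (x : ℝ) : 0 ≤ signPart b x := by
  unfold signPart; split_ifs <;> exact le_max_right _ _

theorem signPart_le_abs (b : Bool) (x : ℝ) : signPart b x ≤ |x| := by
  unfold signPart
  split_ifs
  · exact max_le (le_abs_self x) (abs_nonneg x)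
  · exact max_le (neg_le_abs x) (abs_nonneg x)

/-- The indicator of `true`. -/
def boolReal (b : Bool) : ℝ := if b then 1 else 0

/-- Both parts are nonnegative, yet switching between them changes the value by the signed number
`x`. This lets signed interpolation coefficients act through perturbations that only add mass away
from `κ`. -/
theorem signPart_sub (a b : Bool) (x : ℝ) :
    signPart a x - signPart b x = (boolReal a - boolReal b) * x := by
  have h : max x 0 - max (-x) 0 = x := by
    rcases le_total 0 x with hx | hx
    · rw [max_eq_left hx, max_eq_right (by linarith)]; ring
    · rw [max_eq_right hx, max_eq_left (by linarith)]; ring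
  cases a <;> cases b <;> simp only [signPart, boolReal, if_true, Bool.false_eq_true, if_false] <;>
    linarith

/-- A mixture of the point mass at `0` and the uniform distribution on `{0, …, κ}`. -/
noncomputable def lazyUniform (κ : ℕ) : ℝ[X] :=
  C (3 / 4) + C (1 / 4) * (C (1 / ((κ : ℝ) + 1)) * ∑ x ∈ Finset.range (κ + 1), X ^ x)

theorem isProbPoly_uniform (κ : ℕ) :
    IsProbPoly (κ + 1) (C (1 / ((κ : ℝ) + 1)) * ∑ x ∈ Finset.range (κ + 1), X ^ x) := by
  have hκ : (0 : ℝ) < (κ : ℝ) + 1 := by positivity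
  have hc : ∀ y, (C (1 / ((κ : ℝ) + 1)) * ∑ x ∈ Finset.range (κ + 1), X ^ x : ℝ[X]).coeff y =
      if y < κ + 1 then 1 / ((κ : ℝ) + 1) else 0 := by
    intro y
    rw [coeff_C_mul, finsetSum_coeff]
    simp only [coeff_X_pow]
    rw [Finset.sum_ite_eq]
    simp
  refine ⟨fun y => ?_, fun y hy => ?_, ?_⟩
  · rw [hc]; split_ifs <;> positivity
  · rw [hc, if_neg (by omega)]
  · rw [eval_mul, eval_C, eval_finsetSum]
    simp
    field_simp

theorem isProbPoly_lazyUniform (κ : ℕ) : IsProbPoly (κ + 1) (lazyUniform κ) := by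
  have h := isProbPoly_uniform κ
  refine ⟨fun y => ?_, fun y hy => ?_, ?_⟩
  · rw [lazyUniform, coeff_add, coeff_C_mul, coeff_C]
    have := h.coeff_nonneg y
    split_ifs <;> positivity
  · rw [lazyUniform, coeff_add, coeff_C_mul, h.coeff_eq_zero y hy, coeff_C, if_neg (by omega)]
    simp
  · rw [lazyUniform, eval_add, eval_C, eval_mul, h.eval_one]
    norm_num

/-- The point mass of weight `3 / 4` dominates the uniform part of weight `1 / 4`, so the extra
factor cannot destroy differences in `ℓ¹`. -/
theorem half_coeffNorm_le_lazyUniform_mul (κ : ℕ) (G : ℝ[X]) :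
    1 / 2 * coeffNorm G ≤ coeffNorm (lazyUniform κ * G) := by
  set V : ℝ[X] := C (1 / ((κ : ℝ) + 1)) * ∑ x ∈ Finset.range (κ + 1), X ^ x with hV
  have h1 : C (3 / 4) * G = lazyUniform κ * G - C (1 / 4) * (V * G) := by
    rw [lazyUniform]; ring
  have h2 := coeffNorm_sub_le (lazyUniform κ * G) (C (1 / 4) * (V * G))
  rw [← h1, coeffNorm_C_mul (by norm_num), coeffNorm_C_mul (by norm_num)] at h2
  have h3 := coeffNorm_mul_le V G
  rw [(isProbPoly_uniform κ).coeffNorm_eq_one] at h3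
  linarith

theorem coeffNorm_lazyUniform_mul_le (κ : ℕ) (G : ℝ[X]) :
    coeffNorm (lazyUniform κ * G) ≤ coeffNorm G := by
  have h := coeffNorm_mul_le (lazyUniform κ) G
  rwa [(isProbPoly_lazyUniform κ).coeffNorm_eq_one, one_mul] at h

/-- The uniform part carries the mass at `κ q` over the whole gap up to `κ (q + 1)`; without it the
stretched distribution would vanish between multiples of `κ`. -/
theorem coeff_lazyUniform_mul_expand_ge {κ : ℕ} (hκ : 1 ≤ κ) {Z : ℝ[X]} (hZ : ∀ x, 0 ≤ Z.coeff x)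
    (q : ℕ) {r : ℕ} (hr : r ≤ κ) :
    Z.coeff q / (4 * (κ + 1)) ≤ (lazyUniform κ * expand ℝ κ Z).coeff (κ * q + r) := by
  have hE : ∀ x, 0 ≤ (expand ℝ κ Z).coeff x := fun x => by
    rw [coeff_expand hκ]
    split_ifs
    · exact hZ _
    · exact le_rfl
  rw [lazyUniform, add_mul, coeff_add, coeff_C_mul, mul_assoc, coeff_C_mul, mul_assoc, coeff_C_mul,
    Finset.sum_mul, finsetSum_coeff]
  have h1 : (X ^ r * expand ℝ κ Z).coeff (κ * q + r) ≤
      ∑ x ∈ Finset.range (κ + 1), (X ^ x * expand ℝ κ Z).coeff (κ * q + r) := by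
    refine Finset.single_le_sum (f := fun x => (X ^ x * expand ℝ κ Z).coeff (κ * q + r))
      (fun x _ => ?_) (Finset.mem_range.mpr (Nat.lt_succ_of_le hr))
    simp only [coeff_X_pow_mul']
    split_ifs
    · exact hE _
    · exact le_rfl
  rw [coeff_X_pow_mul, mul_comm κ q, coeff_expand_mul hκ] at h1
  have h2 : Z.coeff q / (4 * (κ + 1)) = 1 / 4 * (1 / ((κ : ℝ) + 1) * Z.coeff q) := by
    field_simp
  rw [h2]
  have h3 := hE (κ * q + r)
  have h4 : 1 / ((κ : ℝ) + 1) * Z.coeff q ≤ 1 / ((κ : ℝ) + 1) *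
      ∑ x ∈ Finset.range (κ + 1), (X ^ x * expand ℝ κ Z).coeff (κ * q + r) := by
    rw [mul_comm κ q]
    exact mul_le_mul_of_nonneg_left h1 (by positivity)
  linarith

/-- The unperturbed factors. -/
noncomputable def cubeBase (κ : ℕ) (p : ℕ → ℝ) (i : ℕ) : ℝ[X] := expand ℝ κ (bernoulliPoly (p i))

theorem prod_cubeBase (κ : ℕ) (p : ℕ → ℝ) (s : Finset ℕ) :
    ∏ i ∈ s, cubeBase κ p i = expand ℝ κ (∏ i ∈ s, bernoulliPoly (p i)) := by
  simp only [cubeBase, map_prod]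

variable {κ n : ℕ} {Q : Finset ℕ}

/-- The perturbation of the `i`-th factor. -/
noncomputable def cubePert (κ : ℕ) (Q : Finset ℕ) (c : ℕ → ℕ → ℝ) (η : ℝ) (S : Q × Fin κ → Bool)
    (i : ℕ) : ℝ[X] :=
  C η * ∑ j : Q × Fin κ, C (signPart (S j) (c i j.1)) * (X ^ (j.2 : ℕ) - X ^ κ)

/-- Mass is removed only at `κ`, where the unperturbed factor has mass `p i ≥ 1 / 4`; each `X ^ r -
X ^ κ` vanishes at `1`. -/
theorem isProbPoly_cubeBase_add_cubePert (hκ : 1 ≤ κ) {p : ℕ → ℝ} {c : ℕ → ℕ → ℝ} {η Γ : ℝ}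
    {i : ℕ} (hp : 1 / 4 ≤ p i ∧ p i ≤ 3 / 4) (hη : 0 ≤ η) (hc : ∀ q ∈ Q, |c i q| ≤ Γ)
    (hsmall : η * (Fintype.card (Q × Fin κ) * Γ) ≤ 1 / 4) (S : Q × Fin κ → Bool) :
    IsProbPoly (κ + 1) (cubeBase κ p i + cubePert κ Q c η S i) := by
  have hcoeff : ∀ x, (cubePert κ Q c η S i).coeff x = η * ∑ j : Q × Fin κ,
      signPart (S j) (c i j.1) * ((if x = (j.2 : ℕ) then 1 else 0) - if x = κ then 1 else 0) := by
    intro x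
    simp only [cubePert, coeff_C_mul, finsetSum_coeff, coeff_sub, coeff_X_pow]
  refine ⟨fun x => ?_, fun x hx => ?_, ?_⟩
  · rw [coeff_add, hcoeff]
    by_cases hx : x = κ
    · have h1 : (cubeBase κ p i).coeff x = p i := by
        rw [cubeBase, hx, coeff_expand hκ, if_pos dvd_rfl, Nat.div_self hκ, coeff_bernoulliPoly_one]
      have h2 : ∑ j : Q × Fin κ, signPart (S j) (c i j.1) *
          ((if x = (j.2 : ℕ) then 1 else 0) - if x = κ then 1 else 0) ≥
          -(Fintype.card (Q × Fin κ) * Γ) := by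
        have h3 : ∀ j ∈ (Finset.univ : Finset (Q × Fin κ)), -Γ ≤ signPart (S j) (c i j.1) *
            ((if x = (j.2 : ℕ) then 1 else 0) - if x = κ then 1 else 0) := by
          intro j _
          have h4 : x ≠ (j.2 : ℕ) := by have := j.2.isLt; omega
          rw [if_neg h4, if_pos hx]
          linarith [signPart_le_abs (S j) (c i j.1), hc j.1 j.1.2]
        have h5 := Finset.sum_le_sum h3
        simp only [Finset.sum_const, Finset.card_univ, nsmul_eq_mul] at h5
        linarith
      have h6 := mul_le_mul_of_nonneg_left h2 hη
      rw [h1]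
      linarith
    · refine add_nonneg ?_ (mul_nonneg hη (Finset.sum_nonneg fun j _ =>
        mul_nonneg (signPart_nonneg _ _) ?_))
      · rw [cubeBase, coeff_expand hκ]
        split_ifs
        · exact (isProbPoly_bernoulliPoly (by linarith) (by linarith)).coeff_nonneg _
        · exact le_rfl
      · rw [if_neg hx]
        split_ifs <;> norm_num
  · rw [coeff_add, hcoeff, Finset.sum_eq_zero fun j _ => ?_, cubeBase, coeff_expand hκ]
    · split_ifs with h
      · rw [coeff_bernoulliPoly_of_two_le, mul_zero, add_zero]
        obtain ⟨y, rfl⟩ := h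
        rw [Nat.mul_div_cancel_left _ hκ]
        by_contra! hy
        have : κ * y ≤ κ * 1 := Nat.mul_le_mul_left κ (by omega)
        omega
      · simp
    · have := j.2.isLt
      rw [if_neg (by omega), if_neg (by omega)]
      simp
  · rw [eval_add, cubeBase, expand_eval, cubePert]
    simp [eval_finsetSum, bernoulliPoly]

theorem coeffNorm_cubePert_le {c : ℕ → ℕ → ℝ} {η Γ : ℝ} {i : ℕ} (hη : 0 < η)
    (hc : ∀ q ∈ Q, |c i q| ≤ Γ) (S : Q × Fin κ → Bool) :
    coeffNorm (cubePert κ Q c η S i) ≤ 2 * η * (Fintype.card (Q × Fin κ) * Γ) := by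
  rw [cubePert, coeffNorm_C_mul hη]
  have h1 : ∀ j ∈ (Finset.univ : Finset (Q × Fin κ)),
      coeffNorm (C (signPart (S j) (c i j.1)) * (X ^ (j.2 : ℕ) - X ^ κ)) ≤ Γ * 2 := by
    intro j _
    refine (coeffNorm_C_mul_le _ _).trans ?_
    have h2 := coeffNorm_sub_le (X ^ (j.2 : ℕ)) (X ^ κ)
    have h3 := coeffNorm_X_pow_le (j.2 : ℕ)
    have h4 := coeffNorm_X_pow_le κ
    rw [abs_of_nonneg (signPart_nonneg _ _)]
    exact mul_le_mul ((signPart_le_abs _ _).trans (hc _ j.1.2)) (by linarith) (coeffNorm_nonneg _)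
      ((abs_nonneg _).trans (hc _ j.1.2))
  have h5 := (coeffNorm_sum_le _ _).trans (Finset.sum_le_sum h1)
  simp only [Finset.sum_const, Finset.card_univ, nsmul_eq_mul] at h5
  have h6 := mul_le_mul_of_nonneg_left h5 hη.le
  linarith

/-- The first order change of the product along an edge vector of the cube. -/
noncomputable def cubeDiff (κ : ℕ) (Q : Finset ℕ) (S T : Q × Fin κ → Bool) : ℝ[X] :=
  ∑ j : Q × Fin κ, C (boolReal (S j) - boolReal (T j)) *
    (X ^ (κ * j.1 + j.2 : ℕ) - X ^ (κ * (j.1 + 1) : ℕ))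

/-- Summing over the factors, the interpolation identity stretched by `κ` collapses the coefficients
`c i q` to `X ^ (κ q)`. Each sign thus moves mass `η` from `κ (q + 1)` to `κ q + r`, independently
of the other signs. -/
theorem sum_cubePert_sub {p : ℕ → ℝ} {c : ℕ → ℕ → ℝ} {η : ℝ}
    (hc : ∀ q ∈ Q, (X : ℝ[X]) ^ q = ∑ i ∈ Finset.range n,
        C (c i q) * ∏ j ∈ (Finset.range n).erase i, bernoulliPoly (p j)) (S T : Q × Fin κ → Bool) :
    ∑ i ∈ Finset.range n, cubePert κ Q c η S i * ∏ j ∈ (Finset.range n).erase i, cubeBase κ p j -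
      ∑ i ∈ Finset.range n, cubePert κ Q c η T i * ∏ j ∈ (Finset.range n).erase i, cubeBase κ p j =
      C η * cubeDiff κ Q S T := by
  have h1 : ∀ j : Q × Fin κ, (X : ℝ[X]) ^ (κ * (j.1 : ℕ)) = ∑ i ∈ Finset.range n,
      C (c i j.1) * ∏ l ∈ (Finset.range n).erase i, cubeBase κ p l := by
    intro j
    have h2 := congrArg (expand ℝ κ) (hc j.1 j.1.2)
    rw [map_pow, expand_X, map_sum, ← pow_mul] at h2
    rw [h2]
    refine Finset.sum_congr rfl fun i _ => ?_
    rw [map_mul, expand_C, prod_cubeBase]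
  rw [← Finset.sum_sub_distrib, cubeDiff, Finset.mul_sum]
  have h3 : ∀ i ∈ Finset.range n,
      cubePert κ Q c η S i * ∏ j ∈ (Finset.range n).erase i, cubeBase κ p j -
        cubePert κ Q c η T i * ∏ j ∈ (Finset.range n).erase i, cubeBase κ p j =
      ∑ j : Q × Fin κ, C η * (C (boolReal (S j) - boolReal (T j)) * ((X ^ (j.2 : ℕ) - X ^ κ) *
        (C (c i j.1) * ∏ l ∈ (Finset.range n).erase i, cubeBase κ p l))) := by
    intro i _
    rw [cubePert, cubePert, ← sub_mul, ← mul_sub, ← Finset.sum_sub_distrib, Finset.mul_sum,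
      Finset.sum_mul]
    refine Finset.sum_congr rfl fun j _ => ?_
    rw [← sub_mul, ← C_sub, signPart_sub, C_mul]
    ring
  rw [Finset.sum_congr rfl h3, Finset.sum_comm]
  refine Finset.sum_congr rfl fun j _ => ?_
  rw [← Finset.mul_sum, ← Finset.mul_sum, ← Finset.mul_sum, ← h1]
  congr 2
  ring

/-- The positions `κ q + r` are distinct, and none is of the form `κ (q' + 1)` with `q' ∈ Q` because
`Q` has no two consecutive elements. The coefficients there are therefore the differences of the
signs. -/
theorem hamming_le_coeffNorm_cubeDiff (hQ : ∀ q ∈ Q, q + 1 ∉ Q) (S T : Q × Fin κ → Bool) :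
    (hamming S T : ℝ) ≤ coeffNorm (cubeDiff κ Q S T) := by
  classical
  set φ : Q × Fin κ → ℕ := fun j => κ * j.1 + j.2 with hφ
  have hinj : Function.Injective φ := by
    intro j l h
    have hκ : 0 < κ := lt_of_le_of_lt (Nat.zero_le _) j.2.isLt
    have h1 := congrArg (· / κ) h
    have h2 := congrArg (· % κ) h
    simp only [hφ, Nat.mul_add_div hκ, Nat.div_eq_of_lt (Fin.isLt _), add_zero, Nat.mul_add_mod,
      Nat.mod_eq_of_lt (Fin.isLt _)] at h1 h2
    exact Prod.ext (Subtype.ext h1) (Fin.ext h2)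
  have hne : ∀ j l : Q × Fin κ, φ j ≠ κ * (l.1 + 1) := by
    intro j l h
    have hκ : 0 < κ := lt_of_le_of_lt (Nat.zero_le _) j.2.isLt
    have h1 := congrArg (· / κ) h
    simp only [hφ, Nat.mul_add_div hκ, Nat.div_eq_of_lt (Fin.isLt _), add_zero,
      Nat.mul_div_cancel_left _ hκ] at h1
    exact hQ l.1 l.1.2 (h1 ▸ j.1.2)
  have hcoeff : ∀ j, (cubeDiff κ Q S T).coeff (φ j) = boolReal (S j) - boolReal (T j) := by
    intro j
    rw [cubeDiff, finsetSum_coeff, Finset.sum_eq_single j]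
    · rw [coeff_C_mul, coeff_sub, coeff_X_pow, coeff_X_pow, if_pos rfl, if_neg (hne j j)]
      ring
    · intro l _ hl
      have h1 : φ j ≠ κ * l.1 + l.2 := fun h => hl (hinj h).symm
      rw [coeff_C_mul, coeff_sub, coeff_X_pow, coeff_X_pow, if_neg h1, if_neg (hne j l)]
      ring
    · exact fun h => absurd (Finset.mem_univ j) h
  have h1 := sum_abs_coeff_le (cubeDiff κ Q S T) (Finset.univ.image φ)
  rw [Finset.sum_image fun _ _ _ _ h => hinj h] at h1
  refine le_trans (le_of_eq ?_) h1
  rw [hamming, Finset.card_filter]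
  push_cast
  refine Finset.sum_congr rfl fun j _ => ?_
  rw [hcoeff]
  cases S j <;> cases T j <;> simp [boolReal]

theorem cubeDiff_update [DecidableEq (Q × Fin κ)] (S : Q × Fin κ → Bool) (j : Q × Fin κ) :
    cubeDiff κ Q S (Function.update S j (!S j)) =
      C (boolReal (S j) - boolReal (!S j)) *
        (X ^ (κ * j.1 + j.2 : ℕ) - X ^ (κ * (j.1 + 1) : ℕ)) := by
  rw [cubeDiff, Finset.sum_eq_single j]
  · rw [Function.update_self]
  · intro l _ hl
    rw [Function.update_of_ne hl]
    simp
  · exact fun h => absurd (Finset.mem_univ j) h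

theorem abs_boolReal_sub_not (b : Bool) : |boolReal b - boolReal (!b)| = 1 := by
  cases b <;> simp [boolReal]

end Cube

/-! ### The hard family: separation in total variation and closeness in chi-square. -/

section HardFamily

open Polynomial

theorem sum_sq_coeff_le (q : ℝ[X]) (s : Finset ℕ) : ∑ x ∈ s, q.coeff x ^ 2 ≤ coeffNorm q ^ 2 := by
  have h1 : ∀ x ∈ s, q.coeff x ^ 2 ≤ coeffNorm q * |q.coeff x| := fun x _ => by
    rw [← sq_abs, sq]
    exact mul_le_mul_of_nonneg_right (abs_coeff_le q x) (abs_nonneg _)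
  refine (Finset.sum_le_sum h1).trans ?_
  rw [← Finset.mul_sum, sq]
  exact mul_le_mul_of_nonneg_left (sum_abs_coeff_le q s) (coeffNorm_nonneg q)

variable {κ n : ℕ} {Q : Finset ℕ} {p : ℕ → ℝ} {c : ℕ → ℕ → ℝ} {η δ : ℝ}

/-- The generating polynomial of a member of the hard family. -/
noncomputable def cubePoly (κ n : ℕ) (Q : Finset ℕ) (p : ℕ → ℝ) (c : ℕ → ℕ → ℝ) (η : ℝ)
    (S : Q × Fin κ → Bool) : ℝ[X] :=
  lazyUniform κ * ∏ i ∈ Finset.range n, (cubeBase κ p i + cubePert κ Q c η S i)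

/-- The terms of higher order in the expansion of the product. -/
noncomputable def cubeRemainder (κ n : ℕ) (Q : Finset ℕ) (p : ℕ → ℝ) (c : ℕ → ℕ → ℝ) (η : ℝ)
    (S : Q × Fin κ → Bool) : ℝ[X] :=
  ∏ i ∈ Finset.range n, (cubeBase κ p i + cubePert κ Q c η S i) -
    ∏ i ∈ Finset.range n, cubeBase κ p i -
    ∑ i ∈ Finset.range n, cubePert κ Q c η S i * ∏ j ∈ (Finset.range n).erase i, cubeBase κ p j

theorem cubePoly_sub (hc : ∀ q ∈ Q, (X : ℝ[X]) ^ q = ∑ i ∈ Finset.range n,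
      C (c i q) * ∏ j ∈ (Finset.range n).erase i, bernoulliPoly (p j)) (S T : Q × Fin κ → Bool) :
    cubePoly κ n Q p c η S - cubePoly κ n Q p c η T =
      C η * (lazyUniform κ * cubeDiff κ Q S T) + lazyUniform κ *
        (cubeRemainder κ n Q p c η S - cubeRemainder κ n Q p c η T) := by
  have h := sum_cubePert_sub (κ := κ) (p := p) (η := η) hc S T
  have h1 : C η * (lazyUniform κ * cubeDiff κ Q S T) =
      lazyUniform κ * (C η * cubeDiff κ Q S T) := by ring
  rw [h1, ← h, cubePoly, cubePoly, cubeRemainder, cubeRemainder]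
  ring

theorem coeffNorm_cubeBase_le (hκ : 1 ≤ κ) {i : ℕ} (hp : 1 / 4 ≤ p i ∧ p i ≤ 3 / 4) :
    coeffNorm (cubeBase κ p i) ≤ 1 := by
  have h := isProbPoly_cubeBase_add_cubePert (Q := ∅) (c := fun _ _ => 0) (η := 0) (Γ := 0) hκ hp
    le_rfl (by simp) (by simp) (fun _ => true)
  have h1 : cubePert κ ∅ (fun _ _ => 0) 0 (fun _ => true) i = 0 := by simp [cubePert]
  rw [h1, add_zero] at h
  exact h.coeffNorm_eq_one.le

theorem coeffNorm_cubeRemainder_le (hκ : 1 ≤ κ) (hp : ∀ i < n, 1 / 4 ≤ p i ∧ p i ≤ 3 / 4)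
    (S : Q × Fin κ → Bool) (hδ0 : 0 ≤ δ) (hδ : ∀ i < n, coeffNorm (cubePert κ Q c η S i) ≤ δ)
    (hnδ : n * δ ≤ 1) :
    coeffNorm (cubeRemainder κ n Q p c η S) ≤ (n * δ) ^ 2 := by
  have h := coeffNorm_prod_add_remainder_le (B := cubeBase κ p) (D := cubePert κ Q c η S) (δ := δ)
    (Finset.range n) (fun i hi => coeffNorm_cubeBase_le hκ (hp i (Finset.mem_range.mp hi)))
    fun i hi => hδ i (Finset.mem_range.mp hi)
  rw [Finset.card_range] at h
  exact h.trans (one_add_pow_sub_le hδ0 hnδ)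

theorem abs_coeff_cubePoly_sub_le (hκ : 1 ≤ κ) (hp : ∀ i < n, 1 / 4 ≤ p i ∧ p i ≤ 3 / 4)
    (S : Q × Fin κ → Bool) (hδ0 : 0 ≤ δ) (hδ : ∀ i < n, coeffNorm (cubePert κ Q c η S i) ≤ δ)
    (hnδ : n * δ ≤ 1) (x : ℕ) :
    |(cubePoly κ n Q p c η S).coeff x -
      (lazyUniform κ * expand ℝ κ (bernoulliProd p n)).coeff x| ≤ 2 * (n * δ) := by
  have h := coeffNorm_prod_add_sub_prod_le (B := cubeBase κ p) (D := cubePert κ Q c η S) (δ := δ)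
    (Finset.range n) (fun i hi => coeffNorm_cubeBase_le hκ (hp i (Finset.mem_range.mp hi)))
    fun i hi => hδ i (Finset.mem_range.mp hi)
  rw [Finset.card_range] at h
  have h1 := one_add_pow_sub_le hδ0 hnδ
  have h2 : 0 ≤ n * δ := by positivity
  rw [bernoulliProd, ← prod_cubeBase, ← coeff_sub, cubePoly, ← mul_sub]
  refine (abs_coeff_le _ _).trans ((coeffNorm_lazyUniform_mul_le _ _).trans (h.trans ?_))
  nlinarith

theorem tvDist_eq_coeffNorm {K : ℕ} {P P' : ProbabilityMeasure ℕ} {f g : ℝ[X]}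
    (hf : ∀ x, massFun P x = f.coeff x) (hg : ∀ x, massFun P' x = g.coeff x)
    (hK : (f - g).natDegree < K) : tvDist P P' = 1 / 2 * coeffNorm (f - g) := by
  rw [tvDist, coeffNorm_eq_sum hK, tsum_eq_sum (s := Finset.range K)]
  · congr 1
    refine Finset.sum_congr rfl fun x _ => ?_
    rw [coeff_sub, ← hf, ← hg]
    rfl
  · intro x hx
    have h : (f - g).coeff x = 0 := coeff_eq_zero_of_natDegree_lt (by
      have : K ≤ x := by simpa using hx
      omega)
    rw [coeff_sub, ← hf, ← hg] at h
    exact abs_eq_zero.mpr h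

theorem coeff_lazyUniform_mul_X_pow {a x : ℕ} (h : x < a ∨ a + κ < x) :
    (lazyUniform κ * X ^ a).coeff x = 0 := by
  rw [coeff_mul_X_pow']
  split_ifs with h1
  · exact (isProbPoly_lazyUniform κ).coeff_eq_zero _ (by omega)
  · rfl

theorem exists_eq_mul_add (hκ : 1 ≤ κ) {x : ℕ} (hx : x < (n + 1) * κ + 1) :
    ∃ q ≤ n, ∃ r ≤ κ, x = κ * q + r := by
  rcases Nat.lt_or_ge x ((n + 1) * κ) with h | h
  · refine ⟨x / κ, ?_, x % κ, (Nat.mod_lt _ hκ).le, (Nat.div_add_mod x κ).symm⟩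
    exact Nat.lt_succ_iff.mp ((Nat.div_lt_iff_lt_mul hκ).mpr h)
  · exact ⟨n, le_rfl, κ, le_rfl, by linarith [mul_comm κ n]⟩

set_option maxHeartbeats 1000000 in
/-- The hard family: sums of `N + 2` variables with values in `{0, …, κ}`. -/
theorem exists_hard_family {N : ℕ} (hκ : 1 ≤ κ) (hN : 1 ≤ N) :
    ∃ m : ℕ, κ * Real.sqrt N / 6 ≤ m ∧ m ≤ (N + 1) * κ ∧ ∀ η δ : ℝ, 0 < η →
      δ = 2 * η * (m * Real.exp (5 * (N + 1 : ℕ))) →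
      2 * ((N + 1 : ℕ) * δ) ≤ (1 / 4) ^ (N + 1) / (8 * (κ + 1)) →
      16 * (((N + 1 : ℕ) * δ) ^ 2) ^ 2 ≤ (1 / 4) ^ (N + 1) / (4 * (κ + 1)) * η ^ 2 →
      ∃ (J : Type) (_ : Fintype J) (_ : DecidableEq J) (P : (J → Bool) → ProbabilityMeasure ℕ)
        (M : ℕ), Fintype.card J = m ∧ (∀ S, IsSIIRV (N + 2) (κ + 1) (P S)) ∧
        (∀ S x, M ≤ x → massFun (P S) x = 0) ∧ (∀ S, ∀ x < M, 0 < massFun (P S) x) ∧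
        (∀ S j, chiSq M (P S) (P (Function.update S j (!S j))) ≤
          3073 * (η ^ 2 * ((κ + 1) * Real.sqrt N))) ∧
        ∀ S T, η * hamming S T / 4 - ((N + 1 : ℕ) * δ) ^ 2 ≤ tvDist (P S) (P T) := by
  classical
  obtain ⟨c, hcΓ, hcX⟩ := exists_X_pow_eq_sum (n := N + 1) (by omega)
  set n := N + 1 with hn
  set p := spacedProb n with hpdef
  have hp : ∀ i < n, 1 / 4 ≤ p i ∧ p i ≤ 3 / 4 := fun i hi => spacedProb_mem hi
  obtain ⟨Q, hQn, hQsep, hQcard, hQheavy⟩ := exists_separated_heavy hN hp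
  have hcX' : ∀ q ∈ Q, (X : ℝ[X]) ^ q = ∑ i ∈ Finset.range n,
      C (c i q) * ∏ j ∈ (Finset.range n).erase i, bernoulliPoly (p j) :=
    fun q hq => hcX q (Finset.mem_range.mp (hQn hq))
  have hcΓ' : ∀ i < n, ∀ q ∈ Q, |c i q| ≤ Real.exp (5 * n) :=
    fun i hi q hq => hcΓ i hi q (Finset.mem_range.mp (hQn hq))
  have hcard : Fintype.card (Q × Fin κ) = Q.card * κ := by simp
  have hQn' : Q.card ≤ n := by simpa using Finset.card_le_card hQn
  refine ⟨Q.card * κ, ?_, Nat.mul_le_mul_right κ hQn', ?_⟩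
  · push_cast
    have := mul_le_mul_of_nonneg_left hQcard (Nat.cast_nonneg (α := ℝ) κ)
    linarith
  intro η δ hη hδdef hδ1 hδ2
  have hk : (0 : ℝ) < κ + 1 := by positivity
  have hδ0 : 0 ≤ δ := by rw [hδdef]; positivity
  have hn1 : (1 : ℝ) ≤ n := by rw [hn]; push_cast; linarith [Nat.cast_nonneg (α := ℝ) N]
  have hr1 : 1 ≤ Real.sqrt N := by rw [Real.one_le_sqrt]; exact_mod_cast hN
  set r := Real.sqrt N with hr
  have hq4 : (1 / 4 : ℝ) ^ n ≤ 1 := pow_le_one₀ (by norm_num) (by norm_num)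
  have hnδ : 2 * (n * δ) ≤ 1 / 8 := by
    refine hδ1.trans ?_
    rw [div_le_div_iff₀ (by positivity) (by norm_num)]
    nlinarith [Nat.cast_nonneg (α := ℝ) κ]
  have hδ' : ∀ (S : Q × Fin κ → Bool), ∀ i < n, coeffNorm (cubePert κ Q c η S i) ≤ δ := by
    intro S i hi
    have h := coeffNorm_cubePert_le hη (hcΓ' i hi) S
    rw [hcard] at h
    rwa [hδdef]
  have hsmall : η * (Fintype.card (Q × Fin κ) * Real.exp (5 * n)) ≤ 1 / 4 := by
    rw [hcard]
    have : δ ≤ n * δ := le_mul_of_one_le_left hδ0 hn1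
    linarith
  have hfac : ∀ (S : Q × Fin κ → Bool), ∀ i < n,
      IsProbPoly (κ + 1) (cubeBase κ p i + cubePert κ Q c η S i) := fun S i hi =>
    isProbPoly_cubeBase_add_cubePert hκ (hp i hi) hη.le (hcΓ' i hi) hsmall S
  have hPex : ∀ S : Q × Fin κ → Bool, ∃ P, IsSIIRV (n + 1) (κ + 1) P ∧
      ∀ x, massFun P x = (cubePoly κ n Q p c η S).coeff x := by
    intro S
    -- One lazy uniform variable and `n = N + 1` perturbed ones, hence order `N + 2`.
    obtain ⟨P, hP, hPx⟩ := exists_isSIIRV (k := κ + 1) (Fin.cons (lazyUniform κ)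
      (fun i : Fin n => cubeBase κ p i + cubePert κ Q c η S i) : Fin (n + 1) → ℝ[X]) (by
        intro i
        refine Fin.cases ?_ (fun i => ?_) i
        · simpa using isProbPoly_lazyUniform κ
        · simpa using hfac S i i.isLt)
    refine ⟨P, hP, fun x => ?_⟩
    rw [massFun, hPx, Fin.prod_univ_succ, cubePoly]
    simp only [Fin.cons_zero, Fin.cons_succ]
    rw [Fin.prod_univ_eq_prod_range (fun i => cubeBase κ p i + cubePert κ Q c η S i) n]
  choose P hPS hPx using hPex
  have hprob : ∀ S : Q × Fin κ → Bool,
      IsProbPoly ((n + 1) * κ + 1) (cubePoly κ n Q p c η S) := by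
    intro S
    have h1 := IsProbPoly.prod (Finset.range n) fun i hi => hfac S i (Finset.mem_range.mp hi)
    have h2 := (isProbPoly_lazyUniform κ).mul h1
    rw [Finset.card_range] at h2
    rwa [show (n + 1) * κ + 1 = κ + n * κ + 1 by ring]
  set M := (n + 1) * κ + 1 with hM
  set F0 : ℝ[X] := lazyUniform κ * expand ℝ κ (bernoulliProd p n) with hF0
  set Pmin : ℝ := (1 / 4) ^ n / (4 * (κ + 1)) with hPmin
  have hPmin0 : 0 < Pmin := by positivity
  have hZ := isProbPoly_bernoulliProd hp
  have hF0ge : ∀ q s, s ≤ κ → (bernoulliProd p n).coeff q / (4 * (κ + 1)) ≤ F0.coeff (κ * q + s) :=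
    fun q s hs => coeff_lazyUniform_mul_expand_ge hκ hZ.coeff_nonneg q hs
  have hF0min : ∀ x < M, Pmin ≤ F0.coeff x := by
    intro x hx
    obtain ⟨q, hq, s, hs, rfl⟩ := exists_eq_mul_add hκ hx
    refine le_trans ?_ (hF0ge q s hs)
    exact div_le_div_of_nonneg_right (coeff_bernoulliProd_ge hp hq) (by positivity)
  -- The perturbation is at most half of the smallest mass of the base distribution, so base masses
  -- serve as denominators for every member of the family.
  have hhalf : ∀ S, ∀ x < M, F0.coeff x / 2 ≤ massFun (P S) x := by
    intro S x hx
    have h1 := abs_coeff_cubePoly_sub_le hκ hp S hδ0 (hδ' S) (by linarith) x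
    have h2 := (abs_le.mp h1).1
    have h3 := hF0min x hx
    have h4 : (1 / 4 : ℝ) ^ n / (8 * (κ + 1)) = Pmin / 2 := by
      rw [hPmin, div_div]; congr 1; ring
    rw [h4] at hδ1
    rw [hPx]
    linarith
  have hpos : ∀ S, ∀ x < M, 0 < massFun (P S) x := fun S x hx =>
    lt_of_lt_of_le (by linarith [hF0min x hx]) (hhalf S x hx)
  have hrem : ∀ S T, coeffNorm (lazyUniform κ *
      (cubeRemainder κ n Q p c η S - cubeRemainder κ n Q p c η T)) ≤ 2 * (n * δ) ^ 2 := by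
    intro S T
    have h1 := coeffNorm_cubeRemainder_le hκ hp S hδ0 (hδ' S) (by linarith)
    have h2 := coeffNorm_cubeRemainder_le hκ hp T hδ0 (hδ' T) (by linarith)
    exact (coeffNorm_lazyUniform_mul_le _ _).trans ((coeffNorm_sub_le _ _).trans (by linarith))
  refine ⟨Q × Fin κ, inferInstance, inferInstance, P, M, hcard, hPS, fun S x hx => ?_, hpos, ?_, ?_⟩
  · rw [hPx]
    exact (hprob S).coeff_eq_zero x hx
  · intro S j
    set T := Function.update S j (!S j) with hT
    set u : ℝ[X] := C η * (lazyUniform κ * cubeDiff κ Q S T) with hu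
    set v : ℝ[X] := lazyUniform κ *
      (cubeRemainder κ n Q p c η S - cubeRemainder κ n Q p c η T) with hv
    have hdec : ∀ x, massFun (P S) x - massFun (P T) x = u.coeff x + v.coeff x := by
      intro x
      rw [hPx, hPx, ← coeff_sub, cubePoly_sub hcX', coeff_add]
    have hunorm : coeffNorm u ≤ 2 * η := by
      have h1 : coeffNorm (cubeDiff κ Q S T) ≤ 2 := by
        rw [hT, cubeDiff_update]
        refine (coeffNorm_C_mul_le _ _).trans ?_
        rw [abs_boolReal_sub_not, one_mul]
        exact (coeffNorm_sub_le _ _).trans (by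
          linarith [coeffNorm_X_pow_le (κ * j.1 + j.2 : ℕ),
            coeffNorm_X_pow_le (κ * (j.1 + 1) : ℕ)])
      rw [hu, coeffNorm_C_mul hη]
      have h2 := (coeffNorm_lazyUniform_mul_le κ (cubeDiff κ Q S T)).trans h1
      nlinarith
    -- The first order part is smeared by the lazy uniform factor over the two blocks starting at `κ
    -- q` and `κ (q + 1)`, both of which are heavy by the choice of `Q`.
    have husupp : ∀ x, u.coeff x = 0 ∨ 1 / (384 * ((κ + 1) * r)) ≤ F0.coeff x / 2 := by
      intro x
      have hconst : 1 / (384 * (((κ : ℝ) + 1) * r)) = 1 / (48 * r) / (4 * (κ + 1)) / 2 := by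
        rw [div_div, div_div]; congr 1; ring
      rw [hconst]
      have hj := j.2.isLt
      have hmul : κ * ((j.1 : ℕ) + 1) = κ * j.1 + κ := by ring
      by_cases h1 : κ * (j.1 : ℕ) ≤ x ∧ x ≤ κ * (j.1 + 1 : ℕ) + κ
      · right
        refine div_le_div_of_nonneg_right ?_ (by norm_num)
        obtain ⟨hq1, hq2⟩ := hQheavy j.1 j.1.2
        rcases Nat.lt_or_ge x (κ * (j.1 + 1 : ℕ)) with h2 | h2
        · obtain ⟨s, rfl⟩ := Nat.exists_eq_add_of_le h1.1
          exact (div_le_div_of_nonneg_right hq1 (by positivity)).trans (hF0ge _ s (by omega))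
        · obtain ⟨s, rfl⟩ := Nat.exists_eq_add_of_le h2
          exact (div_le_div_of_nonneg_right hq2 (by positivity)).trans (hF0ge _ s (by omega))
      · left
        have h2 : u = C η * (C (boolReal (S j) - boolReal (!S j)) *
            (lazyUniform κ * X ^ (κ * j.1 + j.2 : ℕ) -
              lazyUniform κ * X ^ (κ * (j.1 + 1) : ℕ))) := by
          rw [hu, hT, cubeDiff_update]; ring
        rw [h2, coeff_C_mul, coeff_C_mul, coeff_sub, coeff_lazyUniform_mul_X_pow (by omega),
          coeff_lazyUniform_mul_X_pow (by omega)]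
        simp
    -- The first order part `u` is divided by heavy masses, the remainder `v` by the exponentially
    -- small minimum `Pmin`, which it can afford.
    have hterm : ∀ x ∈ Finset.range M, (massFun (P S) x - massFun (P T) x) ^ 2 / massFun (P T) x ≤
        768 * ((κ + 1) * r) * u.coeff x ^ 2 + 4 / Pmin * v.coeff x ^ 2 := by
      intro x hx
      have hx' := Finset.mem_range.mp hx
      have hpx := hpos T x hx'
      have hhx := hhalf T x hx'
      have hmin := hF0min x hx'
      rw [hdec]
      have h1 : u.coeff x ^ 2 / massFun (P T) x ≤ 384 * ((κ + 1) * r) * u.coeff x ^ 2 := by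
        rcases husupp x with h2 | h2
        · rw [h2]; simp
        · rw [div_le_iff₀ hpx]
          have h3 : 1 ≤ 384 * ((κ + 1) * r) * massFun (P T) x := by
            rw [← div_le_iff₀' (by positivity)]
            exact h2.trans hhx
          nlinarith [sq_nonneg (u.coeff x)]
      have h2 : v.coeff x ^ 2 / massFun (P T) x ≤ 2 / Pmin * v.coeff x ^ 2 := by
        rw [div_le_iff₀ hpx]
        have h3 : 1 ≤ 2 / Pmin * massFun (P T) x := by
          rw [div_mul_eq_mul_div, le_div_iff₀ hPmin0]
          linarith
        nlinarith [sq_nonneg (v.coeff x)]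
      have h3 : (u.coeff x + v.coeff x) ^ 2 / massFun (P T) x ≤
          2 * (u.coeff x ^ 2 / massFun (P T) x) + 2 * (v.coeff x ^ 2 / massFun (P T) x) := by
        rw [← mul_div_assoc, ← mul_div_assoc, ← add_div]
        exact div_le_div_of_nonneg_right (by nlinarith [sq_nonneg (u.coeff x - v.coeff x)]) hpx.le
      have h4 : 4 / Pmin = 2 * (2 / Pmin) := by ring
      rw [h4]
      linarith
    have husq : ∑ x ∈ Finset.range M, u.coeff x ^ 2 ≤ (2 * η) ^ 2 :=
      (sum_sq_coeff_le _ _).trans (pow_le_pow_left₀ (coeffNorm_nonneg _) hunorm 2)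
    have hvsq : ∑ x ∈ Finset.range M, v.coeff x ^ 2 ≤ (2 * (n * δ) ^ 2) ^ 2 :=
      (sum_sq_coeff_le _ _).trans (pow_le_pow_left₀ (coeffNorm_nonneg _) (hrem S T) 2)
    rw [chiSq]
    refine (Finset.sum_le_sum hterm).trans ?_
    rw [Finset.sum_add_distrib, ← Finset.mul_sum, ← Finset.mul_sum]
    have h1 := mul_le_mul_of_nonneg_left husq (by positivity : 0 ≤ 768 * (((κ : ℝ) + 1) * r))
    have h2 := mul_le_mul_of_nonneg_left hvsq (by positivity : 0 ≤ 4 / Pmin)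
    have h3 : 4 / Pmin * (2 * (n * δ) ^ 2) ^ 2 ≤ η ^ 2 := by
      rw [div_mul_eq_mul_div, div_le_iff₀ hPmin0]
      linarith
    have h4 : η ^ 2 ≤ η ^ 2 * ((κ + 1) * r) := by
      refine le_mul_of_one_le_right (sq_nonneg η) ?_
      nlinarith [Nat.cast_nonneg (α := ℝ) κ]
    linarith
  · intro S T
    have hdeg : (cubePoly κ n Q p c η S - cubePoly κ n Q p c η T).natDegree < M :=
      lt_of_le_of_lt (natDegree_sub_le _ _) (max_lt (hprob S).natDegree_lt (hprob T).natDegree_lt)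
    rw [tvDist_eq_coeffNorm (hPx S) (hPx T) hdeg, cubePoly_sub hcX']
    set v : ℝ[X] := lazyUniform κ *
      (cubeRemainder κ n Q p c η S - cubeRemainder κ n Q p c η T) with hv
    have h1 := coeffNorm_sub_le (C η * (lazyUniform κ * cubeDiff κ Q S T) + v) v
    rw [add_sub_cancel_right, coeffNorm_C_mul hη] at h1
    have h2 := (mul_le_mul_of_nonneg_left (hamming_le_coeffNorm_cubeDiff hQsep S T)
      (by norm_num : (0 : ℝ) ≤ 1 / 2)).trans (half_coeffNorm_le_lazyUniform_mul κ _)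
    have h3 := mul_le_mul_of_nonneg_left h2 hη.le
    have h4 := hrem S T
    linarith

end HardFamily

/-! ### Choice of parameters for the lower bound. -/

section LowerBound

/-- Numerical consequences of `ε` being a small power of `y`. -/
theorem parameter_bounds {ε y k : ℝ} (hε : 0 < ε) (hy : 16 ≤ y)
    (hεy : ε * y ^ 100 = 1) (hεk : ε * k ^ 3 ≤ 1) :
    8960 * (ε * k * y ^ 8) ≤ 1 ∧ 100000000 * (ε ^ 2 * y ^ 28 * k ^ 3) ≤ 1 ∧
      313600 * (ε * y ^ 12) ≤ 1 := by
  have hy1 : 1 ≤ y := by linarith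
  have h1 : 1000000000000 * (ε * y ^ 30) ≤ 1 := by
    have h2 : (1000000000000 : ℝ) ≤ y ^ 70 :=
      le_trans (by norm_num) (pow_le_pow_left₀ (by norm_num) hy 70)
    calc 1000000000000 * (ε * y ^ 30) ≤ y ^ 70 * (ε * y ^ 30) :=
          mul_le_mul_of_nonneg_right h2 (by positivity)
      _ = 1 := by rw [← hεy]; ring
  have hmono : ∀ a ≤ 30, ε * y ^ a ≤ ε * y ^ 30 := fun a ha =>
    mul_le_mul_of_nonneg_left (pow_le_pow_right₀ hy1 ha) hε.le
  have hε1 : ε ≤ 1 := by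
    have := hmono 0 (by norm_num)
    simp only [pow_zero, mul_one] at this
    linarith
  refine ⟨?_, ?_, ?_⟩
  · have h2 : (8960 * (ε * k * y ^ 8)) ^ 3 ≤ 1 := by
      have h3 : (8960 * (ε * k * y ^ 8)) ^ 3 = 8960 ^ 3 * (ε * k ^ 3) * (ε * (ε * y ^ 24)) := by ring
      have h4 : ε * (ε * y ^ 24) ≤ 1 * (ε * y ^ 24) :=
        mul_le_mul_of_nonneg_right hε1 (by positivity)
      have h5 := hmono 24 (by norm_num)
      rw [h3]
      calc 8960 ^ 3 * (ε * k ^ 3) * (ε * (ε * y ^ 24)) ≤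
            8960 ^ 3 * 1 * (ε * (ε * y ^ 24)) := by gcongr
        _ ≤ 1 := by linarith
    by_contra! h
    have h6 := one_lt_pow₀ h (n := 3) (by norm_num)
    linarith
  · have h2 : ε ^ 2 * y ^ 28 * k ^ 3 = ε * k ^ 3 * (ε * y ^ 28) := by ring
    have h3 := hmono 28 (by norm_num)
    have h4 : ε * k ^ 3 * (ε * y ^ 28) ≤ 1 * (ε * y ^ 28) :=
      mul_le_mul_of_nonneg_right hεk (by positivity)
    rw [h2]
    linarith
  · have := hmono 12 (by norm_num)
    linarith

theorem one_div_mul_pow_le {A₀ A ε k : ℝ} {d : ℕ} (hA₀ : 0 < A₀) (hA : A₀ ≤ A) (hk : 1 ≤ k)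
    (hε : ε ≤ 1 / (A * k ^ d)) : A₀ * (ε * k ^ d) ≤ 1 := by
  have hkd : 0 < k ^ d := by positivity
  have h : ε ≤ 1 / (A₀ * k ^ d) := hε.trans
    (one_div_le_one_div_of_le (by positivity) (mul_le_mul_of_nonneg_right hA hkd.le))
  rw [le_div_iff₀ (by positivity)] at h
  linarith

/-- The number of Bernoulli factors is about `log (1 / ε) / 100`. With `y = exp (l / 100)`, so that
`ε y ^ 100 = 1`, every quantity exponential in that number is a small power of `y`, and the second
order conditions hold with room to spare. The loss in `k` is at most cubic: the smallest mass
contributes `1 / k` and `η²` contributes `1 / k²`. -/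
theorem exists_lower_bound :
    ∃ A₀ c : ℝ, 1 ≤ A₀ ∧ 0 < c ∧ ∀ A : ℝ, A₀ ≤ A → ∀ (k : ℕ) (ε : ℝ), 2 ≤ k → 0 < ε →
      ε ≤ 1 / (A * (k : ℝ) ^ 3) → ∃ n : ℕ, 1 ≤ n ∧
        ∀ (N : ℕ) (𝒜 : Kernel (Fin N → ℕ) (ProbabilityMeasure ℕ)), IsMarkovKernel 𝒜 →
          ((∀ P : ProbabilityMeasure ℕ, IsSIIRV n k P → Learns 𝒜 ε P) ∨
            (∀ P : ProbabilityMeasure ℕ, IsSIIRV n k P → LearnsInExpectation 𝒜 ε P)) →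
          c * ((k : ℝ) / ε ^ 2 * Real.sqrt (Real.log (1 / ε))) ≤ (N : ℝ) := by
  refine ⟨Real.exp 400, 1 / 1000000000000000, Real.one_le_exp (by norm_num), by norm_num, ?_⟩
  intro A hA k ε hk hε hεA
  obtain ⟨κ, rfl⟩ : ∃ κ, k = κ + 1 := ⟨k - 1, by omega⟩
  have hκ : 1 ≤ κ := by omega
  have hκR : (1 : ℝ) ≤ κ := by exact_mod_cast hκ
  set K : ℝ := ((κ + 1 : ℕ) : ℝ) with hK
  have hK' : K = κ + 1 := by rw [hK]; push_cast; ring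
  have hK1 : 1 ≤ K := by linarith
  have hexp := one_div_mul_pow_le (Real.exp_pos 400) hA hK1 hεA
  have hεK : ε * K ^ 3 ≤ 1 := by
    have h1 : 1 * (ε * K ^ 3) ≤ Real.exp 400 * (ε * K ^ 3) :=
      mul_le_mul_of_nonneg_right (Real.one_le_exp (by norm_num)) (by positivity)
    linarith
  set l := Real.log (1 / ε) with hl
  have hεl : ε = Real.exp (-l) := by
    rw [hl, one_div, Real.log_inv, neg_neg, Real.exp_log hε]
  have hl400 : 400 ≤ l := by
    rw [hl, Real.le_log_iff_exp_le (by positivity), le_div_iff₀ hε]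
    have h1 : ε * 1 ≤ ε * K ^ 3 := mul_le_mul_of_nonneg_left (one_le_pow₀ hK1) hε.le
    have h2 := mul_le_mul_of_nonneg_left h1 (Real.exp_pos 400).le
    linarith
  obtain ⟨N, hN⟩ : ∃ N, ⌊l / 100⌋₊ = N + 1 := by
    have : 1 ≤ ⌊l / 100⌋₊ := Nat.le_floor (by push_cast; linarith)
    exact ⟨⌊l / 100⌋₊ - 1, by omega⟩
  have hn_le : ((N + 1 : ℕ) : ℝ) ≤ l / 100 := by rw [← hN]; exact Nat.floor_le (by linarith)
  have hN_ge : l / 200 ≤ (N : ℝ) := by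
    have h1 := Nat.lt_floor_add_one (l / 100)
    rw [hN] at h1
    push_cast at h1
    linarith
  have hN1 : 1 ≤ N := by
    have : (1 : ℝ) ≤ N := by linarith
    exact_mod_cast this
  set n : ℝ := ((N + 1 : ℕ) : ℝ) with hn
  have hn0 : 0 < n := by rw [hn]; positivity
  set y := Real.exp (l / 100) with hy
  have hy0 : 0 < y := Real.exp_pos _
  have hy16 : 16 ≤ y := by
    have h1 : Real.exp 1 ^ 4 ≤ y := by
      rw [← Real.exp_nat_mul, hy]
      exact Real.exp_le_exp.mpr (by push_cast; linarith)
    have h2 : (2 : ℝ) ^ 4 ≤ Real.exp 1 ^ 4 :=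
      pow_le_pow_left₀ (by norm_num) (by linarith [Real.add_one_le_exp (1 : ℝ)]) 4
    linarith
  have hεy : ε * y ^ 100 = 1 := by
    rw [hεl, hy, ← Real.exp_nat_mul, ← Real.exp_add]
    push_cast
    rw [show -l + 100 * (l / 100) = 0 by ring, Real.exp_zero]
  have hny : Real.exp n ≤ y := Real.exp_le_exp.mpr hn_le
  have hny' : n ≤ y := by linarith [Real.add_one_le_exp n]
  have h5n : Real.exp (5 * n) ≤ y ^ 5 := by
    have : Real.exp (5 * n) = Real.exp n ^ 5 := by rw [← Real.exp_nat_mul]; norm_num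
    rw [this]
    exact pow_le_pow_left₀ (Real.exp_pos _).le hny 5
  have h4n : 1 / y ^ 2 ≤ (1 / 4 : ℝ) ^ (N + 1) := by
    rw [one_div_pow]
    refine one_div_le_one_div_of_le (by positivity) ?_
    have h1 : (4 : ℝ) ^ (N + 1) = (2 ^ (N + 1)) ^ 2 := by rw [← pow_mul, mul_comm, pow_mul]; norm_num
    have h2 : (2 : ℝ) ^ (N + 1) ≤ Real.exp n := by
      have : Real.exp n = Real.exp 1 ^ (N + 1) := by rw [← Real.exp_nat_mul, hn, mul_one]
      rw [this]
      exact pow_le_pow_left₀ (by norm_num) (by linarith [Real.add_one_le_exp (1 : ℝ)]) _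
    rw [h1]
    exact pow_le_pow_left₀ (by positivity) (h2.trans hny) 2
  obtain ⟨hb1, hb2, hb3⟩ := parameter_bounds hε hy16 hεy hεK
  obtain ⟨m, hm_ge, hm_le, hfam⟩ := exists_hard_family hκ hN1
  set r := Real.sqrt N with hr
  have hr0 : 0 < r := Real.sqrt_pos.mpr (by exact_mod_cast hN1)
  have hm_ge' : K * r / 12 ≤ m := by
    refine le_trans ?_ hm_ge
    rw [hK']
    have := mul_le_mul_of_nonneg_right hκR hr0.le
    linarith
  have hm0 : (0 : ℝ) < m := lt_of_lt_of_le (by positivity) hm_ge'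
  have hm_le' : (m : ℝ) ≤ y * K := by
    have h1 : (m : ℝ) ≤ n * κ := by rw [hn]; exact_mod_cast hm_le
    refine h1.trans (mul_le_mul hny' (by linarith) (by linarith) hy0.le)
  -- Distributions within `6 ε` have `η * hamming / 4 ≤ 7 ε` once the remainder is at most `ε`,
  -- hence `hamming ≤ m / 10`, as Assouad's method requires.
  set η := 280 * ε / m with hη
  have hη0 : 0 < η := by positivity
  set δ := 2 * η * (m * Real.exp (5 * n)) with hδ
  have hδ' : δ = 560 * ε * Real.exp (5 * n) := by
    rw [hδ, hη]; field_simp; norm_num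
  have hδ0 : 0 ≤ δ := by rw [hδ']; positivity
  have hnδ : n * δ ≤ 560 * (ε * y ^ 6) := by
    rw [hδ']
    calc n * (560 * ε * Real.exp (5 * n)) ≤ y * (560 * ε * y ^ 5) := by gcongr
      _ = 560 * (ε * y ^ 6) := by ring
  have hnδ0 : 0 ≤ n * δ := by positivity
  have hnδ2 : (n * δ) ^ 2 ≤ 313600 * (ε ^ 2 * y ^ 12) :=
    (pow_le_pow_left₀ hnδ0 hnδ 2).trans (le_of_eq (by ring))
  obtain ⟨J, iF, iD, P, M, hcard, hPS, hsupp, hpos, hchi, htv⟩ := hfam η δ hη0 hδ (by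
      rw [← hK']
      refine le_trans ?_ (div_le_div_of_nonneg_right h4n (by positivity))
      rw [div_div, le_div_iff₀ (by positivity)]
      calc 2 * (n * δ) * (y ^ 2 * (8 * K)) ≤ 2 * (560 * (ε * y ^ 6)) * (y ^ 2 * (8 * K)) := by gcongr
        _ = 8960 * (ε * K * y ^ 8) := by ring
        _ ≤ 1 := hb1) (by
      rw [← hK']
      have hη_ge : 280 * ε / (y * K) ≤ η :=
        div_le_div_of_nonneg_left (by positivity) hm0 hm_le'
      have h1 : 1 / y ^ 2 / (4 * K) * (280 * ε / (y * K)) ^ 2 ≤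
          (1 / 4 : ℝ) ^ (N + 1) / (4 * K) * η ^ 2 := by gcongr
      refine le_trans ?_ h1
      have h2 : 1 / y ^ 2 / (4 * K) * (280 * ε / (y * K)) ^ 2 =
          19600 * ε ^ 2 / (y ^ 4 * K ^ 3) := by
        field_simp; norm_num
      rw [h2, le_div_iff₀ (by positivity)]
      calc 16 * ((n * δ) ^ 2) ^ 2 * (y ^ 4 * K ^ 3)
          ≤ 16 * (313600 * (ε ^ 2 * y ^ 12)) ^ 2 * (y ^ 4 * K ^ 3) := by gcongr
        _ = 16 * 313600 ^ 2 * ε ^ 2 * (ε ^ 2 * y ^ 28 * K ^ 3) := by ring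
        _ ≤ 19600 * 100000000 * ε ^ 2 * (ε ^ 2 * y ^ 28 * K ^ 3) := by
            have h3 : 0 ≤ ε ^ 2 * (ε ^ 2 * y ^ 28 * K ^ 3) := by positivity
            linarith
        _ = 19600 * ε ^ 2 * (100000000 * (ε ^ 2 * y ^ 28 * K ^ 3)) := by ring
        _ ≤ 19600 * ε ^ 2 * 1 := by gcongr
        _ = 19600 * ε ^ 2 := by ring)
  have hρ : (n * δ) ^ 2 ≤ ε := by
    refine hnδ2.trans ?_
    calc 313600 * (ε ^ 2 * y ^ 12) = ε * (313600 * (ε * y ^ 12)) := by ring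
      _ ≤ ε * 1 := by gcongr
      _ = ε := mul_one ε
  refine ⟨N + 2, by omega, fun Ns 𝒜 h𝒜 hlearn => ?_⟩
  have hlearn3 : ∀ S, Learns 𝒜 (3 * ε) (P S) := by
    intro S
    rcases hlearn with h | h
    · exact (h _ (hPS S)).mono (by linarith)
    · exact (h _ (hPS S)).learns hε
  have hJ : Nonempty J := by
    rw [← Fintype.card_pos_iff, hcard]
    exact_mod_cast hm0
  have hfin := one_lt_mul_of_learns (by positivity) hsupp hpos hchi (ε := ε) (fun S T hST => by
    have h1 := htv S T
    have h2 : η * hamming S T ≤ 28 * ε := by linarith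
    rw [hη, div_mul_eq_mul_div, div_le_iff₀ hm0] at h2
    have h3 : (10 * hamming S T : ℝ) ≤ m := by
      have h4 : (28 * ε) * (10 * hamming S T) ≤ (28 * ε) * m := by linarith
      exact le_of_mul_le_mul_left h4 (by positivity)
    rw [hcard]
    exact_mod_cast h3) 𝒜 hlearn3
  rw [← hK'] at hfin
  -- Since `m` is at least of order `K r`, the chi-square divergence of neighbours is of order `ε² /
  -- (K r)`, with `r` of order `√ (log (1 / ε))`.
  have hγ : η ^ 2 * (K * r) ≤ 280 ^ 2 * 144 * ε ^ 2 / (K * r) := by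
    have h1 : η ≤ 280 * ε / (K * r / 12) := div_le_div_of_nonneg_left (by positivity)
      (by positivity) hm_ge'
    calc η ^ 2 * (K * r) ≤ (280 * ε / (K * r / 12)) ^ 2 * (K * r) := by gcongr
      _ = 280 ^ 2 * 144 * ε ^ 2 / (K * r) := by field_simp; norm_num
  have h1 : 1 < 800 * (Ns * (3073 * (280 ^ 2 * 144 * ε ^ 2 / (K * r)))) :=
    lt_of_lt_of_le hfin (by gcongr)
  have h2 : K * r < 800 * 3073 * 280 ^ 2 * 144 * (Ns * ε ^ 2) := by
    have h3 : 800 * (Ns * (3073 * (280 ^ 2 * 144 * ε ^ 2 / (K * r)))) =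
        800 * 3073 * 280 ^ 2 * 144 * (Ns * ε ^ 2) / (K * r) := by ring
    rw [h3, lt_div_iff₀ (by positivity), one_mul] at h1
    exact h1
  have hrl : Real.sqrt l ≤ 15 * r := by
    rw [Real.sqrt_le_left (by positivity), mul_pow, hr, Real.sq_sqrt (Nat.cast_nonneg N)]
    linarith
  have h4 : K * Real.sqrt l ≤ 15 * (K * r) := by
    have := mul_le_mul_of_nonneg_left hrl (by linarith : 0 ≤ K)
    linarith
  have h5 : 1 / 1000000000000000 * (K / ε ^ 2 * Real.sqrt l) =
      1 / 1000000000000000 * (K * Real.sqrt l) / ε ^ 2 := by ring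
  rw [h5, div_le_iff₀ (by positivity)]
  have h6 : 0 ≤ (Ns : ℝ) * ε ^ 2 := by positivity
  linarith

end LowerBound
theorem theorem2 :
    ∃ (A c C : ℝ) (d : ℕ), 1 ≤ A ∧ 0 < c ∧ 0 < C ∧
      ∀ (k : ℕ) (ε : ℝ), 1 ≤ k → 0 < ε → ε ≤ 1 / (A * (k : ℝ) ^ d) →
        -- upper bound: one algorithm for all orders `n`
        (∃ (N : ℕ) (𝒜 : Kernel (Fin N → ℕ) (ProbabilityMeasure ℕ)), IsMarkovKernel 𝒜 ∧
          (N : ℝ) ≤ C * ((k : ℝ) / ε ^ 2 * Real.sqrt (Real.log (1 / ε))) ∧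
          ∀ (n : ℕ) (P : ProbabilityMeasure ℕ), 1 ≤ n → IsSIIRV n k P → Learns 𝒜 ε P) ∧
        -- lower bound: already for a single order `n`, which the algorithm may know
        (2 ≤ k → ∃ n : ℕ, 1 ≤ n ∧
          ∀ (N : ℕ) (𝒜 : Kernel (Fin N → ℕ) (ProbabilityMeasure ℕ)), IsMarkovKernel 𝒜 →
            ((∀ P : ProbabilityMeasure ℕ, IsSIIRV n k P → Learns 𝒜 ε P) ∨
              (∀ P : ProbabilityMeasure ℕ, IsSIIRV n k P → LearnsInExpectation 𝒜 ε P)) →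
            c * ((k : ℝ) / ε ^ 2 * Real.sqrt (Real.log (1 / ε))) ≤ (N : ℝ)) := by
  obtain ⟨A₁, C, hA₁, hC, hupper⟩ := exists_upper_bound
  obtain ⟨A₂, c, _, hc, hlower⟩ := exists_lower_bound
  -- The exponent `3` is dictated by the lower bound; the upper bound accepts any positive exponent.
  refine ⟨max A₁ A₂, c, C, 3, hA₁.trans (le_max_left _ _), hc, hC, fun k ε hk hε hεA => ⟨?_, ?_⟩⟩
  · exact hupper _ 3 (le_max_left _ _) (by norm_num) k ε hk hε hεA
  · exact fun hk2 => hlower _ (le_max_right _ _) k ε hk2 hε hεA
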